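/- Let $Q=(0,\infty)\times(0,\infty)$ and $\bar Q=[0,\infty)\times[0,\infty)$. Let $u_0\in\mathcal S([0,\infty))$, $g_0\in C^\infty([0,\infty))$ and $f\in C^\infty(\bar Q)$ be complex-valued, with $f(\cdot,t)\in\mathcal S([0,\infty))$ uniformly for $t$ in compact subsets of $[0,\infty)$ (that is, $\sup_{x\ge 0,\,0\le t\le T}x^{\ell}|\partial_x^k f(x,t)|<\infty$ for all $k,\ell\in\mathbb N$ and $T>0$). Assume the compatibility conditions $$u_0(0)=g_0(0),\qquad u_0''(0)+f(0,0)=g_0'(0).$$ Put, for $\operatorname{Im}\lambda\le 0$, $\hat u_0(\lambda)=\int_0^\infty e^{-i\lambda y}u_0(y)\,dy$, $\hat f(\lambda,t)=\int_0^\infty e^{-i\lambda y}f(y,t)\,dy$ and $\tilde f(\lambda,t)=\int_0^t e^{\lambda^2\tau}\hat f(\lambda,\tau)\,d\tau$, and, for $\lambda\in\mathbb C$, $\tilde g_0(\lambda,t)=\int_0^t e^{\lambda^2\tau}g_0(\tau)\,d\tau$. Let $\gamma$ be the positively oriented boundary of $\{\lambda\in\mathbb C:\operatorname{Im}\lambda\ge0,\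 \operatorname{Re}(\lambda^2)\le0\}$ (from $\infty e^{3\pi i/4}$ through $0$ to $\infty e^{\pi i/4}$). For $x>0$, $t>0$ define $$2\pi U(x,t)=\int_{-\infty}^{\infty}e^{i\lambda x-\lambda^2t}\hat u_0(\lambda)\,d\lambda-\int_\gamma e^{i\lambda x-\lambda^2t}\hat u_0(-\lambda)\,d\lambda-\int_\gamma e^{i\lambda x-\lambda^2t}\,2i\lambda\,\tilde g_0(\lambda,t)\,d\lambda+\int_{-\infty}^{\infty}e^{i\lambda x-\lambda^2t}\tilde f(\lambda,t)\,d\lambda-\int_\gamma e^{i\lambda x-\lambda^2t}\tilde f(-\lambda,t)\,d\lambda ,$$ and extend $U$ by $U(x,0)=u_0(x)$ for $x>0$ and $U(0,t)=g_0(t)$ for $t>0$. Then all these integrals converge absolutely, and $U$ is the unique function $V:\bar Q\setminus\{(0,0)\}\to\mathbb C$ with the following properties: (i) $V$ is of class $C^2$ in $\bar Q\setminus\{(0,0)\}$ and solves $$V_t-V_{xx}=f\ \text{ in } Q,\qquad \lim_{t\to0^+}V(x,t)=u_0(x)\ (x>0),\qquad \lim_{x\to0^+}V(x,t)=g_0(t)\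 (t>0);$$ (ii) for every $t>0$, $\lim_{x\to\infty}V(x,t)=0$ and $\sup_{x\ge1}|V_x(x,t)|<\infty$; (iii) for every $T>0$ there is a positive function $B_T$ with $\int_0^\infty B_T(x)\,dx<\infty$ such that $|V(x,t)|^2\le B_T(x)$ and $|V_t(x,t)|^2\le B_T(x)$ for all $x>0$ and $0<t\le T$. That is, $U$ itself satisfies (i)-(iii), and every $V$ satisfying (i)-(iii) equals $U$ on $\bar Q\setminus\{(0,0)\}$. -/

import Mathlib

open Set Filter Topology MeasureTheory
open scoped ContDiff

noncomputable section

namespace HeatUTM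

/-- The closed quarter-plane. -/
def Qbar : Set (ℝ × ℝ) := {p | 0 ≤ p.1 ∧ 0 ≤ p.2}

/-- The closed quarter-plane without its corner. -/
def QbarPunctured : Set (ℝ × ℝ) := Qbar \ {(0, 0)}

/-- `u ∈ 𝒮([0, ∞))`: smooth on `[0, ∞)` (one-sided at `0`), every derivative rapidly decreasing. -/
def IsSchwartzHalfLine (u : ℝ → ℂ) : Prop :=
  ContDiffOn ℝ ∞ u (Ici 0) ∧
    ∀ k l : ℕ, ∃ C : ℝ, ∀ x : ℝ, 0 ≤ x → x ^ l * ‖iteratedDerivWithin k u (Ici 0) x‖ ≤ C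

/-- `f ∈ C^∞(Q̄)` with `f(·, t) ∈ 𝒮([0, ∞))` uniformly for `t` in compact subsets of `[0, ∞)`. -/
def IsAdmissibleForcing (f : ℝ × ℝ → ℂ) : Prop :=
  ContDiffOn ℝ ∞ f Qbar ∧
    ∀ (k l : ℕ) (T : ℝ), ∃ C : ℝ, ∀ x t : ℝ, 0 ≤ x → 0 ≤ t → t ≤ T →
      x ^ l * ‖iteratedDerivWithin k (fun y => f (y, t)) (Ici 0) x‖ ≤ C

/-- `û(lam) = ∫_0^∞ e^{-i lam y} u(y) dy`, used for `Im lam ≤ 0`. -/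
def hat (u : ℝ → ℂ) (lam : ℂ) : ℂ :=
  ∫ y in Ioi (0 : ℝ), Complex.exp (-(Complex.I * lam * (y : ℂ))) * u y

/-- `g̃₀(lam, t) = ∫_0^t e^{lam² τ} g₀(τ) dτ`. -/
def gTilde (g₀ : ℝ → ℂ) (lam : ℂ) (t : ℝ) : ℂ :=
  ∫ τ in (0 : ℝ)..t, Complex.exp (lam ^ 2 * (τ : ℂ)) * g₀ τ

/-- `f̃(lam, t) = ∫_0^t e^{lam² τ} f̂(lam, τ) dτ`, used for `Im lam ≤ 0`. -/
def fTilde (f : ℝ × ℝ → ℂ) (lam : ℂ) (t : ℝ) : ℂ :=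
  ∫ τ in (0 : ℝ)..t, Complex.exp (lam ^ 2 * (τ : ℂ)) * hat (fun y => f (y, τ)) lam

/-- The factor `e^{i lam x - lam² t}`. -/
def kernel (x t : ℝ) (lam : ℂ) : ℂ :=
  Complex.exp (Complex.I * lam * (x : ℂ) - lam ^ 2 * (t : ℂ))

/-- `∫_γ F(lam) dlam`, where `γ` is the positively oriented boundary of the sector
`{Im lam ≥ 0, Re (lam²) ≤ 0} = {π/4 ≤ arg lam ≤ 3π/4} ∪ {0}`: it comes in from infinity along the
ray through `-1 + i`, and goes out to infinity along the ray through `1 + i`. -/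
def gammaIntegral (F : ℂ → ℂ) : ℂ :=
  (∫ s in Ioi (0 : ℝ), F ((s : ℂ) * (1 + Complex.I)) * (1 + Complex.I)) -
    ∫ s in Ioi (0 : ℝ), F ((s : ℂ) * (-1 + Complex.I)) * (-1 + Complex.I)

/-- Absolute convergence of `∫_γ F(lam) dlam`. -/
def GammaIntegrable (F : ℂ → ℂ) : Prop :=
  IntegrableOn (fun s : ℝ => F ((s : ℂ) * (1 + Complex.I))) (Ioi 0) ∧
    IntegrableOn (fun s : ℝ => F ((s : ℂ) * (-1 + Complex.I))) (Ioi 0)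

/-- The unified transform formula, for `x > 0` and `t > 0`. -/
def utm (u₀ g₀ : ℝ → ℂ) (f : ℝ × ℝ → ℂ) (x t : ℝ) : ℂ :=
  (1 / (2 * (Real.pi : ℂ))) *
    ((∫ lam : ℝ, kernel x t lam * hat u₀ lam)
      - gammaIntegral (fun lam => kernel x t lam * hat u₀ (-lam))
      - gammaIntegral (fun lam => kernel x t lam * (2 * Complex.I * lam * gTilde g₀ lam t))
      + (∫ lam : ℝ, kernel x t lam * fTilde f lam t)
      - gammaIntegral (fun lam => kernel x t lam * fTilde f (-lam) t))

/-- The five integrals in the unified transform formula converge absolutely at `(x, t)`. -/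
def UTMConverges (u₀ g₀ : ℝ → ℂ) (f : ℝ × ℝ → ℂ) (x t : ℝ) : Prop :=
  Integrable (fun lam : ℝ => kernel x t lam * hat u₀ lam) ∧
  GammaIntegrable (fun lam => kernel x t lam * hat u₀ (-lam)) ∧
  GammaIntegrable (fun lam => kernel x t lam * (2 * Complex.I * lam * gTilde g₀ lam t)) ∧
  Integrable (fun lam : ℝ => kernel x t lam * fTilde f lam t) ∧
  GammaIntegrable (fun lam => kernel x t lam * fTilde f (-lam) t)

/-- The function `U` on the punctured closed quarter-plane: the unified transform formula for `x, t > 0`,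
extended by `U(x, 0) = u₀(x)` for `x > 0` and `U(0, t) = g₀(t)` for `t > 0`
(values elsewhere play no role). -/
def utmSolution (u₀ g₀ : ℝ → ℂ) (f : ℝ × ℝ → ℂ) (p : ℝ × ℝ) : ℂ :=
  if p.1 ≤ 0 then g₀ p.2 else if p.2 ≤ 0 then u₀ p.1 else utm u₀ g₀ f p.1 p.2

/-- `V` solves the forced heat equation for `x, t > 0` with initial data `u₀` and Dirichlet data `g₀`,
both attained in the sense of limits. -/
structure SolvesIBVP (u₀ g₀ : ℝ → ℂ) (f : ℝ × ℝ → ℂ) (V : ℝ × ℝ → ℂ) : Prop where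
  pde : ∀ x t : ℝ, 0 < x → 0 < t →
    deriv (fun s => V (x, s)) t - iteratedDeriv 2 (fun y => V (y, t)) x = f (x, t)
  initial : ∀ x : ℝ, 0 < x → Tendsto (fun t => V (x, t)) (𝓝[>] 0) (𝓝 (u₀ x))
  boundary : ∀ t : ℝ, 0 < t → Tendsto (fun x => V (x, t)) (𝓝[>] 0) (𝓝 (g₀ t))

/-- The class of solutions in which uniqueness is asserted. -/
structure IsClassSolution (u₀ g₀ : ℝ → ℂ) (f : ℝ × ℝ → ℂ) (V : ℝ × ℝ → ℂ) : Prop where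
  contDiffOn : ContDiffOn ℝ 2 V QbarPunctured
  solves : SolvesIBVP u₀ g₀ f V
  tendsto_zero : ∀ t : ℝ, 0 < t → Tendsto (fun x => V (x, t)) atTop (𝓝 0)
  deriv_x_bounded : ∀ t : ℝ, 0 < t →
    ∃ C : ℝ, ∀ x : ℝ, 1 ≤ x → ‖deriv (fun y => V (y, t)) x‖ ≤ C
  dominated : ∀ T : ℝ, 0 < T → ∃ B : ℝ → ℝ,
    (∀ x, 0 < x → 0 < B x) ∧ IntegrableOn B (Ioi 0) ∧
    ∀ x t : ℝ, 0 < x → 0 < t → t ≤ T →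
      ‖V (x, t)‖ ^ 2 ≤ B x ∧ ‖deriv (fun s => V (x, s)) t‖ ^ 2 ≤ B x

end HeatUTM

end

noncomputable section

namespace HeatUTM

/-! The formula is the classical half-line solution written in Fourier variables. Inserting the
definitions of the transforms turns each of the five integrals into a superposition of exponentials
e^{iλz - λ²σ}, so Fubini leaves only two explicit integrals. Over the real line such an exponential
gives 2π times the heat kernel; over γ, for z > 0, the contour rotates back to the real line and
gives the same value (`gammaIntegral_kernel`). The extra factor 2iλ is removed by integrating an
exact derivative along γ and produces -2π times the Poisson kernel (`gammaIntegral_mul_kernel`).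
Hence `utm_eq_halfLine`: U is the heat evolution of the odd reflection of u₀, plus the Poisson
integral of g₀, plus Duhamel's integral of the odd reflection of f. Absolute convergence comes from
the same Fubini argument.

In this form smoothness up to the sides is not visible: the odd reflections jump at x = 0 and the
Poisson kernel degenerates there. The remedy is a boundary layer W = ∑ w_i(t) e^{-(i+1)x} for which
W, W_xx and W_xxxx take at x = 0 the values that the equation forces on a smooth solution: g₀, a =
g₀' - f(0,·) and a' - f_xx(0,·). Then u₀ - W(·,0) and f - (W_t - W_xx) vanish at x = 0 together with
their second x-derivatives; for the initial data this is exactly the two compatibility conditions.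
Their odd reflections can be differentiated four times in x, with at most a jump in the last
derivative, and that suffices for a C² solution away from the corner (`contDiffOn_two_heat`,
`contDiffOn_two_duhamel`). Decay like 1/(1+x²) is preserved throughout and yields the growth
conditions (`isClassSolution_superposition`).

The layer W obeys the half-line representation with its own data (`expSum_eq_halfLine`). Adding
representations by linearity identifies W plus the two corrected terms with U.

Uniqueness is the energy method (`eq_zero_of_homogeneous`): the L² norm of the difference of two
solutions does not increase in time and tends to 0 as t → 0+. -/

/-- The density `e^{-z²/4} / √(4π)` of the heat kernel at time one. -/
def gaussDensity (z : ℝ) : ℝ := (√(4 * Real.pi))⁻¹ * Real.exp (-(1 / 4) * z ^ 2)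

/-- The average of `F (·, s)` around `x` against the heat kernel of width `a = √t`. -/
def gaussAvg (F : ℝ × ℝ → ℂ) (x a s : ℝ) : ℂ := ∫ z : ℝ, (gaussDensity z : ℂ) * F (x + a * z, s)

lemma gaussDensity_pos (z : ℝ) : 0 < gaussDensity z := by
  unfold gaussDensity; positivity

lemma continuous_gaussDensity : Continuous gaussDensity := by
  unfold gaussDensity; fun_prop

lemma gaussDensity_neg (z : ℝ) : gaussDensity (-z) = gaussDensity z := by
  simp [gaussDensity]

lemma integrable_gaussDensity : Integrable gaussDensity :=
  (integrable_exp_neg_mul_sq (by norm_num)).const_mul _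

lemma integral_gaussDensity : ∫ z, gaussDensity z = 1 := by
  unfold gaussDensity
  rw [integral_const_mul, integral_gaussian, div_div_eq_mul_div, div_one, mul_comm Real.pi]
  exact inv_mul_cancel₀ (by positivity)

lemma integrable_sq_mul_gaussDensity : Integrable fun z => z ^ 2 * gaussDensity z := by
  have h := (integrable_rpow_mul_exp_neg_mul_sq (b := 1 / 4) (by norm_num) (s := 2)
    (by norm_num)).const_mul (√(4 * Real.pi))⁻¹
  refine h.congr (Eventually.of_forall fun z => ?_)
  simp only [gaussDensity, Real.rpow_two]
  ring

lemma integrable_abs_mul_gaussDensity : Integrable fun z => |z| * gaussDensity z := by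
  refine (integrable_gaussDensity.add integrable_sq_mul_gaussDensity).mono'
    (continuous_abs.mul continuous_gaussDensity).aestronglyMeasurable
    (Eventually.of_forall fun z => ?_)
  have h := gaussDensity_pos z
  rw [Real.norm_of_nonneg (by positivity)]
  have : |z| ≤ 1 + z ^ 2 := by nlinarith [sq_abs z, sq_nonneg (|z| - 1), abs_nonneg z]
  simp only [Pi.add_apply]
  nlinarith

lemma hasDerivAt_gaussDensity (z : ℝ) :
    HasDerivAt gaussDensity (-(z / 2) * gaussDensity z) z := by
  have h : HasDerivAt (fun z : ℝ => -(1 / 4) * z ^ 2) (-(z / 2)) z := by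
    refine ((hasDerivAt_pow 2 z).const_mul (-(1 / 4) : ℝ)).congr_deriv ?_
    simp; ring
  refine (h.exp.const_mul (√(4 * Real.pi))⁻¹).congr_deriv ?_
  unfold gaussDensity; ring

lemma tendsto_gaussDensity_cocompact : Tendsto gaussDensity (cocompact ℝ) (𝓝 0) := by
  have h := (tendsto_rpow_abs_mul_exp_neg_mul_sq_cocompact (a := 1 / 4) (by norm_num) 0).const_mul
    (√(4 * Real.pi))⁻¹
  simp only [Real.rpow_zero, one_mul, mul_zero] at h
  exact h

/-- A measurable function of `(x, s)`, bounded for `s` bounded above and continuous off the line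
`x = 0`. -/
structure Tame (F : ℝ × ℝ → ℂ) : Prop where
  measurable : Measurable F
  bounded : ∀ T : ℝ, ∃ C : ℝ, ∀ x s, s ≤ T → ‖F (x, s)‖ ≤ C
  continuousAt : ∀ x s, x ≠ 0 → ContinuousAt F (x, s)

/-- `F` is continuous in `x`, and `F'` is its derivative in `x` off the line `x = 0`. -/
structure IsXDeriv (F F' : ℝ × ℝ → ℂ) : Prop where
  continuous : ∀ s, Continuous fun x => F (x, s)
  hasDerivAt : ∀ x s, x ≠ 0 → HasDerivAt (fun y => F (y, s)) (F' (x, s)) x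

/-! ### The heat semigroup as a Gaussian average of width √t. -/

section GaussAvg

variable {F F' F'' : ℝ × ℝ → ℂ}

lemma Tame.exists_nonneg_bound (hF : Tame F) (T : ℝ) :
    ∃ C : ℝ, 0 ≤ C ∧ ∀ x s, s ≤ T → ‖F (x, s)‖ ≤ C := by
  obtain ⟨C, hC⟩ := hF.bounded T
  exact ⟨C, (norm_nonneg _).trans (hC 0 T le_rfl), hC⟩

lemma integrable_mul_gaussDensity {G : ℝ → ℂ} (hG : Measurable G) {C : ℝ} (hC : ∀ z, ‖G z‖ ≤ C) :
    Integrable fun z => (gaussDensity z : ℂ) * G z := by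
  refine (integrable_gaussDensity.mul_const C).mono'
    ((Complex.measurable_ofReal.comp continuous_gaussDensity.measurable).mul
      hG).aestronglyMeasurable (Eventually.of_forall fun z => ?_)
  rw [norm_mul, Complex.norm_of_nonneg (gaussDensity_pos z).le]
  exact mul_le_mul_of_nonneg_left (hC z) (gaussDensity_pos z).le

lemma Tame.measurable_comp (hF : Tame F) (x a s : ℝ) : Measurable fun z => F (x + a * z, s) :=
  hF.measurable.comp (by fun_prop)

lemma Tame.integrable (hF : Tame F) (x a s : ℝ) :
    Integrable fun z => (gaussDensity z : ℂ) * F (x + a * z, s) := by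
  obtain ⟨C, hC⟩ := hF.bounded s
  exact integrable_mul_gaussDensity (hF.measurable_comp x a s) fun z => hC _ _ le_rfl

lemma norm_gaussAvg_le {C : ℝ} {s : ℝ} (hC : ∀ x, ‖F (x, s)‖ ≤ C) (x a : ℝ) :
    ‖gaussAvg F x a s‖ ≤ C := by
  refine (norm_integral_le_of_norm_le (integrable_gaussDensity.mul_const C)
    (Eventually.of_forall fun z => ?_)).trans_eq ?_
  · rw [norm_mul, Complex.norm_of_nonneg (gaussDensity_pos z).le]
    exact mul_le_mul_of_nonneg_left (hC _) (gaussDensity_pos z).le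
  · rw [integral_mul_const, integral_gaussDensity, one_mul]

lemma gaussAvg_zero (x s : ℝ) : gaussAvg F x 0 s = F (x, s) := by
  simp only [gaussAvg, zero_mul, add_zero, integral_mul_const]
  rw [integral_complex_ofReal, integral_gaussDensity]; simp

lemma Tame.gaussAvg_add {G : ℝ × ℝ → ℂ} (hF : Tame F) (hG : Tame G) (x a s : ℝ) :
    gaussAvg (F + G) x a s = gaussAvg F x a s + gaussAvg G x a s := by
  simp only [gaussAvg, Pi.add_apply, mul_add]
  exact integral_add (hF.integrable x a s) (hG.integrable x a s)

/-- The Gaussian weight is even, so z ↦ -z changes the sign of the integral. This is how odd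
reflection produces the zero Dirichlet condition. -/
lemma gaussAvg_zero_of_odd {a s : ℝ} (hodd : ∀ x, F (-x, s) = -F (x, s)) :
    gaussAvg F 0 a s = 0 := by
  have h : gaussAvg F 0 a s = -gaussAvg F 0 a s := by
    unfold gaussAvg
    refine (integral_neg_eq_self _ volume).symm.trans ?_
    rw [← integral_neg]
    refine integral_congr_ae (Eventually.of_forall fun z => ?_)
    have := hodd (a * z)
    simp only [gaussDensity_neg, zero_add, mul_neg, this]
  exact self_eq_neg.1 h

lemma Tame.measurable_gaussAvg (hF : Tame F) :
    Measurable fun q : ℝ × ℝ × ℝ => gaussAvg F q.1 q.2.1 q.2.2 := by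
  have h : Measurable fun p : (ℝ × ℝ × ℝ) × ℝ =>
      (gaussDensity p.2 : ℂ) * F (p.1.1 + p.1.2.1 * p.2, p.1.2.2) := by
    have h1 := continuous_gaussDensity.measurable
    exact (by fun_prop : Measurable fun p : (ℝ × ℝ × ℝ) × ℝ => (gaussDensity p.2 : ℂ)).mul
      (hF.measurable.comp (by fun_prop))
  exact h.stronglyMeasurable.integral_prod_right.measurable

/-- The averaging line meets the possible discontinuity x = 0 in at most one z, except when x = a =
0. With a = √t that exception is the corner of the quarter-plane, the only point where continuity
may be lost. -/
lemma ae_add_mul_ne_zero {x a : ℝ} (h : x ≠ 0 ∨ a ≠ 0) : ∀ᵐ z : ℝ, x + a * z ≠ 0 := by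
  by_cases ha : a = 0
  · exact Eventually.of_forall fun z => by simpa [ha] using h
  · have : ∀ᵐ z : ℝ, z ≠ -x / a := by simp [ae_iff, measure_singleton]
    filter_upwards [this] with z hz h0
    exact hz (by field_simp; linarith)

lemma Tame.continuousAt_gaussAvg (hF : Tame F) {x a : ℝ} (h : x ≠ 0 ∨ a ≠ 0) (s : ℝ) :
    ContinuousAt (fun q : ℝ × ℝ × ℝ => gaussAvg F q.1 q.2.1 q.2.2) (x, a, s) := by
  obtain ⟨C, hC⟩ := hF.bounded (s + 1)
  refine continuousAt_of_dominated (bound := fun z => gaussDensity z * C)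
    (Eventually.of_forall fun q => (hF.integrable q.1 q.2.1 q.2.2).aestronglyMeasurable) ?_
    (integrable_gaussDensity.mul_const C) ?_
  · have : ∀ᶠ q : ℝ × ℝ × ℝ in 𝓝 (x, a, s), q.2.2 < s + 1 :=
      (continuous_snd.comp continuous_snd).continuousAt.eventually_lt continuousAt_const
        (by simp)
    filter_upwards [this] with q hq
    refine Eventually.of_forall fun z => ?_
    rw [norm_mul, Complex.norm_of_nonneg (gaussDensity_pos z).le]
    exact mul_le_mul_of_nonneg_left (hC _ _ hq.le) (gaussDensity_pos z).le
  · filter_upwards [ae_add_mul_ne_zero h] with z hz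
    refine continuousAt_const.mul (ContinuousAt.comp (g := F)
      (f := fun q : ℝ × ℝ × ℝ => (q.1 + q.2.1 * z, q.2.2)) (hF.continuousAt _ _ hz) ?_)
    fun_prop

/-- The fundamental theorem of calculus tolerates one exceptional point for a continuous function.
The Lipschitz bound is the domination needed to differentiate Gaussian averages: the kink sits at a
z that moves with x and a, so no fixed z is differentiable for all parameters. -/
lemma IsXDeriv.norm_sub_le (hd : IsXDeriv F F') (hF' : Tame F') {C s : ℝ}
    (hC : ∀ x, ‖F' (x, s)‖ ≤ C) (x y : ℝ) : ‖F (y, s) - F (x, s)‖ ≤ C * |y - x| := by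
  have hm : Measurable fun x => F' (x, s) := hF'.measurable.comp (by fun_prop)
  have hint : IntervalIntegrable (fun x => F' (x, s)) volume x y := by
    refine (intervalIntegrable_const (c := C)).mono_fun hm.aestronglyMeasurable ?_
    exact Eventually.of_forall fun z => (hC z).trans (le_abs_self C)
  rw [← integral_eq_of_hasDerivAt_off_countable (fun x => F (x, s)) (fun x => F' (x, s))
    (countable_singleton 0) (hd.continuous s).continuousOn
    (fun z hz => hd.hasDerivAt z s hz.2) hint]
  exact intervalIntegral.norm_integral_le_of_norm_le_const fun z _ => hC z

lemma IsXDeriv.hasDerivAt_gaussAvg (hd : IsXDeriv F F') (hF : Tame F) (hF' : Tame F')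
    {x a : ℝ} (h : x ≠ 0 ∨ a ≠ 0) (s : ℝ) :
    HasDerivAt (fun x => gaussAvg F x a s) (gaussAvg F' x a s) x := by
  obtain ⟨C, hC0, hC⟩ := hF'.exists_nonneg_bound s
  refine (hasDerivAt_integral_of_dominated_loc_of_lip (bound := fun z => gaussDensity z * C)
    univ_mem (Eventually.of_forall fun x => (hF.integrable x a s).aestronglyMeasurable)
    (hF.integrable x a s) (hF'.integrable x a s).aestronglyMeasurable
    (Eventually.of_forall fun z => ?_) (integrable_gaussDensity.mul_const C) ?_).2
  · refine LipschitzOnWith.of_dist_le_mul fun y _ y' _ => ?_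
    have h0 := (gaussDensity_pos z).le
    rw [dist_eq_norm, ← mul_sub, norm_mul, Complex.norm_of_nonneg h0, Real.coe_nnabs,
      abs_of_nonneg (mul_nonneg h0 hC0), mul_assoc]
    refine mul_le_mul_of_nonneg_left ?_ h0
    refine (hd.norm_sub_le hF' (fun x => hC x s le_rfl) _ _).trans_eq ?_
    rw [Real.dist_eq, add_sub_add_right_eq_sub]
  · filter_upwards [ae_add_mul_ne_zero h] with z hz
    exact ((hd.hasDerivAt _ s hz).comp_add_const x (a * z)).const_mul _

/-- Gaussian integration by parts. -/
lemma IsXDeriv.integral_mul_gaussDensity (hd : IsXDeriv F F') (hF : Tame F) (hF' : Tame F')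
    (x : ℝ) {a : ℝ} (ha : a ≠ 0) (s : ℝ) :
    ∫ z : ℝ, (gaussDensity z : ℂ) * (z * F (x + a * z, s)) = 2 * a * gaussAvg F' x a s := by
  obtain ⟨C, hC0, hC⟩ := hF.exists_nonneg_bound s
  have h1 : Integrable fun z : ℝ => (gaussDensity z : ℂ) * (z * F (x + a * z, s)) := by
    refine (integrable_abs_mul_gaussDensity.mul_const C).mono'
      ((Complex.measurable_ofReal.comp continuous_gaussDensity.measurable).mul
        (Complex.measurable_ofReal.mul (hF.measurable_comp x a s))).aestronglyMeasurable
      (Eventually.of_forall fun z => ?_)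
    have h0 := gaussDensity_pos z
    rw [norm_mul, norm_mul, Complex.norm_of_nonneg h0.le, Complex.norm_real, Real.norm_eq_abs]
    calc _ = |z| * gaussDensity z * ‖F (x + a * z, s)‖ := by ring
      _ ≤ _ := mul_le_mul_of_nonneg_left (hC _ _ le_rfl) (by positivity)
  have h2 := hF'.integrable x a s
  set ψ : ℝ → ℂ := fun z => (gaussDensity z : ℂ) * F (x + a * z, s) with hψ
  -- The derivative of ψ off z = -x/a, because the density satisfies ρ' = -(z/2)ρ. Since ψ vanishes
  -- at ±∞, its integral is zero, which is the claim up to the factor -2.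
  set ψ' : ℝ → ℂ := fun z => -(1 / 2) * ((gaussDensity z : ℂ) * (z * F (x + a * z, s))) +
    a * ((gaussDensity z : ℂ) * F' (x + a * z, s)) with hψ'
  have h3 : Integrable ψ' := (h1.const_mul _).add (h2.const_mul _)
  have hcont : Continuous ψ :=
    (Complex.continuous_ofReal.comp continuous_gaussDensity).mul
      ((hd.continuous s).comp (by fun_prop : Continuous fun z : ℝ => x + a * z))
  have hder : ∀ z, z ≠ -x / a → HasDerivAt ψ (ψ' z) z := by
    intro z hz
    have hz' : x + a * z ≠ 0 := fun h0 => hz (by field_simp; linarith)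
    have e1 := (hasDerivAt_gaussDensity z).ofReal_comp
    have e2 : HasDerivAt (fun z => F (x + a * z, s)) (a * F' (x + a * z, s)) z := by
      refine ((hd.hasDerivAt _ s hz').scomp z
        (((hasDerivAt_id z).const_mul a).const_add x)).congr_deriv ?_
      simp
    refine (e1.mul e2).congr_deriv ?_
    simp only [hψ']
    push_cast
    ring
  have hlim : Tendsto ψ (cocompact ℝ) (𝓝 0) := by
    refine squeeze_zero_norm (a := fun z => gaussDensity z * C) (fun z => ?_)
      (by simpa using tendsto_gaussDensity_cocompact.mul_const C)
    rw [norm_mul, Complex.norm_of_nonneg (gaussDensity_pos z).le]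
    exact mul_le_mul_of_nonneg_left (hC _ _ le_rfl) (gaussDensity_pos z).le
  rw [cocompact_eq_atBot_atTop, tendsto_sup] at hlim
  have h4 := intervalIntegral_tendsto_integral h3 tendsto_neg_atTop_atBot tendsto_id
  have h5 : Tendsto (fun R : ℝ => ψ R - ψ (-R)) atTop (𝓝 (0 - 0)) :=
    hlim.2.sub (hlim.1.comp tendsto_neg_atTop_atBot)
  have h6 : ∫ z, ψ' z = 0 := by
    rw [sub_zero] at h5
    refine tendsto_nhds_unique h4 (h5.congr fun R => ?_)
    exact (integral_eq_of_hasDerivAt_off_countable ψ ψ' (countable_singleton (-x / a))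
      hcont.continuousOn (fun z hz => hder z hz.2) h3.intervalIntegrable).symm
  rw [hψ', integral_add (h1.const_mul _) (h2.const_mul _), integral_const_mul,
    integral_const_mul] at h6
  unfold gaussAvg
  linear_combination (-2) * h6

/-- Differentiating in the width brings down a factor z, and Gaussian integration by parts trades it
for a second x-derivative. The factor 2a cancels against the derivative of √r at a = √r, leaving the
heat equation. -/
lemma IsXDeriv.hasDerivAt_gaussAvg_width (hd : IsXDeriv F F') (hd' : IsXDeriv F' F'')
    (hF : Tame F) (hF' : Tame F') (hF'' : Tame F'') (x : ℝ) {a : ℝ} (ha : a ≠ 0) (s : ℝ) :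
    HasDerivAt (fun a => gaussAvg F x a s) (2 * a * gaussAvg F'' x a s) a := by
  rw [← hd'.integral_mul_gaussDensity hF' hF'' x ha s]
  obtain ⟨C, hC0, hC⟩ := hF'.exists_nonneg_bound s
  refine (hasDerivAt_integral_of_dominated_loc_of_lip
    (bound := fun z => |z| * gaussDensity z * C)
    univ_mem (Eventually.of_forall fun a => (hF.integrable x a s).aestronglyMeasurable)
    (hF.integrable x a s) ?_
    (Eventually.of_forall fun z => ?_) (integrable_abs_mul_gaussDensity.mul_const C) ?_).2
  · exact ((Complex.measurable_ofReal.comp continuous_gaussDensity.measurable).mul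
      (Complex.measurable_ofReal.mul (hF'.measurable_comp x a s))).aestronglyMeasurable
  · refine LipschitzOnWith.of_dist_le_mul fun b _ b' _ => ?_
    have h0 := (gaussDensity_pos z).le
    rw [dist_eq_norm, ← mul_sub, norm_mul, Complex.norm_of_nonneg h0, Real.coe_nnabs,
      abs_of_nonneg (by positivity), mul_comm |z|, mul_assoc, mul_assoc]
    refine mul_le_mul_of_nonneg_left ?_ h0
    refine (hd.norm_sub_le hF' (fun x => hC x s le_rfl) _ _).trans_eq ?_
    rw [Real.dist_eq, add_sub_add_left_eq_sub, ← sub_mul, abs_mul]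
    ring
  · filter_upwards [ae_add_mul_ne_zero (Or.inr ha : x ≠ 0 ∨ a ≠ 0)] with z hz
    refine HasDerivAt.const_mul _ ?_
    refine ((hd.hasDerivAt _ s hz).scomp a
      (((hasDerivAt_id a).mul_const z).const_add x)).congr_deriv ?_
    simp

lemma IsXDeriv.hasDerivAt_gaussAvg_sqrt (hd : IsXDeriv F F') (hd' : IsXDeriv F' F'')
    (hF : Tame F) (hF' : Tame F') (hF'' : Tame F'') (x : ℝ) {r : ℝ} (hr : 0 < r) (s : ℝ) :
    HasDerivAt (fun r => gaussAvg F x (√r) s) (gaussAvg F'' x (√r) s) r := by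
  have h0 : √r ≠ 0 := (Real.sqrt_pos.2 hr).ne'
  have h := (hd.hasDerivAt_gaussAvg_width hd' hF hF' hF'' x h0 s).scomp r
    (Real.hasDerivAt_sqrt hr.ne')
  refine h.congr_deriv ?_
  have h0' : (√r : ℂ) ≠ 0 := Complex.ofReal_ne_zero.2 h0
  rw [Complex.real_smul]
  push_cast
  field_simp

lemma Tame.continuousOn_gaussAvg_sqrt (hF : Tame F) {x : ℝ} (hx : x ≠ 0) (s : ℝ) :
    Continuous fun r => gaussAvg F x (√r) s :=
  continuous_iff_continuousAt.2 fun r =>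
    ContinuousAt.comp (g := fun q : ℝ × ℝ × ℝ => gaussAvg F q.1 q.2.1 q.2.2)
      (f := fun r => (x, √r, s)) (hF.continuousAt_gaussAvg (Or.inl hx) s)
      (by fun_prop)

/-- The heat semigroup in integrated form. -/
lemma IsXDeriv.gaussAvg_sqrt_eq (hd : IsXDeriv F F') (hd' : IsXDeriv F' F'')
    (hF : Tame F) (hF' : Tame F') (hF'' : Tame F'') {x : ℝ} (hx : x ≠ 0) {r : ℝ} (hr : 0 ≤ r)
    (s : ℝ) :
    gaussAvg F x (√r) s = F (x, s) + ∫ ρ in (0 : ℝ)..r, gaussAvg F'' x (√ρ) s := by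
  rw [intervalIntegral.integral_eq_sub_of_hasDerivAt_of_le hr
    (hF.continuousOn_gaussAvg_sqrt hx s).continuousOn
    (fun ρ hρ => hd.hasDerivAt_gaussAvg_sqrt hd' hF hF' hF'' x hρ.1 s)
    ((hF''.continuousOn_gaussAvg_sqrt hx s).intervalIntegrable _ _)]
  simp [gaussAvg_zero]

/-- Peetre's inequality moves the weight 1 + x² through the translation by az at the cost of 1 +
a²z², which the second moment of the Gaussian absorbs. The constant depends on T alone, so it serves
every time slice in Duhamel's integral. -/
lemma norm_gaussAvg_le_of_decay (T : ℝ) : ∃ M : ℝ, 0 ≤ M ∧ ∀ (F : ℝ × ℝ → ℂ) (C s : ℝ),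
    0 ≤ C → (∀ x, ‖F (x, s)‖ ≤ C / (1 + x ^ 2)) →
    ∀ x a, a ^ 2 ≤ T → ‖gaussAvg F x a s‖ ≤ M * C / (1 + x ^ 2) := by
  have hint : Integrable fun z => gaussDensity z + |T| * (z ^ 2 * gaussDensity z) :=
    integrable_gaussDensity.add (integrable_sq_mul_gaussDensity.const_mul _)
  refine ⟨2 * ∫ z, (gaussDensity z + |T| * (z ^ 2 * gaussDensity z)), ?_, ?_⟩
  · refine mul_nonneg zero_le_two (integral_nonneg fun z => ?_)
    have := gaussDensity_pos z
    simp only [Pi.zero_apply]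
    positivity
  intro F C s hC hF x a ha
  refine (norm_integral_le_of_norm_le (hint.const_mul (2 * C / (1 + x ^ 2)))
    (Eventually.of_forall fun z => ?_)).trans_eq ?_
  · have h0 := gaussDensity_pos z
    rw [norm_mul, Complex.norm_of_nonneg h0.le]
    have hx : 0 < 1 + x ^ 2 := by positivity
    have hxz : 0 < 1 + (x + a * z) ^ 2 := by positivity
    have key : C / (1 + (x + a * z) ^ 2) ≤ 2 * C / (1 + x ^ 2) * (1 + |T| * z ^ 2) := by
      rw [div_mul_eq_mul_div, div_le_div_iff₀ hxz hx]
      -- Peetre's inequality: x is the difference of x + az and az.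
      have h1 : 1 + x ^ 2 ≤ 2 * (1 + a ^ 2 * z ^ 2) * (1 + (x + a * z) ^ 2) := by
        nlinarith [sq_nonneg (x + a * z + a * z), sq_nonneg ((x + a * z) * (a * z)),
          sq_nonneg (a * z), sq_nonneg (x + 2 * (a * z))]
      have h2 : 1 + a ^ 2 * z ^ 2 ≤ 1 + |T| * z ^ 2 := by
        have := mul_le_mul_of_nonneg_right (ha.trans (le_abs_self T)) (sq_nonneg z)
        linarith
      have h3 : 2 * (1 + a ^ 2 * z ^ 2) * (1 + (x + a * z) ^ 2) ≤
          2 * (1 + |T| * z ^ 2) * (1 + (x + a * z) ^ 2) :=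
        mul_le_mul_of_nonneg_right (by linarith) hxz.le
      calc C * (1 + x ^ 2) ≤ C * (2 * (1 + |T| * z ^ 2) * (1 + (x + a * z) ^ 2)) :=
            mul_le_mul_of_nonneg_left (h1.trans h3) hC
        _ = _ := by ring
    calc gaussDensity z * ‖F (x + a * z, s)‖
        ≤ gaussDensity z * (2 * C / (1 + x ^ 2) * (1 + |T| * z ^ 2)) :=
          mul_le_mul_of_nonneg_left ((hF _).trans key) h0.le
      _ = _ := by ring
  · rw [integral_const_mul]
    ring

end GaussAvg

/-! ### Duhamel's integral. -/

/-- Duhamel's integral `∫_0^t e^{(t-s)∂²} F(·, s) ds`. -/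
def duhamel (F : ℝ × ℝ → ℂ) (x t : ℝ) : ℂ := ∫ s in (0 : ℝ)..t, gaussAvg F x (√(t - s)) s

section Duhamel

variable {F F' F'' : ℝ × ℝ → ℂ}

lemma duhamel_zero (x : ℝ) : duhamel F x 0 = 0 := by simp [duhamel]

lemma duhamel_zero_of_odd {t : ℝ} (hodd : ∀ x s, F (-x, s) = -F (x, s)) :
    duhamel F 0 t = 0 := by
  simp [duhamel, gaussAvg_zero_of_odd fun x => hodd x _]

lemma Tame.measurable_duhamel_integrand (hF : Tame F) :
    Measurable fun q : ℝ × ℝ × ℝ => gaussAvg F q.1 (√(q.2.1 - q.2.2)) q.2.2 :=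
  hF.measurable_gaussAvg.comp
    (f := fun q : ℝ × ℝ × ℝ => (q.1, √(q.2.1 - q.2.2), q.2.2)) (by fun_prop)

lemma Tame.measurable_duhamel_slice (hF : Tame F) (x t : ℝ) :
    Measurable fun s => gaussAvg F x (√(t - s)) s :=
  hF.measurable_duhamel_integrand.comp (f := fun s => (x, t, s)) (by fun_prop)

lemma Tame.intervalIntegrable_duhamel (hF : Tame F) (x t a b : ℝ) :
    IntervalIntegrable (fun s => gaussAvg F x (√(t - s)) s) volume a b := by
  obtain ⟨C, hC⟩ := hF.bounded (max a b)
  refine (intervalIntegrable_const (c := C)).mono_fun'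
    (hF.measurable_duhamel_slice x t).aestronglyMeasurable ?_
  refine (ae_restrict_iff' measurableSet_uIoc).2 (Eventually.of_forall fun s hs => ?_)
  exact norm_gaussAvg_le (fun x => hC x s (by rw [uIoc] at hs; exact hs.2)) _ _

lemma duhamel_eq_integral_indicator (x : ℝ) {t : ℝ} (ht : 0 ≤ t) :
    duhamel F x t = ∫ s, (Ioc 0 t).indicator (fun s => gaussAvg F x (√(t - s)) s) s := by
  rw [duhamel, intervalIntegral.integral_of_le ht, integral_indicator measurableSet_Ioc]

/-- For s < t the width √(t - s) is positive, so the average is continuous even at x = 0; only the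
null set s = t is bad. Hence continuity holds on the whole closed half-plane t ≥ 0, corner included.
-/
lemma Tame.continuousWithinAt_duhamel (hF : Tame F) (x t : ℝ) :
    ContinuousWithinAt (fun p : ℝ × ℝ => duhamel F p.1 p.2) {p | 0 ≤ p.2} (x, t) := by
  by_cases ht : 0 ≤ t
  swap
  · refine continuousWithinAt_of_notMem_closure ?_
    rw [(isClosed_le continuous_const continuous_snd).closure_eq]
    exact ht
  -- The moving endpoint becomes an indicator in the integrand, so that dominated convergence treats
  -- both variables at once. The two expressions agree only for t ≥ 0, since an interval integral
  -- changes sign when reversed.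
  suffices h : ContinuousAt (fun p : ℝ × ℝ =>
      ∫ s, (Ioc 0 p.2).indicator (fun s => gaussAvg F p.1 (√(p.2 - s)) s) s) (x, t) from
    h.continuousWithinAt.congr (fun p hp => duhamel_eq_integral_indicator _ hp)
      (duhamel_eq_integral_indicator _ ht)
  obtain ⟨C, hC0, hC⟩ := hF.exists_nonneg_bound (t + 1)
  refine continuousAt_of_dominated (bound := (Ioc 0 (t + 1)).indicator fun _ => C)
    (Eventually.of_forall fun p => ?_) ?_ ?_ ?_
  · exact ((hF.measurable_duhamel_slice p.1 p.2).indicator measurableSet_Ioc).aestronglyMeasurable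
  · have : ∀ᶠ p : ℝ × ℝ in 𝓝 (x, t), p.2 < t + 1 :=
      continuous_snd.continuousAt.eventually_lt continuousAt_const (by simp)
    filter_upwards [this] with p hp
    refine Eventually.of_forall fun s => ?_
    by_cases hs : s ∈ Ioc 0 p.2
    · have hs' : s ∈ Ioc 0 (t + 1) := ⟨hs.1, hs.2.trans hp.le⟩
      rw [indicator_of_mem hs, indicator_of_mem hs']
      exact norm_gaussAvg_le (fun x => hC x s hs'.2) _ _
    · rw [indicator_of_notMem hs, norm_zero]
      exact indicator_nonneg (fun _ _ => hC0) s
  · exact (integrable_indicator_iff measurableSet_Ioc).2 (by simp [IntegrableOn])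
  · have : ∀ᵐ s : ℝ, s ≠ t := by simp [ae_iff, measure_singleton]
    filter_upwards [this] with s hs
    rcases lt_or_gt_of_ne hs with hs | hs
    · by_cases h0 : 0 < s
      · have e : (fun p : ℝ × ℝ => gaussAvg F p.1 (√(p.2 - s)) s) =ᶠ[𝓝 (x, t)] fun p =>
            (Ioc 0 p.2).indicator (fun s => gaussAvg F p.1 (√(p.2 - s)) s) s := by
          have : ∀ᶠ p : ℝ × ℝ in 𝓝 (x, t), s < p.2 :=
            continuousAt_const.eventually_lt continuous_snd.continuousAt hs
          filter_upwards [this] with p hp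
          exact (indicator_of_mem (show s ∈ Ioc 0 p.2 from ⟨h0, hp.le⟩) _).symm
        refine ContinuousAt.congr ?_ e
        refine ContinuousAt.comp (g := fun q : ℝ × ℝ × ℝ => gaussAvg F q.1 q.2.1 q.2.2)
          (f := fun p : ℝ × ℝ => (p.1, √(p.2 - s), s))
          (hF.continuousAt_gaussAvg (Or.inr (Real.sqrt_pos.2 (sub_pos.2 hs)).ne') s) (by fun_prop)
      · have : (fun p : ℝ × ℝ =>
            (Ioc 0 p.2).indicator (fun s => gaussAvg F p.1 (√(p.2 - s)) s) s) = fun _ => 0 := by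
          funext p
          exact indicator_of_notMem (fun h => h0 h.1) _
        rw [this]; exact continuousAt_const
    · have e : (fun _ : ℝ × ℝ => (0 : ℂ)) =ᶠ[𝓝 (x, t)] fun p =>
          (Ioc 0 p.2).indicator (fun s => gaussAvg F p.1 (√(p.2 - s)) s) s := by
        have : ∀ᶠ p : ℝ × ℝ in 𝓝 (x, t), p.2 < s :=
          continuous_snd.continuousAt.eventually_lt continuousAt_const hs
        filter_upwards [this] with p hp
        exact (indicator_of_notMem (fun h => absurd h.2 (not_le.2 hp)) _).symm
      exact continuousAt_const.congr e

lemma IsXDeriv.hasDerivAt_duhamel_x (hd : IsXDeriv F F') (hF : Tame F) (hF' : Tame F')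
    {x t : ℝ} (hx : x ≠ 0) (ht : 0 ≤ t) :
    HasDerivAt (fun x => duhamel F x t) (duhamel F' x t) x := by
  obtain ⟨C, hC0, hC⟩ := hF'.exists_nonneg_bound t
  have hs : {x : ℝ | x ≠ 0} ∈ 𝓝 x := isOpen_ne.mem_nhds hx
  refine (intervalIntegral.hasDerivAt_integral_of_dominated_loc_of_deriv_le
    (bound := fun _ => C) (F' := fun x s => gaussAvg F' x (√(t - s)) s) hs
    (Eventually.of_forall fun x => (hF.measurable_duhamel_slice x t).aestronglyMeasurable)
    (hF.intervalIntegrable_duhamel x t 0 t)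
    (hF'.measurable_duhamel_slice x t).aestronglyMeasurable
    (Eventually.of_forall fun s hs x _ => ?_) intervalIntegrable_const
    (Eventually.of_forall fun s _ x hx => ?_)).2
  · rw [uIoc_of_le ht] at hs
    exact norm_gaussAvg_le (fun x => hC x s hs.2) _ _
  · exact hd.hasDerivAt_gaussAvg hF hF' (Or.inl hx) s

lemma Tame.continuousOn_slice (hF : Tame F) {x : ℝ} (hx : x ≠ 0) :
    Continuous fun s => F (x, s) :=
  continuous_iff_continuousAt.2 fun s =>
    ContinuousAt.comp (g := F) (f := fun s => (x, s)) (hF.continuousAt x s hx) (by fun_prop)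

lemma Tame.continuousOn_duhamel_slice (hF : Tame F) (x : ℝ) :
    ContinuousOn (fun t => duhamel F x t) (Ici 0) := fun t _ =>
  (hF.continuousWithinAt_duhamel x t).comp (f := fun t => (x, t))
    (by fun_prop) (fun _ h => h)

/-- Expand each average by the integrated semigroup identity and exchange the order of integration
over the triangle 0 < s < r ≤ t. The t-derivative then follows from the fundamental theorem of
calculus, without differentiating an integral whose integrand and endpoint both move. -/
lemma IsXDeriv.duhamel_eq_integral (hd : IsXDeriv F F') (hd' : IsXDeriv F' F'')
    (hF : Tame F) (hF' : Tame F') (hF'' : Tame F'') {x t : ℝ} (hx : x ≠ 0) (ht : 0 ≤ t) :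
    duhamel F x t = ∫ r in (0 : ℝ)..t, (F (x, r) + duhamel F'' x r) := by
  obtain ⟨C, hC0, hC⟩ := hF''.exists_nonneg_bound t
  -- Extension by zero from the triangle to the square (0, t]², where Fubini applies.
  set k : ℝ → ℝ → ℂ := fun s r => (Ioi s).indicator (fun r => gaussAvg F'' x (√(r - s)) s) r
    with hk
  have hkm : Measurable (Function.uncurry k) := by
    have h := hF''.measurable_duhamel_integrand.comp
      (f := fun p : ℝ × ℝ => (x, p.2, p.1)) (by fun_prop)
    exact h.indicator (measurableSet_lt measurable_fst measurable_snd)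
  have hkint : Integrable (Function.uncurry k)
      ((volume.restrict (Ioc 0 t)).prod (volume.restrict (Ioc 0 t))) := by
    refine Integrable.mono' (g := fun _ => C) (integrable_const C) hkm.aestronglyMeasurable ?_
    rw [Measure.prod_restrict]
    refine (ae_restrict_iff' (measurableSet_Ioc.prod measurableSet_Ioc)).2
      (Eventually.of_forall fun p hp => ?_)
    simp only [Function.uncurry, hk]
    refine (norm_indicator_le_norm_self _ _).trans ?_
    exact norm_gaussAvg_le (fun x => hC x p.1 hp.1.2) _ _
  have h1 : ∀ s ∈ Ioc 0 t, gaussAvg F x (√(t - s)) s =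
      F (x, s) + ∫ r in Ioc 0 t, k s r := by
    intro s hs
    rw [hd.gaussAvg_sqrt_eq hd' hF hF' hF'' hx (sub_nonneg.2 hs.2) s]
    congr 1
    rw [hk, setIntegral_indicator measurableSet_Ioi, Ioc_inter_Ioi, max_eq_right hs.1.le,
      ← intervalIntegral.integral_of_le hs.2,
      intervalIntegral.integral_comp_sub_right (fun ρ => gaussAvg F'' x (√ρ) s) s, sub_self]
  have h2 : ∀ r ∈ Ioc 0 t, ∫ s in Ioc 0 t, k s r = duhamel F'' x r := by
    intro r hr
    have : ∀ s, k s r = (Iio r).indicator (fun s => gaussAvg F'' x (√(r - s)) s) s := by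
      intro s
      simp [hk, indicator]
    simp_rw [this]
    rw [setIntegral_indicator measurableSet_Iio, duhamel, intervalIntegral.integral_of_le hr.1.le,
      integral_Ioc_eq_integral_Ioo]
    congr 2
    ext s
    simp only [mem_inter_iff, mem_Ioc, mem_Iio, mem_Ioo]
    exact ⟨fun h => ⟨h.1.1, h.2⟩, fun h => ⟨⟨h.1, h.2.le.trans hr.2⟩, h.2⟩⟩
  have hFi : IntegrableOn (fun s => F (x, s)) (Ioc 0 t) :=
    ((hF.continuousOn_slice hx).intervalIntegrable 0 t).1
  rw [duhamel, intervalIntegral.integral_of_le ht, setIntegral_congr_fun measurableSet_Ioc h1,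
    integral_add (g := fun s => ∫ r in Ioc 0 t, k s r) hFi hkint.integral_prod_left, integral_integral_swap hkint,
    setIntegral_congr_fun measurableSet_Ioc h2, intervalIntegral.integral_of_le ht, integral_add hFi]
  exact (hkint.integral_prod_right.congr
    ((ae_restrict_iff' measurableSet_Ioc).2 (Eventually.of_forall h2)))

lemma IsXDeriv.hasDerivAt_duhamel_t (hd : IsXDeriv F F') (hd' : IsXDeriv F' F'')
    (hF : Tame F) (hF' : Tame F') (hF'' : Tame F'') {x t : ℝ} (hx : x ≠ 0) (ht : 0 < t) :
    HasDerivAt (fun t => duhamel F x t) (F (x, t) + duhamel F'' x t) t := by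
  have hc : ContinuousOn (fun r => F (x, r) + duhamel F'' x r) (Ici 0) :=
    (hF.continuousOn_slice hx).continuousOn.add (hF''.continuousOn_duhamel_slice x)
  have h := intervalIntegral.integral_hasDerivAt_right
    (hc.mono (by rw [uIcc_of_le ht.le]; exact Icc_subset_Ici_self)).intervalIntegrable
    ((hc.mono Ioi_subset_Ici_self).stronglyMeasurableAtFilter isOpen_Ioi t ht)
    (hc.continuousAt (Ici_mem_nhds ht))
  refine h.congr_of_eventuallyEq ?_
  filter_upwards [Ioi_mem_nhds ht] with r hr
  exact hd.duhamel_eq_integral hd' hF hF' hF'' hx hr.le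

lemma norm_duhamel_le_of_decay (hdec : ∀ T : ℝ, ∃ C : ℝ, ∀ x s, s ≤ T →
    ‖F (x, s)‖ ≤ C / (1 + x ^ 2)) (T : ℝ) :
    ∃ C : ℝ, ∀ x t, 0 ≤ t → t ≤ T → ‖duhamel F x t‖ ≤ C / (1 + x ^ 2) := by
  obtain ⟨M, hM0, hM⟩ := norm_gaussAvg_le_of_decay T
  obtain ⟨C, hC⟩ := hdec T
  have hC0 : 0 ≤ C := by simpa using (norm_nonneg _).trans (hC 0 T le_rfl)
  refine ⟨M * C * T, fun x t h0 ht => ?_⟩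
  have h := intervalIntegral.norm_integral_le_of_norm_le_const (a := 0) (b := t)
    (f := fun s => gaussAvg F x (√(t - s)) s) (C := M * C / (1 + x ^ 2)) fun s hs => by
      rw [uIoc_of_le h0] at hs
      refine hM F C s hC0 (fun x => hC x s (hs.2.trans ht)) x _ ?_
      rw [Real.sq_sqrt (sub_nonneg.2 hs.2)]
      linarith [hs.1]
  refine h.trans ?_
  rw [sub_zero, abs_of_nonneg h0, div_mul_eq_mul_div]
  gcongr

end Duhamel

/-! ### Differentiability up to the sides of the quarter-plane. -/

lemma mem_QbarPunctured {x t : ℝ} : (x, t) ∈ QbarPunctured ↔ 0 ≤ x ∧ 0 ≤ t ∧ (x ≠ 0 ∨ t ≠ 0) := by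
  simp only [QbarPunctured, Qbar, Set.mem_sdiff, mem_ofPred_eq, mem_singleton_iff, Prod.mk.injEq]
  tauto

lemma closure_openQuadrant :
    closure (Ioi (0 : ℝ) ×ˢ Ioi (0 : ℝ)) = Qbar := by
  rw [closure_prod_eq, closure_Ioi]; rfl

lemma openQuadrant_subset : Ioi (0 : ℝ) ×ˢ Ioi (0 : ℝ) ⊆ QbarPunctured := fun _ hp =>
  mem_QbarPunctured.2 ⟨hp.1.le, hp.2.le, Or.inl hp.1.ne'⟩

/-- The linear map with partial derivatives `a` and `b`. -/
def gradMap (a b : ℂ) : ℝ × ℝ →L[ℝ] ℂ :=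
  (ContinuousLinearMap.toSpanSingleton ℝ a).coprod (ContinuousLinearMap.toSpanSingleton ℝ b)

lemma contDiffOn_gradMap {n : ℕ∞} {A B : ℝ × ℝ → ℂ} {s : Set (ℝ × ℝ)} (hA : ContDiffOn ℝ n A s)
    (hB : ContDiffOn ℝ n B s) : ContDiffOn ℝ n (fun p => gradMap (A p) (B p)) s := by
  have h1 := ((ContinuousLinearMap.smulRightL ℝ (ℝ × ℝ) ℂ)
    (ContinuousLinearMap.fst ℝ ℝ ℝ)).contDiff.comp_contDiffOn hA
  have h2 := ((ContinuousLinearMap.smulRightL ℝ (ℝ × ℝ) ℂ)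
    (ContinuousLinearMap.snd ℝ ℝ ℝ)).contDiff.comp_contDiffOn hB
  refine (h1.add h2).congr fun p _ => ?_
  ext <;> simp [gradMap]

lemma hasFDerivAt_of_partials {V A B : ℝ × ℝ → ℂ} {s : Set (ℝ × ℝ)} (hs : IsOpen s)
    (hA : ContinuousOn A s) (hB : ContinuousOn B s)
    (hx : ∀ p ∈ s, HasDerivAt (fun y => V (y, p.2)) (A p) p.1)
    (ht : ∀ p ∈ s, HasDerivAt (fun r => V (p.1, r)) (B p) p.2) {p : ℝ × ℝ} (hp : p ∈ s) :
    HasFDerivAt V (gradMap (A p) (B p)) p := by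
  have hmem : ∀ᶠ q in 𝓝 p, q ∈ s := hs.mem_nhds hp
  have hcl : Continuous fun a : ℂ => ContinuousLinearMap.toSpanSingleton ℝ a :=
    (ContinuousLinearMap.toSpanSingletonCLE (𝕜 := ℝ) (E := ℂ)).continuous
  have := hasStrictFDerivAt_uncurry_coprod (𝕜 := ℝ) (u := p) (f := fun x t => V (x, t))
    (f₁ := fun x t => ContinuousLinearMap.toSpanSingleton ℝ (A (x, t)))
    (f₂ := fun x t => ContinuousLinearMap.toSpanSingleton ℝ (B (x, t)))
    (hmem.mono fun q hq => (hx q hq).hasFDerivAt) (hmem.mono fun q hq => (ht q hq).hasFDerivAt)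
    (hcl.continuousAt.comp (hA.continuousAt hmem)) (hcl.continuousAt.comp (hB.continuousAt hmem))
  exact this.hasFDerivAt

/-- By the mean value inequality on a convex open set, a derivative that has a limit at a boundary
point is a derivative there. Thus partial derivatives have to be computed only in the interior, and
at the sides it is enough that the candidates are continuous. -/
lemma hasFDerivWithinAt_of_partials {V A B : ℝ × ℝ → ℂ} (hV : ContinuousOn V QbarPunctured)
    (hA : ContinuousOn A QbarPunctured) (hB : ContinuousOn B QbarPunctured)
    (hx : ∀ x t, 0 < x → 0 < t → HasDerivAt (fun y => V (y, t)) (A (x, t)) x)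
    (ht : ∀ x t, 0 < x → 0 < t → HasDerivAt (fun r => V (x, r)) (B (x, t)) t)
    {p : ℝ × ℝ} (hp : p ∈ QbarPunctured) :
    HasFDerivWithinAt V (gradMap (A p) (B p)) QbarPunctured p := by
  set Q : Set (ℝ × ℝ) := Ioi 0 ×ˢ Ioi 0 with hQ
  have hQo : IsOpen Q := isOpen_Ioi.prod isOpen_Ioi
  have hder : ∀ q ∈ Q, HasFDerivAt V (gradMap (A q) (B q)) q := fun q hq =>
    hasFDerivAt_of_partials hQo (hA.mono openQuadrant_subset) (hB.mono openQuadrant_subset)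
      (fun r hr => hx r.1 r.2 hr.1 hr.2) (fun r hr => ht r.1 r.2 hr.1 hr.2) hq
  have hp0 : p ≠ 0 := fun h => hp.2 h
  -- Half the distance to the corner: the convex piece cut out by this ball has a closure that
  -- avoids the corner, where nothing is assumed continuous.
  set ε := ‖p‖ / 2 with hε
  have hpos : 0 < ‖p‖ := norm_pos_iff.2 hp0
  have hε0 : 0 < ε := by positivity
  set s := Metric.ball p ε ∩ Q with hs
  have hcl : closure s ⊆ QbarPunctured := by
    intro q hq
    refine ⟨closure_openQuadrant ▸ closure_mono inter_subset_right hq, fun h0 => ?_⟩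
    have h1 := Metric.closure_ball_subset_closedBall (closure_mono inter_subset_left hq)
    rw [show q = 0 from h0, Metric.mem_closedBall, dist_zero_left] at h1
    linarith
  have hsub : s ⊆ QbarPunctured := subset_closure.trans hcl
  have hLc : ContinuousOn (fun p => gradMap (A p) (B p)) QbarPunctured := by
    have := contDiffOn_gradMap (n := 0) (contDiffOn_zero.2 hA) (contDiffOn_zero.2 hB)
    exact this.continuousOn
  have key : HasFDerivWithinAt V (gradMap (A p) (B p)) (closure s) p := by
    refine hasFDerivWithinAt_closure_of_tendsto_fderiv
      (fun q hq => (hder q hq.2).differentiableAt.differentiableWithinAt)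
      ((convex_ball p ε).inter ((convex_Ioi 0).prod (convex_Ioi 0)))
      (Metric.isOpen_ball.inter hQo) (fun q hq => (hV q (hcl hq)).mono hsub) ?_
    refine ((hLc p hp).mono hsub).tendsto.congr' ?_
    filter_upwards [self_mem_nhdsWithin] with q hq
    exact (hder q hq.2).fderiv.symm
  refine key.mono_of_mem_nhdsWithin ?_
  filter_upwards [self_mem_nhdsWithin, mem_nhdsWithin_of_mem_nhds (Metric.ball_mem_nhds p hε0)]
    with q hq hqb
  exact Metric.isOpen_ball.inter_closure ⟨hqb, by rw [closure_openQuadrant]; exact hq.1⟩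

/-- A function on the punctured quarter-plane whose partial derivatives in the interior extend to
functions of class `C^n` is of class `C^{n+1}`. -/
lemma contDiffOn_succ_of_partials {n : ℕ} {V A B : ℝ × ℝ → ℂ}
    (hV : ContinuousOn V QbarPunctured)
    (hA : ContDiffOn ℝ n A QbarPunctured) (hB : ContDiffOn ℝ n B QbarPunctured)
    (hx : ∀ x t, 0 < x → 0 < t → HasDerivAt (fun y => V (y, t)) (A (x, t)) x)
    (ht : ∀ x t, 0 < x → 0 < t → HasDerivAt (fun r => V (x, r)) (B (x, t)) t) :
    ContDiffOn ℝ (n + 1) V QbarPunctured := by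
  refine (contDiffOn_succ_iff_hasFDerivWithinAt (by exact_mod_cast ENat.natCast_ne_top n)).2
    fun p hp => ⟨QbarPunctured, ?_, ?_, fun q => gradMap (A q) (B q), fun q hq => ?_, ?_⟩
  · rw [insert_eq_of_mem hp]; exact self_mem_nhdsWithin
  · intro h; exact absurd h (by simp)
  · exact hasFDerivWithinAt_of_partials hV hA.continuousOn hB.continuousOn hx ht hq
  · exact contDiffOn_gradMap (n := n) hA hB

/-! ### Even and odd reflections. -/

/-- The extension of a function on the quarter-plane to the plane: even (`ε = 1`) or odd (`ε = -1`)
in `x`, constant in time before time zero. -/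
def reflect (ε : ℝ) (φ : ℝ × ℝ → ℂ) (p : ℝ × ℝ) : ℂ :=
  if 0 ≤ p.1 then φ (p.1, max p.2 0) else ε * φ (-p.1, max p.2 0)

lemma reflect_of_nonneg {ε : ℝ} {φ : ℝ × ℝ → ℂ} {x t : ℝ} (hx : 0 ≤ x) (ht : 0 ≤ t) :
    reflect ε φ (x, t) = φ (x, t) := by
  simp [reflect, hx, ht]

lemma reflect_odd {φ : ℝ × ℝ → ℂ} (h0 : ∀ t, 0 ≤ t → φ (0, t) = 0) (x t : ℝ) :
    reflect (-1) φ (-x, t) = -reflect (-1) φ (x, t) := by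
  rcases lt_trichotomy x 0 with hx | rfl | hx
  · simp [reflect, hx.le, not_le.2 hx]
  · simp [reflect, h0]
  · simp [reflect, hx.le, not_le.2 hx]

section Reflect

variable {ε : ℝ} {φ φ' : ℝ × ℝ → ℂ}

lemma continuous_comp_max (hφ : ContinuousOn φ Qbar) :
    Continuous fun p : ℝ × ℝ => φ (max p.1 0, max p.2 0) :=
  hφ.comp_continuous (by fun_prop) fun _ => ⟨le_max_right _ _, le_max_right _ _⟩

lemma continuous_comp_neg_max (hφ : ContinuousOn φ Qbar) :
    Continuous fun p : ℝ × ℝ => (ε : ℂ) * φ (max (-p.1) 0, max p.2 0) :=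
  continuous_const.mul ((continuous_comp_max hφ).comp
    (by fun_prop : Continuous fun p : ℝ × ℝ => (-p.1, p.2)))

/-- With arguments clamped by `max`, both branches are defined and continuous on the whole plane, so
measurability and continuity concern only the cut x = 0. -/
lemma reflect_eq (ε : ℝ) (φ : ℝ × ℝ → ℂ) : reflect ε φ = fun p => if 0 ≤ p.1 then
    φ (max p.1 0, max p.2 0) else ε * φ (max (-p.1) 0, max p.2 0) := by
  funext p
  by_cases h : 0 ≤ p.1
  · simp [reflect, h]
  · have : 0 ≤ -p.1 := by linarith
    simp [reflect, h, this]

lemma norm_reflect_le (hε : |ε| = 1) {T : ℝ} (hT : 0 ≤ T) {b : ℝ → ℝ} (hb : ∀ x, b (-x) = b x)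
    (h : ∀ x t, 0 ≤ x → 0 ≤ t → t ≤ T → ‖φ (x, t)‖ ≤ b x) (x t : ℝ) (ht : t ≤ T) :
    ‖reflect ε φ (x, t)‖ ≤ b x := by
  unfold reflect
  split_ifs with hx
  · exact h _ _ hx (le_max_right _ _) (max_le ht hT)
  · rw [norm_mul, Complex.norm_real, Real.norm_eq_abs, hε, one_mul, ← hb]
    exact h _ _ (by simp only at hx; linarith) (le_max_right _ _) (max_le ht hT)

lemma reflect_bounded (hε : |ε| = 1)
    (hb : ∀ T : ℝ, ∃ C : ℝ, ∀ x t, 0 ≤ x → 0 ≤ t → t ≤ T → ‖φ (x, t)‖ ≤ C) (T : ℝ) :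
    ∃ C : ℝ, ∀ x s, s ≤ T → ‖reflect ε φ (x, s)‖ ≤ C := by
  obtain ⟨C, hC⟩ := hb (max T 0)
  exact ⟨C, fun x s hs => norm_reflect_le hε (le_max_right T 0) (b := fun _ => C) (fun _ => rfl)
    hC x s (hs.trans (le_max_left _ _))⟩

lemma reflect_decay (hε : |ε| = 1)
    (hb : ∀ T : ℝ, ∃ C : ℝ, ∀ x t, 0 ≤ x → 0 ≤ t → t ≤ T → ‖φ (x, t)‖ ≤ C / (1 + x ^ 2)) (T : ℝ) :
    ∃ C : ℝ, ∀ x s, s ≤ T → ‖reflect ε φ (x, s)‖ ≤ C / (1 + x ^ 2) := by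
  obtain ⟨C, hC⟩ := hb (max T 0)
  exact ⟨C, fun x s hs => norm_reflect_le hε (le_max_right T 0)
    (b := fun x => C / (1 + x ^ 2)) (fun _ => by simp)
    hC x s (hs.trans (le_max_left _ _))⟩

lemma tame_reflect (hε : |ε| = 1) (hφ : ContinuousOn φ Qbar)
    (hb : ∀ T : ℝ, ∃ C : ℝ, ∀ x t, 0 ≤ x → 0 ≤ t → t ≤ T → ‖φ (x, t)‖ ≤ C) :
    Tame (reflect ε φ) where
  measurable := by
    rw [reflect_eq]
    exact Measurable.ite (measurableSet_le measurable_const measurable_fst)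
      (continuous_comp_max hφ).measurable (continuous_comp_neg_max hφ).measurable
  bounded := reflect_bounded hε hb
  continuousAt x s hx := by
    rw [reflect_eq]
    rcases lt_or_gt_of_ne hx with hx | hx
    · refine (continuous_comp_neg_max (ε := ε) hφ).continuousAt.congr ?_
      have : ∀ᶠ p : ℝ × ℝ in 𝓝 (x, s), p.1 < 0 :=
        continuous_fst.continuousAt.eventually_lt continuousAt_const hx
      filter_upwards [this] with p hp
      rw [if_neg (not_le.2 hp)]
    · refine (continuous_comp_max hφ).continuousAt.congr ?_
      have : ∀ᶠ p : ℝ × ℝ in 𝓝 (x, s), 0 < p.1 :=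
        continuousAt_const.eventually_lt continuous_fst.continuousAt hx
      filter_upwards [this] with p hp
      rw [if_pos hp.le]

lemma bounded_of_decay
    (hb : ∀ T : ℝ, ∃ C : ℝ, ∀ x t, 0 ≤ x → 0 ≤ t → t ≤ T → ‖φ (x, t)‖ ≤ C / (1 + x ^ 2)) (T : ℝ) :
    ∃ C : ℝ, ∀ x t, 0 ≤ x → 0 ≤ t → t ≤ T → ‖φ (x, t)‖ ≤ C := by
  obtain ⟨C, hC⟩ := hb T
  refine ⟨|C|, fun x t hx ht hT => (hC x t hx ht hT).trans ?_⟩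
  exact (div_le_div_of_nonneg_right (le_abs_self C) (by positivity)).trans
    (div_le_self (abs_nonneg C) (by nlinarith [sq_nonneg x]))

/-- Differentiation reverses parity. The matching condition at x = 0 is void for ε = 1 and says φ(0,
t) = 0 for ε = -1, so along a chain starting with an odd reflection only derivatives of even order
have to vanish at the boundary. The last derivative may jump. -/
lemma isXDeriv_reflect (hφ : ContinuousOn φ Qbar)
    (h0 : ∀ t, 0 ≤ t → (ε : ℂ) * φ (0, t) = φ (0, t))
    (hd : ∀ x t, 0 < x → 0 ≤ t → HasDerivAt (fun y => φ (y, t)) (φ' (x, t)) x) :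
    IsXDeriv (reflect ε φ) (reflect (-ε) φ') where
  continuous s := by
    rw [reflect_eq]
    refine Continuous.if_le
      ((continuous_comp_max hφ).comp (by fun_prop : Continuous fun x : ℝ => (x, s)))
      ((continuous_comp_neg_max hφ).comp (by fun_prop : Continuous fun x : ℝ => (x, s)))
      continuous_const continuous_id fun x hx => ?_
    subst hx
    simpa using (h0 (max s 0) (le_max_right _ _)).symm
  hasDerivAt x s hx := by
    rcases lt_or_gt_of_ne hx with hx | hx
    · have h := (hd (-x) (max s 0) (neg_pos.2 hx) (le_max_right _ _)).scomp x (hasDerivAt_neg x)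
      have e : (fun y => reflect ε φ (y, s)) =ᶠ[𝓝 x] fun y => (ε : ℂ) * φ (-y, max s 0) := by
        filter_upwards [Iio_mem_nhds hx] with y hy
        simp [reflect, not_le.2 (mem_Iio.1 hy)]
      refine ((h.const_mul (ε : ℂ)).congr_of_eventuallyEq e).congr_deriv ?_
      simp [reflect, not_le.2 hx]
    · have e : (fun y => reflect ε φ (y, s)) =ᶠ[𝓝 x] fun y => φ (y, max s 0) := by
        filter_upwards [Ioi_mem_nhds hx] with y hy
        simp [reflect, (mem_Ioi.1 hy).le]
      refine ((hd x (max s 0) hx (le_max_right _ _)).congr_of_eventuallyEq e).congr_deriv ?_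
      simp [reflect, hx.le]

end Reflect

/-! ### Chains of x-derivatives with decay. -/

/-- A sequence of functions on the quarter-plane, each the `x`-derivative of the previous one, all
continuous and decaying at infinity. -/
structure DecayChain (φ : ℕ → ℝ × ℝ → ℂ) : Prop where
  continuousOn : ∀ j, ContinuousOn (φ j) Qbar
  decay : ∀ (j : ℕ) (T : ℝ), ∃ C : ℝ, ∀ x t, 0 ≤ x → 0 ≤ t → t ≤ T →
    ‖φ j (x, t)‖ ≤ C / (1 + x ^ 2)
  hasDerivAt : ∀ (j : ℕ) (x t : ℝ), 0 < x → 0 ≤ t →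
    HasDerivAt (fun y => φ j (y, t)) (φ (j + 1) (x, t)) x

namespace DecayChain

variable {φ ψ : ℕ → ℝ × ℝ → ℂ}

lemma sub (hφ : DecayChain φ) (hψ : DecayChain ψ) : DecayChain fun j => φ j - ψ j where
  continuousOn j := (hφ.continuousOn j).sub (hψ.continuousOn j)
  decay j T := by
    obtain ⟨C, hC⟩ := hφ.decay j T
    obtain ⟨D, hD⟩ := hψ.decay j T
    refine ⟨C + D, fun x t hx ht hT => ?_⟩
    rw [add_div]
    exact (norm_sub_le _ _).trans (add_le_add (hC x t hx ht hT) (hD x t hx ht hT))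
  hasDerivAt j x t hx ht := (hφ.hasDerivAt j x t hx ht).sub (hψ.hasDerivAt j x t hx ht)

lemma tame (hφ : DecayChain φ) {ε : ℝ} (hε : |ε| = 1) (j : ℕ) : Tame (reflect ε (φ j)) :=
  tame_reflect hε (hφ.continuousOn j) (bounded_of_decay (hφ.decay j))

lemma isXDeriv_even (hφ : DecayChain φ) (j : ℕ) :
    IsXDeriv (reflect 1 (φ j)) (reflect (-1) (φ (j + 1))) :=
  isXDeriv_reflect (hφ.continuousOn j) (by simp) (hφ.hasDerivAt j)

lemma isXDeriv_odd (hφ : DecayChain φ) {j : ℕ} (h0 : ∀ t, 0 ≤ t → φ j (0, t) = 0) :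
    IsXDeriv (reflect (-1) (φ j)) (reflect 1 (φ (j + 1))) := by
  have := isXDeriv_reflect (ε := -1) (hφ.continuousOn j)
    (fun t ht => by simp [h0 t ht]) (hφ.hasDerivAt j)
  rwa [neg_neg] at this

end DecayChain

/-! ### C² regularity of the heat evolution and of Duhamel's integral. -/

lemma Tame.continuousOn_heat {F : ℝ × ℝ → ℂ} (hF : Tame F) :
    ContinuousOn (fun p : ℝ × ℝ => gaussAvg F p.1 (√p.2) 0) QbarPunctured := by
  rintro ⟨x, t⟩ hp
  obtain ⟨-, ht, h⟩ := mem_QbarPunctured.1 hp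
  have h' : x ≠ 0 ∨ √t ≠ 0 := h.imp_right fun h => (Real.sqrt_pos.2 (ht.lt_of_ne' h)).ne'
  exact (ContinuousAt.comp (g := fun q : ℝ × ℝ × ℝ => gaussAvg F q.1 q.2.1 q.2.2)
    (f := fun p : ℝ × ℝ => (p.1, √p.2, (0 : ℝ))) (hF.continuousAt_gaussAvg h' 0)
    (by fun_prop)).continuousWithinAt

lemma Tame.continuousOn_duhamel {F : ℝ × ℝ → ℂ} (hF : Tame F) :
    ContinuousOn (fun p : ℝ × ℝ => duhamel F p.1 p.2) QbarPunctured := fun p _ =>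
  (hF.continuousWithinAt_duhamel p.1 p.2).mono fun _ hq => hq.1.2

lemma contDiffOn_one_heat {F₀ F₁ F₂ : ℝ × ℝ → ℂ} (h₀ : Tame F₀) (h₁ : Tame F₁) (h₂ : Tame F₂)
    (d₀ : IsXDeriv F₀ F₁) (d₁ : IsXDeriv F₁ F₂) :
    ContDiffOn ℝ 1 (fun p : ℝ × ℝ => gaussAvg F₀ p.1 (√p.2) 0) QbarPunctured := by
  have := contDiffOn_succ_of_partials (n := 0) h₀.continuousOn_heat
    (contDiffOn_zero.2 h₁.continuousOn_heat) (contDiffOn_zero.2 h₂.continuousOn_heat)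
    (fun x t hx _ => d₀.hasDerivAt_gaussAvg (a := √t) h₀ h₁ (Or.inl hx.ne') 0)
    (fun x t _ ht => d₀.hasDerivAt_gaussAvg_sqrt d₁ h₀ h₁ h₂ x ht 0)
  simpa using this

/-- Each t-derivative costs two x-derivatives, so C² requires four. The last one, F₄, enters only
through its average and may be discontinuous at x = 0. -/
lemma contDiffOn_two_heat {F₀ F₁ F₂ F₃ F₄ : ℝ × ℝ → ℂ} (h₀ : Tame F₀) (h₁ : Tame F₁)
    (h₂ : Tame F₂) (h₃ : Tame F₃) (h₄ : Tame F₄)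
    (d₀ : IsXDeriv F₀ F₁) (d₁ : IsXDeriv F₁ F₂) (d₂ : IsXDeriv F₂ F₃) (d₃ : IsXDeriv F₃ F₄) :
    ContDiffOn ℝ 2 (fun p : ℝ × ℝ => gaussAvg F₀ p.1 (√p.2) 0) QbarPunctured := by
  have := contDiffOn_succ_of_partials (n := 1) h₀.continuousOn_heat
    (by exact_mod_cast contDiffOn_one_heat h₁ h₂ h₃ d₁ d₂)
    (by exact_mod_cast contDiffOn_one_heat h₂ h₃ h₄ d₂ d₃)
    (fun x t hx _ => d₀.hasDerivAt_gaussAvg (a := √t) h₀ h₁ (Or.inl hx.ne') 0)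
    (fun x t _ ht => d₀.hasDerivAt_gaussAvg_sqrt d₁ h₀ h₁ h₂ x ht 0)
  exact_mod_cast this

lemma contDiffOn_one_duhamel {F₀ F₁ F₂ : ℝ × ℝ → ℂ} (h₀ : Tame F₀) (h₁ : Tame F₁) (h₂ : Tame F₂)
    (d₀ : IsXDeriv F₀ F₁) (d₁ : IsXDeriv F₁ F₂) (hc : ContinuousOn F₀ QbarPunctured) :
    ContDiffOn ℝ 1 (fun p : ℝ × ℝ => duhamel F₀ p.1 p.2) QbarPunctured := by
  have := contDiffOn_succ_of_partials (n := 0) h₀.continuousOn_duhamel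
    (contDiffOn_zero.2 h₁.continuousOn_duhamel)
    (contDiffOn_zero.2 (hc.add h₂.continuousOn_duhamel))
    (fun x t hx ht => d₀.hasDerivAt_duhamel_x h₀ h₁ hx.ne' ht.le)
    (fun x t hx ht => d₀.hasDerivAt_duhamel_t d₁ h₀ h₁ h₂ hx.ne' ht)
  simpa using this

/-- The t-derivative is F₀ plus Duhamel's integral of F₂. The forcing itself therefore appears
undamped, which is why F₀ must be C¹ and F₁, F₂ continuous on the punctured quarter-plane. -/
lemma contDiffOn_two_duhamel {F₀ F₁ F₂ F₃ F₄ : ℝ × ℝ → ℂ} (h₀ : Tame F₀) (h₁ : Tame F₁)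
    (h₂ : Tame F₂) (h₃ : Tame F₃) (h₄ : Tame F₄)
    (d₀ : IsXDeriv F₀ F₁) (d₁ : IsXDeriv F₁ F₂) (d₂ : IsXDeriv F₂ F₃) (d₃ : IsXDeriv F₃ F₄)
    (c₀ : ContDiffOn ℝ 1 F₀ QbarPunctured) (c₁ : ContinuousOn F₁ QbarPunctured)
    (c₂ : ContinuousOn F₂ QbarPunctured) :
    ContDiffOn ℝ 2 (fun p : ℝ × ℝ => duhamel F₀ p.1 p.2) QbarPunctured := by
  have := contDiffOn_succ_of_partials (n := 1) h₀.continuousOn_duhamel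
    (by exact_mod_cast contDiffOn_one_duhamel h₁ h₂ h₃ d₁ d₂ c₁)
    (by exact_mod_cast c₀.add (contDiffOn_one_duhamel h₂ h₃ h₄ d₂ d₃ c₂))
    (fun x t hx ht => d₀.hasDerivAt_duhamel_x h₀ h₁ hx.ne' ht.le)
    (fun x t hx ht => d₀.hasDerivAt_duhamel_t d₁ h₀ h₁ h₂ hx.ne' ht)
  exact_mod_cast this

/-! ### Chains coming from the data, and exponential layers. -/

/-- The iterated `x`-derivatives of a function on the quarter-plane. -/
def xDeriv (f : ℝ × ℝ → ℂ) (j : ℕ) (p : ℝ × ℝ) : ℂ :=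
  iteratedDerivWithin j (fun y => f (y, p.2)) (Ici 0) p.1

lemma uniqueDiffOn_Qbar : UniqueDiffOn ℝ Qbar :=
  (uniqueDiffOn_Ici (0 : ℝ)).prod (uniqueDiffOn_Ici (0 : ℝ))

lemma contDiffOn_derivWithin_fst {g : ℝ × ℝ → ℂ} (hg : ContDiffOn ℝ ∞ g Qbar) :
    ContDiffOn ℝ ∞ (fun p : ℝ × ℝ => derivWithin (fun y => g (y, p.2)) (Ici 0) p.1) Qbar := by
  have h := (hg.fderivWithin uniqueDiffOn_Qbar (m := ∞) (by simp)).clm_apply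
    (contDiffOn_const (c := ((1 : ℝ), (0 : ℝ))))
  refine h.congr fun p hp => ?_
  have h1 := (hg.differentiableOn (by simp) p hp).hasFDerivWithinAt
  have h2 : HasDerivWithinAt (fun y : ℝ => (y, p.2)) ((1 : ℝ), (0 : ℝ)) (Ici 0) p.1 :=
    ((hasDerivAt_id p.1).prodMk (hasDerivAt_const p.1 p.2)).hasDerivWithinAt
  exact (h1.comp_hasDerivWithinAt p.1 h2
    (show MapsTo (fun y : ℝ => (y, p.2)) (Ici 0) Qbar from fun y hy => ⟨hy, hp.2⟩)).derivWithin
    (uniqueDiffOn_Ici 0 p.1 hp.1)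

lemma contDiffOn_xDeriv {f : ℝ × ℝ → ℂ} (hf : ContDiffOn ℝ ∞ f Qbar) (j : ℕ) :
    ContDiffOn ℝ ∞ (xDeriv f j) Qbar := by
  induction j with
  | zero => exact hf.congr fun p _ => by simp [xDeriv]
  | succ j ih =>
    refine (contDiffOn_derivWithin_fst ih).congr fun p _ => ?_
    simp only [xDeriv, iteratedDerivWithin_succ]

lemma contDiffOn_slice {g : ℝ × ℝ → ℂ} (hg : ContDiffOn ℝ ∞ g Qbar) {t : ℝ} (ht : 0 ≤ t) :
    ContDiffOn ℝ ∞ (fun y => g (y, t)) (Ici 0) :=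
  hg.comp (contDiff_prodMk_left t).contDiffOn fun _ hy => ⟨hy, ht⟩

lemma IsAdmissibleForcing.decayChain {f : ℝ × ℝ → ℂ} (hf : IsAdmissibleForcing f) :
    DecayChain (xDeriv f) where
  continuousOn j := (contDiffOn_xDeriv hf.1 j).continuousOn
  decay j T := by
    -- The weights x⁰ and x² add up to 1 + x².
    obtain ⟨C, hC⟩ := hf.2 j 0 T
    obtain ⟨D, hD⟩ := hf.2 j 2 T
    refine ⟨C + D, fun x t hx ht hT => ?_⟩
    rw [le_div_iff₀ (by positivity), mul_comm, add_mul]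
    exact add_le_add (by simpa [xDeriv] using hC x t hx ht hT) (hD x t hx ht hT)
  hasDerivAt j x t hx ht := by
    have h := (contDiffOn_slice (contDiffOn_xDeriv hf.1 j) ht).differentiableOn (by simp) x hx.le
    have h2 := h.hasDerivWithinAt.hasDerivAt (Ici_mem_nhds hx)
    refine h2.congr_deriv ?_
    simp only [xDeriv, iteratedDerivWithin_succ]

/-- Initial data count as forcing that is constant in time, so one theory of chains and reflections
serves both. -/
lemma IsSchwartzHalfLine.isAdmissibleForcing {u : ℝ → ℂ} (hu : IsSchwartzHalfLine u) :
    IsAdmissibleForcing fun p => u p.1 := by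
  refine ⟨hu.1.comp contDiff_fst.contDiffOn fun p hp => hp.1, fun k l T => ?_⟩
  obtain ⟨C, hC⟩ := hu.2 k l
  exact ⟨C, fun x t hx _ _ => hC x hx⟩

/-- The derivatives of `∑ i, c i t * e^{-(i+1) x}` in `x`. -/
def expSum (c : Fin 3 → ℝ → ℂ) (j : ℕ) (p : ℝ × ℝ) : ℂ :=
  ∑ i : Fin 3, (((-((i : ℝ) + 1)) ^ j * Real.exp (-((i : ℝ) + 1) * p.1) : ℝ) : ℂ) * c i p.2

lemma hasDerivAt_exp_neg_mul (κ x : ℝ) (j : ℕ) :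
    HasDerivAt (fun y => (((-κ) ^ j * Real.exp (-κ * y) : ℝ) : ℂ))
      (((-κ) ^ (j + 1) * Real.exp (-κ * x) : ℝ) : ℂ) x := by
  have h := (((hasDerivAt_id x).const_mul (-κ)).exp.const_mul ((-κ) ^ j)).ofReal_comp
  refine h.congr_deriv ?_
  simp only [id, mul_one, pow_succ]
  congr 1
  ring

lemma hasDerivAt_expSum (c : Fin 3 → ℝ → ℂ) (j : ℕ) (x t : ℝ) :
    HasDerivAt (fun y => expSum c j (y, t)) (expSum c (j + 1) (x, t)) x :=
  HasDerivAt.fun_sum fun i _ => (hasDerivAt_exp_neg_mul ((i : ℝ) + 1) x j).mul_const (c i t)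

lemma exp_neg_mul_le {κ x : ℝ} (hκ : 1 ≤ κ) (hx : 0 ≤ x) :
    Real.exp (-κ * x) ≤ 2 / (1 + x ^ 2) := by
  have h1 : 1 + x + x ^ 2 / 2 ≤ Real.exp x := Real.quadratic_le_exp_of_nonneg hx
  have h2 : Real.exp (-κ * x) ≤ (Real.exp x)⁻¹ := by
    rw [← Real.exp_neg]; exact Real.exp_le_exp.2 (by nlinarith)
  refine h2.trans ?_
  rw [inv_eq_one_div, div_le_div_iff₀ (Real.exp_pos x) (by positivity)]
  nlinarith

lemma decayChain_expSum {c : Fin 3 → ℝ → ℂ} (hc : ∀ i, ContinuousOn (c i) (Ici 0)) :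
    DecayChain (expSum c) where
  continuousOn j := by
    refine continuousOn_finsetSum _ fun i _ => ContinuousOn.mul ?_
      ((hc i).comp continuousOn_snd fun p hp => hp.2)
    exact Continuous.continuousOn (by fun_prop)
  decay j T := by
    have hb : ∀ i, ∃ C, ∀ t ∈ Icc 0 T, ‖c i t‖ ≤ C := fun i =>
      isCompact_Icc.exists_bound_of_continuousOn ((hc i).mono Icc_subset_Ici_self)
    choose C hC using hb
    refine ⟨∑ i : Fin 3, ((i : ℝ) + 1) ^ j * 2 * C i, fun x t hx ht hT => ?_⟩
    rw [Finset.sum_div]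
    refine norm_sum_le_of_le _ fun i _ => ?_
    have hi : (0 : ℝ) ≤ i := by positivity
    rw [norm_mul, Complex.norm_real, norm_mul, norm_pow, norm_neg, Real.norm_of_nonneg (by positivity),
      Real.norm_of_nonneg (Real.exp_pos _).le]
    calc ((i : ℝ) + 1) ^ j * Real.exp (-((i : ℝ) + 1) * x) * ‖c i t‖
        ≤ ((i : ℝ) + 1) ^ j * (2 / (1 + x ^ 2)) * C i := by
          gcongr
          · exact exp_neg_mul_le (by linarith) hx
          · exact hC i t ⟨ht, hT⟩
      _ = _ := by ring
  hasDerivAt j x t _ _ := hasDerivAt_expSum c j x t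

/-! ### The Poisson kernel and the representation of exponential layers. -/

/-- The Poisson kernel of the half-line for the heat equation. -/
def poissonKernel (x σ : ℝ) : ℝ := x / σ * (√σ)⁻¹ * gaussDensity (x / √σ)

lemma poissonKernel_nonneg {x σ : ℝ} (hx : 0 ≤ x) (hσ : 0 ≤ σ) : 0 ≤ poissonKernel x σ :=
  mul_nonneg (by positivity) (gaussDensity_pos _).le

lemma tame_sign : Tame (reflect (-1) fun _ => 1) :=
  tame_reflect (by simp) continuousOn_const fun _ => ⟨1, by simp⟩

/-- The heat evolution of the sign function is an error function of x/√σ, namely twice a Gaussian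
tail minus 1. Its time derivative is minus the Poisson kernel, which thus records the effect of a
jump of size 2 at x = 0. -/
lemma hasDerivAt_gaussAvg_sign {x σ : ℝ} (hσ : 0 < σ) :
    HasDerivAt (fun σ => gaussAvg (reflect (-1) fun _ => 1) x (√σ) 0)
      (-poissonKernel x σ : ℝ) σ := by
  have key : ∀ a : ℝ, 0 < a → gaussAvg (reflect (-1) fun _ => 1) x a 0 =
      ((2 * ((∫ z in (-(x / a))..0, gaussDensity z) + ∫ z in Ioi 0, gaussDensity z) - 1 : ℝ) : ℂ) := by
    intro a ha
    have e : ∀ z, (gaussDensity z : ℂ) * reflect (-1) (fun _ => 1) (x + a * z, 0) =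
        ((2 * (Ici (-(x / a))).indicator gaussDensity z - gaussDensity z : ℝ) : ℂ) := by
      intro z
      have : -(x / a) ≤ z ↔ 0 ≤ x + a * z := by
        rw [← neg_div, div_le_iff₀ ha]; constructor <;> intro h <;> linarith
      by_cases h : 0 ≤ x + a * z
      · simp [reflect, h, indicator, this]; ring
      · simp [reflect, h, indicator, this]
    simp only [gaussAvg, e]
    rw [integral_complex_ofReal, integral_sub ((integrable_gaussDensity.indicator
      measurableSet_Ici).const_mul 2) integrable_gaussDensity, integral_const_mul,
      integral_indicator measurableSet_Ici, integral_gaussDensity, integral_Ici_eq_integral_Ioi,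
      intervalIntegral.integral_interval_add_Ioi integrable_gaussDensity.integrableOn
        integrable_gaussDensity.integrableOn]
  have hs : 0 < √σ := Real.sqrt_pos.2 hσ
  have h1 : HasDerivAt (fun σ => -(x / √σ)) (x / (2 * σ * √σ)) σ := by
    have := ((Real.hasDerivAt_sqrt hσ.ne').inv hs.ne').const_mul (-x)
    refine (this.congr_of_eventuallyEq (Eventually.of_forall fun r => ?_)).congr_deriv ?_
    · simp [div_eq_mul_inv]
    · rw [Real.sq_sqrt hσ.le]; field_simp
  have h2 : HasDerivAt (fun c => ∫ z in c..0, gaussDensity z) (-gaussDensity (-(x / √σ)))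
      (-(x / √σ)) :=
    intervalIntegral.integral_hasDerivAt_left
      (continuous_gaussDensity.intervalIntegrable _ _)
      (continuous_gaussDensity.stronglyMeasurableAtFilter _ _) continuous_gaussDensity.continuousAt
  have h3 := ((((h2.comp σ h1).add_const (∫ z in Ioi 0, gaussDensity z)).const_mul 2).sub_const
    1).ofReal_comp
  refine (h3.congr_of_eventuallyEq ?_).congr_deriv ?_
  · filter_upwards [Ioi_mem_nhds hσ] with r hr
    exact key (√r) (Real.sqrt_pos.2 hr)
  · congr 1
    rw [gaussDensity_neg, poissonKernel]
    field_simp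

lemma continuous_gaussAvg_sign {x : ℝ} (hx : x ≠ 0) :
    Continuous fun σ => gaussAvg (reflect (-1) fun _ => 1) x (√σ) 0 :=
  tame_sign.continuousOn_gaussAvg_sqrt hx 0

/-- A nonnegative derivative of a function continuous up to the endpoints is integrable, so no
estimate of the kernel near σ = 0 is needed. -/
lemma intervalIntegrable_poissonKernel {x t : ℝ} (hx : 0 < x) (ht : 0 ≤ t) :
    IntervalIntegrable (fun σ => poissonKernel x σ) volume 0 t := by
  have h := intervalIntegral.intervalIntegrable_deriv_of_nonneg (a := 0) (b := t)
    (g := fun σ => -(gaussAvg (reflect (-1) fun _ => 1) x (√σ) 0).re)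
    (g' := fun σ => poissonKernel x σ)
    (Complex.continuous_re.comp (continuous_gaussAvg_sign hx.ne')).neg.continuousOn ?_ ?_
  · exact h
  · intro σ hσ
    rw [min_eq_left ht] at hσ
    have h1 := Complex.reCLM.hasFDerivAt.comp_hasDerivAt σ
      (hasDerivAt_gaussAvg_sign (x := x) hσ.1)
    refine h1.neg.congr_deriv ?_
    simp
  · intro σ hσ
    rw [min_eq_left ht] at hσ
    exact poissonKernel_nonneg hx.le hσ.1.le

lemma intervalIntegrable_poissonKernel_mul {x t : ℝ} (hx : 0 < x) (ht : 0 ≤ t) {w : ℝ → ℂ}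
    (hw : ContinuousOn w (Ici 0)) :
    IntervalIntegrable (fun τ => (poissonKernel x (t - τ) : ℂ) * w τ) volume 0 t := by
  have h1 := (intervalIntegrable_poissonKernel hx ht).comp_sub_left t
  simp only [sub_zero, sub_self] at h1
  refine IntervalIntegrable.mul_continuousOn (f := fun τ => (poissonKernel x (t - τ) : ℂ))
    ⟨h1.2.ofReal, h1.1.ofReal⟩ (hw.mono ?_)
  rw [uIcc_of_le ht]; exact Icc_subset_Ici_self

/-- The odd extension of `e^{-κ x}`. -/
def oddExp (κ : ℝ) : ℝ × ℝ → ℂ := reflect (-1) fun p => (Real.exp (-κ * p.1) : ℂ)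

lemma norm_exp_neg_mul_le {κ x : ℝ} (hκ : 0 ≤ κ) (hx : 0 ≤ x) : Real.exp (-κ * x) ≤ 1 :=
  Real.exp_le_one_iff.2 (by nlinarith)

lemma tame_reflect_exp {ε κ : ℝ} (hε : |ε| = 1) (hκ : 0 ≤ κ) (a b : ℂ) :
    Tame (reflect ε fun p => a * (Real.exp (-κ * p.1) : ℂ) + b) := by
  refine tame_reflect hε (Continuous.continuousOn (by fun_prop)) fun _ =>
    ⟨‖a‖ + ‖b‖, fun x t hx _ _ => (norm_add_le _ _).trans (add_le_add_left ?_ _)⟩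
  rw [norm_mul, Complex.norm_of_nonneg (Real.exp_pos _).le]
  exact mul_le_of_le_one_right (norm_nonneg a) (norm_exp_neg_mul_le hκ hx)

lemma tame_oddExp {κ : ℝ} (hκ : 0 ≤ κ) : Tame (oddExp κ) := by
  simpa [oddExp] using tame_reflect_exp (ε := -1) (by simp) hκ 1 0

/-- The odd extension of e^{-κx} jumps at 0, so the heat equation for averages does not apply to it
directly. Subtracting the sign function removes the jump, and the sign function contributes the
Poisson kernel. -/
lemma hasDerivAt_gaussAvg_oddExp {κ x σ : ℝ} (hκ : 0 ≤ κ) (hσ : 0 < σ) :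
    HasDerivAt (fun σ => gaussAvg (oddExp κ) x (√σ) 0)
      (κ ^ 2 * gaussAvg (oddExp κ) x (√σ) 0 - poissonKernel x σ) σ := by
  have hd : ∀ (a b : ℂ) (x t : ℝ), HasDerivAt
      (fun y : ℝ => (fun p : ℝ × ℝ => a * (Real.exp (-κ * p.1) : ℂ) + b) (y, t))
      ((fun p : ℝ × ℝ => -(κ * a) * (Real.exp (-κ * p.1) : ℂ) + 0) (x, t)) x := by
    intro a b x t
    have := ((hasDerivAt_exp_neg_mul κ x 0).const_mul a).add_const b
    simp only [pow_zero, one_mul, zero_add, pow_one] at this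
    refine this.congr_deriv ?_
    push_cast; ring
  have hc : ∀ a b : ℂ, ContinuousOn (fun p : ℝ × ℝ => a * (Real.exp (-κ * p.1) : ℂ) + b) Qbar :=
    fun a b => Continuous.continuousOn (by fun_prop)
  have d₀ := isXDeriv_reflect (ε := -1)
    (φ' := fun p => -(κ * 1) * (Real.exp (-κ * p.1) : ℂ) + 0) (hc 1 (-1)) (by simp) fun x t _ _ => hd 1 (-1) x t
  rw [neg_neg] at d₀
  have d₁ := isXDeriv_reflect (ε := 1)
    (φ' := fun p => -(κ * -(κ * 1)) * (Real.exp (-κ * p.1) : ℂ) + 0) (hc (-(κ * 1)) 0) (by simp) fun x t _ _ =>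
    hd (-(κ * 1)) 0 x t
  have t₀ := tame_reflect_exp (ε := -1) (by simp) hκ 1 (-1)
  have t₂ := tame_reflect_exp (ε := -1) (by simp) hκ (-(κ * -(κ * 1))) 0
  have h := (d₀.hasDerivAt_gaussAvg_sqrt d₁ t₀
    (tame_reflect_exp (by simp) hκ _ _) t₂ x hσ 0).add (hasDerivAt_gaussAvg_sign (x := x) hσ)
  have e : oddExp κ = (reflect (-1) fun p => 1 * (Real.exp (-κ * p.1) : ℂ) + -1) +
      reflect (-1) fun _ => 1 := by
    funext p
    simp only [oddExp, reflect, Pi.add_apply]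
    split_ifs <;> push_cast <;> ring
  have e2 : gaussAvg (reflect (-1) fun p => -(κ * -(κ * 1)) * (Real.exp (-κ * p.1) : ℂ) + 0)
      x (√σ) 0 = κ ^ 2 * gaussAvg (oddExp κ) x (√σ) 0 := by
    unfold gaussAvg
    rw [← integral_const_mul]
    refine integral_congr_ae (Eventually.of_forall fun z => ?_)
    simp only [oddExp, reflect]
    split_ifs <;> ring
  refine (h.congr_of_eventuallyEq (Eventually.of_forall fun r => ?_)).congr_deriv ?_
  · rw [e, t₀.gaussAvg_add tame_sign]; rfl
  · rw [e2]; push_cast; ring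

/-- The half-line representation formula for `e^{-κ x} w(t)`. -/
lemma exp_mul_eq_halfLine {κ x t : ℝ} (hκ : 0 ≤ κ) (hx : 0 < x) (ht : 0 ≤ t) {w : ℝ → ℂ}
    (hw : ContDiffOn ℝ ∞ w (Ici 0)) :
    (Real.exp (-κ * x) : ℂ) * w t = gaussAvg (oddExp κ) x (√t) 0 * w 0 +
      (∫ τ in (0 : ℝ)..t, (poissonKernel x (t - τ) : ℂ) * w τ) +
      ∫ τ in (0 : ℝ)..t, gaussAvg (oddExp κ) x (√(t - τ)) 0 *
        (derivWithin w (Ici 0) τ - κ ^ 2 * w τ) := by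
  have hwc : ContinuousOn w (Ici 0) := hw.continuousOn
  have hwc' : ContinuousOn (derivWithin w (Ici 0)) (Ici 0) :=
    hw.continuousOn_derivWithin (uniqueDiffOn_Ici 0) (by simp)
  have hsub : Icc 0 t ⊆ Ici (0 : ℝ) := Icc_subset_Ici_self
  have hq : Continuous fun τ => gaussAvg (oddExp κ) x (√(t - τ)) 0 :=
    ((tame_oddExp hκ).continuousOn_gaussAvg_sqrt hx.ne' 0).comp (by fun_prop)
  have i1 := intervalIntegrable_poissonKernel_mul hx ht hwc
  have i2 : IntervalIntegrable (fun τ => gaussAvg (oddExp κ) x (√(t - τ)) 0 *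
      (derivWithin w (Ici 0) τ - κ ^ 2 * w τ)) volume 0 t := by
    refine ContinuousOn.intervalIntegrable ?_
    rw [uIcc_of_le ht]
    exact hq.continuousOn.mul ((hwc'.mono hsub).sub (continuousOn_const.mul (hwc.mono hsub)))
  -- With G the average of the odd exponential and P the Poisson kernel, both at time t - τ, the
  -- product Gw has τ-derivative Pw + G(w' - κ²w). At τ = t it equals e^{-κx} w(t), and at τ = 0 it
  -- is the evolved initial value.
  have h := intervalIntegral.integral_eq_sub_of_hasDerivAt_of_le ht
    (f := fun τ => gaussAvg (oddExp κ) x (√(t - τ)) 0 * w τ)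
    (hq.continuousOn.mul (hwc.mono hsub)) (fun τ hτ => ?_) (i1.add i2)
  · have h' := (intervalIntegral.integral_add i1 i2).symm.trans h
    simp only [sub_self, Real.sqrt_zero, gaussAvg_zero, sub_zero] at h'
    have e : oddExp κ (x, 0) = (Real.exp (-κ * x) : ℂ) := reflect_of_nonneg hx.le le_rfl
    rw [e] at h'
    linear_combination -h'
  · have h1 := (hasDerivAt_gaussAvg_oddExp (x := x) hκ (sub_pos.2 hτ.2)).scomp τ
      ((hasDerivAt_id τ).const_sub t)
    have h2 := ((hw.differentiableOn (by simp)) τ hτ.1.le).hasDerivWithinAt.hasDerivAt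
      (Ici_mem_nhds hτ.1)
    refine (h1.mul h2).congr_deriv ?_
    simp
    ring

/-! ### The exponential kernel on the real line and on γ. -/

/-- The heat kernel on the line. -/
def heatKernel (σ z : ℝ) : ℝ := (√σ)⁻¹ * gaussDensity (z / √σ)

lemma poissonKernel_eq (x σ : ℝ) : poissonKernel x σ = x / σ * heatKernel σ x := by
  unfold poissonKernel heatKernel; ring

lemma heatKernel_neg (σ z : ℝ) : heatKernel σ (-z) = heatKernel σ z := by
  rw [heatKernel, neg_div, gaussDensity_neg, heatKernel]

lemma heatKernel_nonneg (σ z : ℝ) : 0 ≤ heatKernel σ z :=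
  mul_nonneg (by positivity) (gaussDensity_pos _).le

lemma heatKernel_le (σ z : ℝ) : heatKernel σ z ≤ (√σ)⁻¹ * (√(4 * Real.pi))⁻¹ := by
  unfold heatKernel gaussDensity
  refine mul_le_mul_of_nonneg_left ?_ (by positivity)
  refine mul_le_of_le_one_right (by positivity) (Real.exp_le_one_iff.2 ?_)
  nlinarith [sq_nonneg (z / √σ)]

lemma measurable_heatKernel : Measurable fun p : ℝ × ℝ => heatKernel p.1 p.2 := by
  unfold heatKernel
  have := continuous_gaussDensity.measurable
  fun_prop

lemma norm_kernel (x t : ℝ) (lam : ℂ) :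
    ‖kernel x t lam‖ = Real.exp (-lam.im * x - (lam ^ 2).re * t) := by
  rw [kernel, Complex.norm_exp]
  congr 1
  simp

lemma norm_kernel_ofReal (x t lam : ℝ) : ‖kernel x t lam‖ = Real.exp (-t * lam ^ 2) := by
  rw [norm_kernel, ← Complex.ofReal_pow, Complex.ofReal_re, Complex.ofReal_im]
  congr 1; ring

/-- The directions of the two rays of `γ`. -/
def IsRay (w : ℂ) : Prop := w.im = 1 ∧ (w.re = 1 ∨ w.re = -1)

lemma isRay_right : IsRay (1 + Complex.I) := by simp [IsRay]

lemma isRay_left : IsRay (-1 + Complex.I) := by simp [IsRay]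

lemma IsRay.sq_re {w : ℂ} (hw : IsRay w) : (w ^ 2).re = 0 := by
  obtain ⟨h1, h2⟩ := hw
  rw [sq, Complex.mul_re, h1]
  rcases h2 with h2 | h2 <;> rw [h2] <;> norm_num

/-- On the rays λ² is purely imaginary, so the time factor has modulus 1 and all decay comes from x.
The bounds on γ are therefore uniform in time. -/
lemma IsRay.norm_kernel {w : ℂ} (hw : IsRay w) (x t s : ℝ) :
    ‖kernel x t (s * w)‖ = Real.exp (-x * s) := by
  rw [HeatUTM.norm_kernel, mul_pow, ← Complex.ofReal_pow, Complex.re_ofReal_mul,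
    Complex.im_ofReal_mul, hw.sq_re, hw.1]
  congr 1; ring

lemma continuous_kernel (x t : ℝ) : Continuous (kernel x t) := by
  unfold kernel; fun_prop

lemma hasDerivAt_kernel (x t : ℝ) (lam : ℂ) :
    HasDerivAt (kernel x t) ((Complex.I * x - 2 * lam * t) * kernel x t lam) lam := by
  have h : HasDerivAt (fun lam : ℂ => Complex.I * lam * x - lam ^ 2 * t)
      (Complex.I * x - 2 * lam * t) lam := by
    refine ((((hasDerivAt_id lam).const_mul Complex.I).mul_const (x : ℂ)).sub
      ((hasDerivAt_pow 2 lam).mul_const (t : ℂ))).congr_deriv ?_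
    simp
  exact h.cexp.congr_deriv (mul_comm _ _)

lemma integrable_kernel_ofReal (z : ℝ) {σ : ℝ} (hσ : 0 < σ) :
    Integrable fun lam : ℝ => kernel z σ lam := by
  refine (integrable_exp_neg_mul_sq hσ).mono'
    ((continuous_kernel z σ).comp Complex.continuous_ofReal).aestronglyMeasurable
    (Eventually.of_forall fun lam => ?_)
  rw [norm_kernel_ofReal]

lemma integral_kernel (z : ℝ) {σ : ℝ} (hσ : 0 < σ) :
    ∫ lam : ℝ, kernel z σ lam = 2 * Real.pi * heatKernel σ z := by
  have h := fourierIntegral_gaussian (b := (σ : ℂ)) (by simpa using hσ) (z : ℂ)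
  have e : ∀ lam : ℝ, kernel z σ lam =
      Complex.exp (Complex.I * z * lam) * Complex.exp (-σ * lam ^ 2) := by
    intro lam
    rw [kernel, ← Complex.exp_add]
    congr 1; ring
  simp_rw [e, h]
  have h1 : ((Real.pi : ℂ) / σ) ^ (1 / 2 : ℂ) = (√(Real.pi / σ) : ℝ) := by
    rw [Real.sqrt_eq_rpow, Complex.ofReal_cpow (by positivity)]
    push_cast; rfl
  have h2 : 2 * Real.pi * heatKernel σ z = √(Real.pi / σ) * Real.exp (-z ^ 2 / (4 * σ)) := by
    have hp : √(4 * Real.pi) = 2 * √Real.pi := by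
      rw [Real.sqrt_mul (by norm_num), show (4 : ℝ) = 2 ^ 2 by norm_num,
        Real.sqrt_sq (by norm_num)]
    have hs : √σ ≠ 0 := (Real.sqrt_pos.2 hσ).ne'
    have hp' : √Real.pi ≠ 0 := (Real.sqrt_pos.2 Real.pi_pos).ne'
    have e1 : -(1 / 4) * (z / √σ) ^ 2 = -z ^ 2 / (4 * σ) := by
      rw [div_pow, Real.sq_sqrt hσ.le]; field_simp
    rw [heatKernel, gaussDensity, e1, hp, Real.sqrt_div' _ hσ.le]
    field_simp
    rw [Real.sq_sqrt Real.pi_pos.le]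
  rw [h1]
  have h3 : (2 * Real.pi * heatKernel σ z : ℂ) = ((2 * Real.pi * heatKernel σ z : ℝ) : ℂ) := by
    push_cast; ring
  rw [h3, h2]
  push_cast; ring

lemma IsRay.integrableOn_kernel {w : ℂ} (hw : IsRay w) {z : ℝ} (hz : 0 < z) (σ : ℝ) :
    IntegrableOn (fun s : ℝ => kernel z σ (s * w)) (Ioi 0) := by
  refine Integrable.mono' (integrableOn_exp_mul_Ioi (neg_lt_zero.2 hz) 0)
    ((continuous_kernel z σ).comp (by fun_prop)).aestronglyMeasurable
    (Eventually.of_forall fun s => ?_)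
  rw [hw.norm_kernel]

lemma IsRay.norm {w : ℂ} (hw : IsRay w) : ‖w‖ ≤ 2 := by
  refine (Complex.norm_le_abs_re_add_abs_im w).trans ?_
  rcases hw.2 with h | h <;> rw [h, hw.1] <;> norm_num

lemma IsRay.integrableOn_mul_kernel {w : ℂ} (hw : IsRay w) {z : ℝ} (hz : 0 < z) (σ : ℝ) :
    IntegrableOn (fun s : ℝ => s * w * kernel z σ (s * w)) (Ioi 0) := by
  have h : IntegrableOn (fun s : ℝ => s * Real.exp (-z * s)) (Ioi 0) := by
    have := integrableOn_rpow_mul_exp_neg_mul_rpow (s := 1) (p := 1) (b := z) (by norm_num)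
      one_pos hz
    simpa using this
  refine Integrable.mono' (h.const_mul 2)
    ((by fun_prop : Continuous fun s : ℝ => (s * w : ℂ)).mul
      ((continuous_kernel z σ).comp (by fun_prop))).aestronglyMeasurable
    ((ae_restrict_iff' measurableSet_Ioi).2 (Eventually.of_forall fun s hs => ?_))
  rw [norm_mul, norm_mul, hw.norm_kernel, Complex.norm_of_nonneg (mem_Ioi.1 hs).le]
  have h0 : 0 ≤ s * Real.exp (-z * s) := mul_nonneg (mem_Ioi.1 hs).le (Real.exp_pos _).le
  nlinarith [mul_le_mul_of_nonneg_right hw.norm h0]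

lemma tendsto_mul_exp_neg {δ : ℝ} (hδ : 0 < δ) :
    Tendsto (fun R : ℝ => R * Real.exp (-δ * R)) atTop (𝓝 0) := by
  have := tendsto_rpow_mul_exp_neg_mul_atTop_nhds_zero 1 δ hδ
  simpa using this

/-- Rotation of a half-line of integration onto a ray of `γ`. -/
lemma IsRay.integral_kernel {w : ℂ} (hw : IsRay w) {z σ : ℝ} (hz : 0 < z) (hσ : 0 < σ) :
    ∫ s in Ioi (0 : ℝ), kernel z σ (s * w) * w =
      ∫ s in Ioi (0 : ℝ), kernel z σ (s * (w.re : ℂ)) * w.re := by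
  have hre : w.re ^ 2 = 1 := by rcases hw.2 with h | h <;> rw [h] <;> norm_num
  have i1 : IntegrableOn (fun s : ℝ => kernel z σ (s * w) * w) (Ioi 0) :=
    (hw.integrableOn_kernel hz σ).mul_const w
  have i2 : IntegrableOn (fun s : ℝ => kernel z σ (s * (w.re : ℂ)) * w.re) (Ioi 0) := by
    refine Integrable.mul_const ?_ _
    have h0 : w.re ≠ 0 := by intro h; rw [h] at hre; norm_num at hre
    have := (integrable_kernel_ofReal z hσ).comp_mul_right' h0
    simp only [Complex.ofReal_mul] at this
    exact this.integrableOn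
  have l1 := intervalIntegral_tendsto_integral_Ioi 0 i1 tendsto_id
  have l2 := intervalIntegral_tendsto_integral_Ioi 0 i2 tendsto_id
  refine tendsto_nhds_unique l1 ?_
  -- Decay rate on the segment joining the two rays at distance R. At height αR the exponent is
  -- -(Rαz + R²(1 - α²)σ), which for R ≥ 1 is at most -R·min(z, σ).
  have hδ : 0 < min z σ := lt_min hz hσ
  suffices hlim : Tendsto (fun R : ℝ => (∫ s in (0 : ℝ)..id R, kernel z σ (s * w) * w) -
      ∫ s in (0 : ℝ)..id R, kernel z σ (s * (w.re : ℂ)) * w.re) atTop (𝓝 0) by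
    have := l2.add hlim
    rw [add_zero] at this
    refine this.congr fun R => ?_
    ring
  refine squeeze_zero_norm' ?_ (tendsto_mul_exp_neg hδ)
  filter_upwards [eventually_ge_atTop 1] with R hR
  -- Cauchy's theorem in the form of a primitive. The directions have norm at most 2, so the radius
  -- 3R contains all the paths.
  obtain ⟨Φ, hΦ⟩ := DifferentiableOn.isExactOn_ball (c := 0) (r := 3 * R)
    (f := kernel z σ) fun lam _ => (hasDerivAt_kernel z σ lam).differentiableAt.differentiableWithinAt
  have hball : ∀ (v : ℂ) (s : ℝ), ‖v‖ ≤ 2 → s ∈ uIcc 0 R → (s * v : ℂ) ∈ Metric.ball 0 (3 * R) := by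
    intro v s hv hs
    rw [uIcc_of_le (by linarith)] at hs
    rw [mem_ball_zero_iff, norm_mul, Complex.norm_of_nonneg hs.1]
    nlinarith [norm_nonneg v, hs.1, hs.2]
  have hray : ∀ v : ℂ, ‖v‖ ≤ 2 → ∫ s in (0 : ℝ)..R, kernel z σ (s * v) * v =
      Φ (R * v) - Φ 0 := by
    intro v hv
    have := intervalIntegral.integral_eq_sub_of_hasDerivAt (a := 0) (b := R)
      (f := fun s : ℝ => Φ (s * v)) (f' := fun s : ℝ => kernel z σ (s * v) * v)
      (fun s hs => ?_) (Continuous.intervalIntegrable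
        (((continuous_kernel z σ).comp (by fun_prop)).mul continuous_const) _ _)
    · rw [this]; simp
    · have h1 : HasDerivAt (fun s : ℝ => (s * v : ℂ)) v s := by
        simpa using (Complex.ofRealCLM.hasDerivAt (x := s)).mul_const v
      exact (hΦ _ (hball v s hv hs)).comp s h1
  have hvn : ‖(w.re : ℂ)‖ ≤ 2 := by
    rw [Complex.norm_real]; exact (Complex.abs_re_le_norm w).trans hw.norm
  rw [id, hray w hw.norm, hray _ hvn, sub_sub_sub_cancel_right]
  have hw' : w = w.re + Complex.I := by
    conv_lhs => rw [← Complex.re_add_im w, hw.1]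
    simp
  -- The closing vertical segment from R·Re w to Rw.
  have hseg : ∫ α in (0 : ℝ)..1, kernel z σ (R * (w.re + α * Complex.I)) * (R * Complex.I) =
      Φ (R * w) - Φ (R * w.re) := by
    have := intervalIntegral.integral_eq_sub_of_hasDerivAt (a := 0) (b := 1)
      (f := fun α : ℝ => Φ (R * (w.re + α * Complex.I)))
      (f' := fun α : ℝ => kernel z σ (R * (w.re + α * Complex.I)) * (R * Complex.I))
      (fun α hα => ?_) (Continuous.intervalIntegrable
        (((continuous_kernel z σ).comp (by fun_prop)).mul continuous_const) _ _)
    · rw [this, hw']; simp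
    · have h1 : HasDerivAt (fun α : ℝ => (R * (w.re + α * Complex.I) : ℂ)) (R * Complex.I) α := by
        have := (((Complex.ofRealCLM.hasDerivAt (x := α)).mul_const Complex.I).const_add
          (w.re : ℂ)).const_mul (R : ℂ)
        simpa using this
      rw [uIcc_of_le zero_le_one] at hα
      refine (hΦ _ (hball _ R ?_ right_mem_uIcc)).comp α h1
      refine (norm_add_le _ _).trans ?_
      have hre' : |w.re| = 1 := by rcases hw.2 with h | h <;> rw [h] <;> norm_num
      rw [Complex.norm_real, norm_mul, Complex.norm_I, Complex.norm_of_nonneg hα.1,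
        Real.norm_eq_abs, hre']
      linarith [hα.2]
  rw [← hseg]
  have hbound := intervalIntegral.norm_integral_le_of_norm_le_const (a := 0) (b := 1)
    (f := fun α : ℝ => kernel z σ (R * (w.re + α * Complex.I)) * (R * Complex.I))
    (C := R * Real.exp (-min z σ * R)) fun α hα => ?_
  · simpa using hbound
  · rw [uIoc_of_le zero_le_one] at hα
    rw [norm_mul, norm_mul, Complex.norm_I, mul_one, Complex.norm_of_nonneg (by linarith), mul_comm,
      HeatUTM.norm_kernel]
    refine mul_le_mul_of_nonneg_left (Real.exp_le_exp.2 ?_) (by linarith)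
    have e1 : ((R : ℂ) * (w.re + α * Complex.I)).im = R * α := by simp
    have e2 : (((R : ℂ) * (w.re + α * Complex.I)) ^ 2).re = R ^ 2 * (1 - α ^ 2) := by
      rw [sq, Complex.mul_re, e1]
      simp
      linear_combination R ^ 2 * hre
    rw [e1, e2]
    have hz' := min_le_left z σ
    have hσ' := min_le_right z σ
    have h1 : R * α * min z σ ≤ R * α * z :=
      mul_le_mul_of_nonneg_left hz' (mul_nonneg (by linarith) hα.1.le)
    have h2 : R * (1 - α) * min z σ ≤ R ^ 2 * (1 - α ^ 2) * σ := by
      have h3 : R * (1 - α) ≤ R ^ 2 * (1 - α ^ 2) := by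
        have h4 : R * (1 - α) ≤ R * (R * (1 - α)) :=
          mul_le_mul_of_nonneg_left (by nlinarith [hα.2]) (by linarith)
        have h5 : R ^ 2 * (1 - α) ≤ R ^ 2 * (1 - α ^ 2) :=
          mul_le_mul_of_nonneg_left (by nlinarith [hα.1, hα.2]) (sq_nonneg R)
        nlinarith
      have h6 : 0 ≤ R * (1 - α) := mul_nonneg (by linarith) (by linarith [hα.2])
      calc R * (1 - α) * min z σ ≤ R * (1 - α) * σ := mul_le_mul_of_nonneg_left hσ' h6
        _ ≤ _ := mul_le_mul_of_nonneg_right h3 hσ.le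
    nlinarith

/-- Rotating the two rays onto the positive and negative half-lines, with γ's orientation,
reassembles the integral over the real line. -/
lemma gammaIntegral_kernel {z σ : ℝ} (hz : 0 < z) (hσ : 0 < σ) :
    gammaIntegral (kernel z σ) = 2 * Real.pi * heatKernel σ z := by
  have hi := integrable_kernel_ofReal z hσ
  rw [gammaIntegral, isRay_right.integral_kernel hz hσ, isRay_left.integral_kernel hz hσ,
    ← integral_kernel z hσ, ← intervalIntegral.integral_Iic_add_Ioi (b := 0) hi.integrableOn
      hi.integrableOn]
  have h := integral_comp_neg_Ioi 0 (fun lam : ℝ => kernel z σ lam)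
  rw [neg_zero] at h
  rw [← h]
  have e1 : ∀ s : ℝ, kernel z σ (s * ((1 + Complex.I).re : ℂ)) * ((1 + Complex.I).re : ℂ) =
      kernel z σ s := by intro s; simp
  have e2 : ∀ s : ℝ, kernel z σ (s * ((-1 + Complex.I).re : ℂ)) * ((-1 + Complex.I).re : ℂ) =
      -kernel z σ (-s : ℝ) := by intro s; simp
  simp_rw [e1, e2]
  rw [integral_neg]
  ring

/-- The λ-derivative of the kernel is (iz - 2λσ) times the kernel; along a ray from 0 to ∞ it
integrates to minus the value 1 at the origin. -/
lemma IsRay.integral_deriv_kernel {w : ℂ} (hw : IsRay w) {z : ℝ} (hz : 0 < z) (σ : ℝ) :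
    Complex.I * z * (∫ s in Ioi (0 : ℝ), kernel z σ (s * w) * w) -
      2 * σ * ∫ s in Ioi (0 : ℝ), s * w * kernel z σ (s * w) * w = -1 := by
  have i1 : IntegrableOn (fun s : ℝ => kernel z σ (s * w) * w) (Ioi 0) :=
    (hw.integrableOn_kernel hz σ).mul_const w
  have i2 : IntegrableOn (fun s : ℝ => s * w * kernel z σ (s * w) * w) (Ioi 0) :=
    (hw.integrableOn_mul_kernel hz σ).mul_const w
  rw [← integral_const_mul, ← integral_const_mul,
    ← integral_sub (i1.const_mul (Complex.I * z)) (i2.const_mul (2 * σ : ℂ))]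
  refine (integral_Ioi_of_hasDerivAt_of_tendsto' (f := fun s : ℝ => kernel z σ (s * w)) (m := 0)
    (fun s _ => ?_) ((i1.const_mul _).sub (i2.const_mul _)) ?_).trans (by simp [kernel])
  · have h1 : HasDerivAt (fun s : ℝ => (s * w : ℂ)) w s := by
      simpa using (Complex.ofRealCLM.hasDerivAt (x := s)).mul_const w
    refine ((hasDerivAt_kernel z σ (s * w)).comp s h1).congr_deriv ?_
    simp only [Pi.sub_apply]
    ring
  · rw [tendsto_zero_iff_norm_tendsto_zero]
    simp_rw [hw.norm_kernel]
    exact Real.tendsto_exp_atBot.comp (tendsto_id.const_mul_atTop_of_neg (neg_lt_zero.2 hz))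

/-- Along γ the endpoint contributions of the two rays cancel, so 2σ∫λk = iz∫k for the kernel k. The
factor 2iλ may thus be replaced by -z/σ, which turns the heat kernel into the Poisson kernel. -/
lemma gammaIntegral_mul_kernel {z σ : ℝ} (hz : 0 < z) (hσ : 0 < σ) :
    gammaIntegral (fun lam => 2 * Complex.I * lam * kernel z σ lam) =
      -(2 * Real.pi * poissonKernel z σ) := by
  have h1 := isRay_right.integral_deriv_kernel hz σ
  have h2 := isRay_left.integral_deriv_kernel hz σ
  have h3 := gammaIntegral_kernel hz hσ
  have e : ∀ w : ℂ, ∫ s in Ioi (0 : ℝ), 2 * Complex.I * (s * w) * kernel z σ (s * w) * w =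
      2 * Complex.I * ∫ s in Ioi (0 : ℝ), s * w * kernel z σ (s * w) * w := by
    intro w
    rw [← integral_const_mul]
    congr 1; funext s; ring
  rw [gammaIntegral] at h3 ⊢
  have hσ' : (σ : ℂ) ≠ 0 := Complex.ofReal_ne_zero.2 hσ.ne'
  rw [e, e, poissonKernel_eq]
  generalize (∫ s in Ioi (0 : ℝ), kernel z σ (s * (1 + Complex.I)) * (1 + Complex.I)) = A at *
  generalize (∫ s in Ioi (0 : ℝ), kernel z σ (s * (-1 + Complex.I)) * (-1 + Complex.I)) = A' at *
  generalize (∫ s in Ioi (0 : ℝ), s * (1 + Complex.I) * kernel z σ (s * (1 + Complex.I)) *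
    (1 + Complex.I)) = B at *
  generalize (∫ s in Ioi (0 : ℝ), s * (-1 + Complex.I) * kernel z σ (s * (-1 + Complex.I)) *
    (-1 + Complex.I)) = B' at *
  push_cast
  refine mul_left_cancel₀ hσ' ?_
  have h4 : (σ : ℂ) * (z / σ) = z := by field_simp
  linear_combination (-Complex.I) * h1 + Complex.I * h2 - z * h3 + z * (A - A') * Complex.I_sq +
    2 * Real.pi * heatKernel σ z * h4

/-! ### Interchanging the contour integrals with superpositions of kernels. -/

section Fubini

variable {Ω : Type*} [MeasurableSpace Ω] {μ : Measure Ω} [SFinite μ] {z σ : Ω → ℝ} {m : Ω → ℂ}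

/-- Superpositions of the exponentials `e^{iλz - λ²σ}`, integrated over the real line. -/
lemma integral_integral_kernel (hz : Measurable z) (hσ : Measurable σ)
    (hm : AEStronglyMeasurable m μ) (hpos : ∀ᵐ q ∂μ, 0 < σ q)
    (hint : Integrable (fun q => (√(σ q))⁻¹ * ‖m q‖) μ) :
    Integrable (fun lam : ℝ => ∫ q, kernel (z q) (σ q) lam * m q ∂μ) ∧
      ∫ lam : ℝ, ∫ q, kernel (z q) (σ q) lam * m q ∂μ =
        ∫ q, 2 * Real.pi * heatKernel (σ q) (z q) * m q ∂μ := by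
  have h : Integrable (Function.uncurry fun (q : Ω) (lam : ℝ) => kernel (z q) (σ q) lam * m q)
      (μ.prod volume) := by
    have hmeas : AEStronglyMeasurable
        (Function.uncurry fun (q : Ω) (lam : ℝ) => kernel (z q) (σ q) lam * m q)
        (μ.prod volume) := by
      refine AEStronglyMeasurable.mul ?_ hm.comp_fst
      refine Measurable.aestronglyMeasurable ?_
      unfold kernel
      fun_prop
    refine (integrable_prod_iff hmeas).2 ⟨?_, ?_⟩
    · filter_upwards [hpos] with q hq
      exact (integrable_kernel_ofReal (z q) hq).mul_const (m q)
    -- The modulus is a Gaussian in λ with integral √(π/σ), whence the weight in `hint`.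
    · refine (hint.const_mul (√Real.pi)).congr ?_
      filter_upwards [hpos] with q hq
      simp only [Function.uncurry, norm_mul, norm_kernel_ofReal]
      rw [integral_mul_const, integral_gaussian, Real.sqrt_div' _ hq.le]
      ring
  refine ⟨h.integral_prod_right, ?_⟩
  rw [← integral_integral_swap h]
  refine integral_congr_ae ?_
  filter_upwards [hpos] with q hq
  rw [integral_mul_const, integral_kernel _ hq]

/-- For z ≥ x > 0 the kernel is at most e^{-xs} whatever σ is, so a product majorant works without
any weight singular in σ. The polynomial P leaves room for the factor 2iλ of the boundary term. -/
lemma IsRay.integral_integral_kernel {w : ℂ} (hw : IsRay w) {x : ℝ} (hz : Measurable z)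
    (hσ : Measurable σ) (hm : Integrable m μ) (hzx : ∀ᵐ q ∂μ, x ≤ z q) {P : ℂ → ℂ}
    (hP : Continuous P)
    (hPi : IntegrableOn (fun s : ℝ => ‖P (s * w)‖ * Real.exp (-x * s)) (Ioi 0)) :
    IntegrableOn (fun s : ℝ => ∫ q, P (s * w) * kernel (z q) (σ q) (s * w) * m q ∂μ) (Ioi 0) ∧
      Integrable (fun q => (∫ s in Ioi (0 : ℝ), P (s * w) * kernel (z q) (σ q) (s * w) * w) * m q)
        μ ∧
      ∫ s in Ioi (0 : ℝ), (∫ q, P (s * w) * kernel (z q) (σ q) (s * w) * m q ∂μ) * w =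
        ∫ q, (∫ s in Ioi (0 : ℝ), P (s * w) * kernel (z q) (σ q) (s * w) * w) * m q ∂μ := by
  have h : Integrable (Function.uncurry fun (q : Ω) (s : ℝ) =>
      P (s * w) * kernel (z q) (σ q) (s * w) * m q) (μ.prod (volume.restrict (Ioi 0))) := by
    refine Integrable.mono' (hm.norm.mul_prod hPi) ?_ ?_
    · refine AEStronglyMeasurable.mul ?_ hm.aestronglyMeasurable.comp_fst
      refine Measurable.aestronglyMeasurable ?_
      have := hP.measurable
      unfold kernel
      fun_prop
    · have h1 := (Measure.quasiMeasurePreserving_fst (μ := μ) (ν := volume.restrict (Ioi (0 : ℝ)))).ae hzx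
      have h2 := (Measure.quasiMeasurePreserving_snd (μ := μ) (ν := volume.restrict (Ioi (0 : ℝ)))).ae
        (ae_restrict_mem (μ := (volume : Measure ℝ)) measurableSet_Ioi)
      filter_upwards [h1, h2] with p hp1 hp2
      simp only [Function.uncurry, norm_mul, hw.norm_kernel]
      rw [mul_comm]
      have hs : (0 : ℝ) < p.2 := hp2
      gcongr
  have e : ∀ q, (∫ s in Ioi (0 : ℝ), P (s * w) * kernel (z q) (σ q) (s * w) * w) * m q =
      (∫ s in Ioi (0 : ℝ), P (s * w) * kernel (z q) (σ q) (s * w) * m q) * w := by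
    intro q
    rw [integral_mul_const, integral_mul_const]
    ring
  refine ⟨h.integral_prod_right, ?_, ?_⟩
  · simp_rw [e]
    exact h.integral_prod_left.mul_const w
  · simp_rw [e]
    rw [integral_mul_const, integral_mul_const, integral_integral_swap h]

/-- Superpositions of the exponentials `e^{iλz - λ²σ}`, integrated along `γ`. -/
lemma gammaIntegral_integral_kernel {x : ℝ} (hz : Measurable z)
    (hσ : Measurable σ) (hm : Integrable m μ) (hzx : ∀ᵐ q ∂μ, x ≤ z q) {P : ℂ → ℂ}
    (hP : Continuous P)
    (hPi : ∀ w, IsRay w → IntegrableOn (fun s : ℝ => ‖P (s * w)‖ * Real.exp (-x * s)) (Ioi 0)) :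
    GammaIntegrable (fun lam => ∫ q, P lam * kernel (z q) (σ q) lam * m q ∂μ) ∧
      gammaIntegral (fun lam => ∫ q, P lam * kernel (z q) (σ q) lam * m q ∂μ) =
        ∫ q, gammaIntegral (fun lam => P lam * kernel (z q) (σ q) lam) * m q ∂μ := by
  have h1 := isRay_right.integral_integral_kernel hz hσ hm hzx hP (hPi _ isRay_right)
  have h2 := isRay_left.integral_integral_kernel hz hσ hm hzx hP (hPi _ isRay_left)
  refine ⟨⟨h1.1, h2.1⟩, ?_⟩
  simp only [gammaIntegral, sub_mul]
  rw [h1.2.2, h2.2.2, integral_sub h1.2.1 h2.2.1]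

end Fubini

lemma integrableOn_exp_ray {x : ℝ} (hx : 0 < x) (w : ℂ) :
    IntegrableOn (fun s : ℝ => ‖(fun _ => 1 : ℂ → ℂ) (s * w)‖ * Real.exp (-x * s)) (Ioi 0) := by
  simpa using integrableOn_exp_mul_Ioi (neg_lt_zero.2 hx) 0

lemma integrableOn_mul_exp_ray {x : ℝ} (hx : 0 < x) {w : ℂ} (hw : IsRay w) :
    IntegrableOn (fun s : ℝ => ‖(fun lam => 2 * Complex.I * lam : ℂ → ℂ) (s * w)‖ *
      Real.exp (-x * s)) (Ioi 0) := by
  refine ((hw.integrableOn_mul_kernel hx 0).norm.const_mul 2).congr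
    (Eventually.of_forall fun s => ?_)
  simp [hw.norm_kernel]
  ring

/-! ### The five integrals as heat and Poisson potentials. -/

lemma kernel_mul_exp (x y t : ℝ) (lam : ℂ) :
    kernel x t lam * Complex.exp (-(Complex.I * lam * y)) = kernel (x - y) t lam := by
  rw [kernel, kernel, ← Complex.exp_add]
  congr 1; push_cast; ring

lemma kernel_mul_exp_neg (x y t : ℝ) (lam : ℂ) :
    kernel x t lam * Complex.exp (-(Complex.I * -lam * y)) = kernel (x + y) t lam := by
  rw [kernel, kernel, ← Complex.exp_add]
  congr 1; push_cast; ring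

lemma kernel_mul_exp_sq (x t τ : ℝ) (lam : ℂ) :
    kernel x t lam * Complex.exp (lam ^ 2 * τ) = kernel x (t - τ) lam := by
  rw [kernel, kernel, ← Complex.exp_add]
  congr 1; push_cast; ring

lemma kernel_mul_hat (u : ℝ → ℂ) (x t : ℝ) (lam : ℂ) :
    kernel x t lam * hat u lam = ∫ y in Ioi (0 : ℝ), kernel (x - y) t lam * u y := by
  rw [hat, ← integral_const_mul]
  simp_rw [← mul_assoc, kernel_mul_exp]

lemma kernel_mul_hat_neg (u : ℝ → ℂ) (x t : ℝ) (lam : ℂ) :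
    kernel x t lam * hat u (-lam) = ∫ y in Ioi (0 : ℝ), kernel (x + y) t lam * u y := by
  rw [hat, ← integral_const_mul]
  simp_rw [← mul_assoc, kernel_mul_exp_neg]

lemma kernel_mul_gTilde (g : ℝ → ℂ) (x : ℝ) {t : ℝ} (ht : 0 ≤ t) (lam : ℂ) :
    kernel x t lam * (2 * Complex.I * lam * gTilde g lam t) =
      ∫ τ in Ioc 0 t, 2 * Complex.I * lam * kernel x (t - τ) lam * g τ := by
  rw [gTilde, intervalIntegral.integral_of_le ht, ← integral_const_mul, ← integral_const_mul]
  congr 1; funext τ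
  rw [← kernel_mul_exp_sq]; ring

/-- The space-time domain of the forcing up to time `t`, time first. -/
def forcingMeasure (t : ℝ) : Measure (ℝ × ℝ) :=
  (volume.restrict (Ioc 0 t)).prod (volume.restrict (Ioi 0))

instance (t : ℝ) : SFinite (forcingMeasure t) := by unfold forcingMeasure; infer_instance

lemma kernel_mul_fTilde {f : ℝ × ℝ → ℂ} {x t : ℝ} (ht : 0 ≤ t) {lam : ℂ}
    (hi : Integrable (fun q : ℝ × ℝ => kernel (x - q.2) (t - q.1) lam * f (q.2, q.1))
      (forcingMeasure t)) :
    kernel x t lam * fTilde f lam t =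
      ∫ q, kernel (x - q.2) (t - q.1) lam * f (q.2, q.1) ∂forcingMeasure t := by
  unfold forcingMeasure at hi ⊢
  rw [integral_prod _ hi, fTilde, intervalIntegral.integral_of_le ht, ← integral_const_mul]
  congr 1; funext τ
  rw [← mul_assoc, kernel_mul_exp_sq, kernel_mul_hat]

lemma kernel_mul_fTilde_neg {f : ℝ × ℝ → ℂ} {x t : ℝ} (ht : 0 ≤ t) {lam : ℂ}
    (hi : Integrable (fun q : ℝ × ℝ => kernel (x + q.2) (t - q.1) lam * f (q.2, q.1))
      (forcingMeasure t)) :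
    kernel x t lam * fTilde f (-lam) t =
      ∫ q, kernel (x + q.2) (t - q.1) lam * f (q.2, q.1) ∂forcingMeasure t := by
  unfold forcingMeasure at hi ⊢
  rw [integral_prod _ hi, fTilde, intervalIntegral.integral_of_le ht, ← integral_const_mul]
  congr 1; funext τ
  rw [← mul_assoc, neg_sq, kernel_mul_exp_sq, kernel_mul_hat_neg]

/-- The method of images: substitute y = x + √σ z and fold the negative half-line onto the positive
one. The two terms match the real-line integral and the γ-integral of the formula. -/
lemma gaussAvg_reflect_eq {φ : ℝ × ℝ → ℂ} {s : ℝ} (hs : 0 ≤ s)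
    (hi : Integrable fun y => reflect (-1) φ (y, s)) (x : ℝ) {σ : ℝ} (hσ : 0 < σ) :
    gaussAvg (reflect (-1) φ) x (√σ) s =
      (∫ y in Ioi (0 : ℝ), (heatKernel σ (x - y) : ℂ) * φ (y, s)) -
        ∫ y in Ioi (0 : ℝ), (heatKernel σ (x + y) : ℂ) * φ (y, s) := by
  have hs0 : 0 < √σ := Real.sqrt_pos.2 hσ
  set G : ℝ → ℂ := fun y => (heatKernel σ (x - y) : ℂ) * reflect (-1) φ (y, s) with hG
  have hGi : Integrable G := by
    refine hi.bdd_mul (c := (√σ)⁻¹ * (√(4 * Real.pi))⁻¹) ?_ (Eventually.of_forall fun y => ?_)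
    · refine Measurable.aestronglyMeasurable ?_
      exact Complex.measurable_ofReal.comp
        (measurable_heatKernel.comp (by fun_prop : Measurable fun y : ℝ => (σ, x - y)))
    · rw [Complex.norm_of_nonneg (heatKernel_nonneg _ _)]
      exact heatKernel_le _ _
  have h1 : gaussAvg (reflect (-1) φ) x (√σ) s = ∫ y, G y := by
    have e : ∀ z : ℝ, (gaussDensity z : ℂ) * reflect (-1) φ (x + √σ * z, s) =
        √σ * (fun y => G (x + y)) (√σ * z) := by
      intro z
      have : heatKernel σ (x - (x + √σ * z)) = (√σ)⁻¹ * gaussDensity z := by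
        rw [show x - (x + √σ * z) = -(√σ * z) by ring, heatKernel_neg, heatKernel,
          mul_div_cancel_left₀ _ hs0.ne']
      simp only [hG, this]
      push_cast
      rw [← mul_assoc, mul_inv_cancel_left₀ (Complex.ofReal_ne_zero.2 hs0.ne')]
    simp only [gaussAvg, e]
    rw [integral_const_mul, Measure.integral_comp_mul_left (fun y => G (x + y)),
      integral_add_left_eq_self G x, abs_of_pos (inv_pos.2 hs0), Complex.real_smul,
      Complex.ofReal_inv, mul_inv_cancel_left₀ (Complex.ofReal_ne_zero.2 hs0.ne')]
  rw [h1, ← intervalIntegral.integral_Iic_add_Ioi (b := 0) hGi.integrableOn hGi.integrableOn]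
  have h2 := integral_comp_neg_Ioi 0 G
  rw [neg_zero] at h2
  have e1 : ∀ y ∈ Ioi (0 : ℝ), G (-y) = -((heatKernel σ (x + y) : ℂ) * φ (y, s)) := by
    intro y hy
    have : ¬ (0 : ℝ) ≤ -y := by simpa using hy
    simp [hG, reflect, this, max_eq_left hs]
  have e2 : ∀ y ∈ Ioi (0 : ℝ), G y = (heatKernel σ (x - y) : ℂ) * φ (y, s) := by
    intro y hy
    simp only [hG, reflect_of_nonneg (mem_Ioi.1 hy).le hs]
  rw [← h2, setIntegral_congr_fun measurableSet_Ioi e1, setIntegral_congr_fun measurableSet_Ioi e2,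
    integral_neg]
  ring

lemma xDeriv_zero (f : ℝ × ℝ → ℂ) : xDeriv f 0 = f := by
  funext p; simp [xDeriv]

section Forcing

variable {f : ℝ × ℝ → ℂ}

lemma IsAdmissibleForcing.tame (hf : IsAdmissibleForcing f) : Tame (reflect (-1) f) := by
  simpa only [xDeriv_zero] using hf.decayChain.tame (ε := -1) (by simp) 0

lemma IsAdmissibleForcing.decay (hf : IsAdmissibleForcing f) (T : ℝ) :
    ∃ C : ℝ, ∀ x s, s ≤ T → ‖reflect (-1) f (x, s)‖ ≤ C / (1 + x ^ 2) :=
  reflect_decay (by simp) (by simpa only [xDeriv_zero] using hf.decayChain.decay 0) T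

lemma IsAdmissibleForcing.integrable_reflect (hf : IsAdmissibleForcing f) (s : ℝ) :
    Integrable fun y => reflect (-1) f (y, s) := by
  obtain ⟨C, hC⟩ := hf.decay s
  refine (integrable_inv_one_add_sq.const_mul C).mono'
    (hf.tame.measurable.comp (by fun_prop)).aestronglyMeasurable
    (Eventually.of_forall fun y => ?_)
  rw [← div_eq_mul_inv]
  exact hC y s le_rfl

lemma IsAdmissibleForcing.integrableOn (hf : IsAdmissibleForcing f) {s : ℝ} (hs : 0 ≤ s) :
    IntegrableOn (fun y => f (y, s)) (Ioi 0) :=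
  (hf.integrable_reflect s).integrableOn.congr_fun
    (fun _ hy => reflect_of_nonneg (mem_Ioi.1 hy).le hs) measurableSet_Ioi

lemma ae_forcingMeasure (t : ℝ) : ∀ᵐ q ∂forcingMeasure t, q.1 ∈ Ioo 0 t ∧ q.2 ∈ Ioi (0 : ℝ) := by
  rw [forcingMeasure, ← Measure.restrict_congr_set Ioo_ae_eq_Ioc, Measure.prod_restrict]
  exact ae_restrict_mem (measurableSet_Ioo.prod measurableSet_Ioi)

lemma IsAdmissibleForcing.aestronglyMeasurable (hf : IsAdmissibleForcing f) (t : ℝ) :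
    AEStronglyMeasurable (fun q : ℝ × ℝ => f (q.2, q.1)) (forcingMeasure t) := by
  have h : Measurable fun q : ℝ × ℝ => reflect (-1) f (q.2, q.1) :=
    hf.tame.measurable.comp (by fun_prop)
  refine h.aestronglyMeasurable.congr ?_
  filter_upwards [ae_forcingMeasure t] with q hq
  exact reflect_of_nonneg (mem_Ioi.1 hq.2).le hq.1.1.le

/-- The decay of f gives a majorant that is a product of b(τ) and C/(1 + y²). The weight needed
later is (t - τ)^{-1/2}, the size of the heat kernel, which is integrable up to τ = t. -/
lemma IsAdmissibleForcing.integrable_weight (hf : IsAdmissibleForcing f) (t : ℝ) {b : ℝ → ℝ}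
    (hb : IntegrableOn b (Ioc 0 t)) (hb0 : ∀ τ, 0 ≤ b τ) :
    Integrable (fun q : ℝ × ℝ => b q.1 * ‖f (q.2, q.1)‖) (forcingMeasure t) := by
  obtain ⟨C, hC⟩ := hf.decay t
  have h2 : IntegrableOn (fun y : ℝ => C * (1 + y ^ 2)⁻¹) (Ioi 0) :=
    (integrable_inv_one_add_sq.const_mul C).integrableOn
  have hb' : AEStronglyMeasurable (fun q : ℝ × ℝ => b q.1) (forcingMeasure t) :=
    hb.aestronglyMeasurable.comp_fst
  refine Integrable.mono' (Integrable.mul_prod hb h2) (hb'.mul (hf.aestronglyMeasurable t).norm) ?_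
  filter_upwards [ae_forcingMeasure t] with q hq
  rw [norm_mul, norm_norm, Real.norm_of_nonneg (hb0 _), ← div_eq_mul_inv]
  refine mul_le_mul_of_nonneg_left ?_ (hb0 _)
  rw [← reflect_of_nonneg (ε := -1) (φ := f) (mem_Ioi.1 hq.2).le hq.1.1.le]
  exact hC _ _ hq.1.2.le

lemma IsAdmissibleForcing.integrable (hf : IsAdmissibleForcing f) (t : ℝ) :
    Integrable (fun q : ℝ × ℝ => f (q.2, q.1)) (forcingMeasure t) := by
  rw [← integrable_norm_iff (hf.aestronglyMeasurable t)]
  simpa using hf.integrable_weight t (b := fun _ => 1) (by simp [IntegrableOn]) (by simp)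

lemma integrableOn_inv_sqrt_sub {t : ℝ} (ht : 0 ≤ t) :
    IntegrableOn (fun τ => (√(t - τ))⁻¹) (Ioc 0 t) := by
  have h : IntervalIntegrable (fun x : ℝ => x ^ (-(1 / 2) : ℝ)) volume 0 t :=
    intervalIntegral.intervalIntegrable_rpow' (by norm_num)
  have h1 := (h.comp_sub_left t).symm
  rw [sub_self, sub_zero, intervalIntegrable_iff_integrableOn_Ioc_of_le ht] at h1
  refine h1.congr_fun (fun τ hτ => ?_) measurableSet_Ioc
  simp only
  rw [Real.rpow_neg (sub_nonneg.2 hτ.2), Real.sqrt_eq_rpow]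

lemma IsAdmissibleForcing.integrable_kernel_mul (hf : IsAdmissibleForcing f) (t : ℝ) {z : ℝ × ℝ → ℝ}
    (hz : Measurable z) {lam : ℂ}
    (hk : ∀ᵐ q ∂forcingMeasure t, ‖kernel (z q) (t - q.1) lam‖ ≤ 1) :
    Integrable (fun q : ℝ × ℝ => kernel (z q) (t - q.1) lam * f (q.2, q.1)) (forcingMeasure t) := by
  refine (hf.integrable t).bdd_mul (c := 1) ?_ hk
  refine Measurable.aestronglyMeasurable ?_
  unfold kernel
  fun_prop

lemma IsAdmissibleForcing.integrable_heatKernel_mul (hf : IsAdmissibleForcing f) {t : ℝ}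
    (ht : 0 ≤ t) {z : ℝ × ℝ → ℝ} (hz : Measurable z) :
    Integrable (fun q : ℝ × ℝ => (heatKernel (t - q.1) (z q) : ℂ) * f (q.2, q.1))
      (forcingMeasure t) := by
  refine Integrable.mono' (hf.integrable_weight t
    ((integrableOn_inv_sqrt_sub ht).mul_const (√(4 * Real.pi))⁻¹) fun τ => by positivity)
    (AEStronglyMeasurable.mul ?_ (hf.aestronglyMeasurable t)) (Eventually.of_forall fun q => ?_)
  · refine Measurable.aestronglyMeasurable ?_
    exact Complex.measurable_ofReal.comp
      (measurable_heatKernel.comp (by fun_prop : Measurable fun q => (t - q.1, z q)))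
  · rw [norm_mul, Complex.norm_of_nonneg (heatKernel_nonneg _ _)]
    exact mul_le_mul_of_nonneg_right (heatKernel_le _ _) (norm_nonneg _)

lemma IsRay.norm_kernel_le_one {w : ℂ} (hw : IsRay w) {x s : ℝ} (hx : 0 ≤ x) (hs : 0 ≤ s) (t : ℝ) :
    ‖kernel x t (s * w)‖ ≤ 1 := by
  rw [hw.norm_kernel]
  exact Real.exp_le_one_iff.2 (by nlinarith)

lemma gammaIntegral_congr {F G : ℂ → ℂ} (h : ∀ w, IsRay w → ∀ s : ℝ, 0 < s → F (s * w) = G (s * w)) :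
    gammaIntegral F = gammaIntegral G := by
  unfold gammaIntegral
  congr 1
  · refine setIntegral_congr_fun measurableSet_Ioi fun s hs => ?_
    simp only [h _ isRay_right s (mem_Ioi.1 hs)]
  · refine setIntegral_congr_fun measurableSet_Ioi fun s hs => ?_
    simp only [h _ isRay_left s (mem_Ioi.1 hs)]

lemma GammaIntegrable.congr {F G : ℂ → ℂ} (hF : GammaIntegrable F)
    (h : ∀ w, IsRay w → ∀ s : ℝ, 0 < s → F (s * w) = G (s * w)) : GammaIntegrable G :=
  ⟨hF.1.congr_fun (fun s hs => h _ isRay_right s (mem_Ioi.1 hs)) measurableSet_Ioi,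
    hF.2.congr_fun (fun s hs => h _ isRay_left s (mem_Ioi.1 hs)) measurableSet_Ioi⟩

lemma forcing_line (hf : IsAdmissibleForcing f) (x : ℝ) {t : ℝ} (ht : 0 ≤ t) :
    Integrable (fun lam : ℝ => kernel x t lam * fTilde f lam t) ∧
      ∫ lam : ℝ, kernel x t lam * fTilde f lam t = 2 * Real.pi *
        ∫ τ in Ioc 0 t, ∫ y in Ioi (0 : ℝ), (heatKernel (t - τ) (x - y) : ℂ) * f (y, τ) := by
  have e : ∀ lam : ℝ, kernel x t lam * fTilde f lam t =
      ∫ q, kernel (x - q.2) (t - q.1) lam * f (q.2, q.1) ∂forcingMeasure t := fun lam =>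
    kernel_mul_fTilde ht (hf.integrable_kernel_mul t (by fun_prop) (by
      filter_upwards [ae_forcingMeasure t] with q hq
      rw [norm_kernel_ofReal]
      exact Real.exp_le_one_iff.2 (by nlinarith [hq.1.2, sq_nonneg lam])))
  simp_rw [e]
  have h := integral_integral_kernel (μ := forcingMeasure t) (z := fun q => x - q.2)
    (σ := fun q => t - q.1) (m := fun q => f (q.2, q.1)) (by fun_prop) (by fun_prop)
    (hf.aestronglyMeasurable t)
    (by filter_upwards [ae_forcingMeasure t] with q hq using sub_pos.2 hq.1.2)
    (hf.integrable_weight t (integrableOn_inv_sqrt_sub ht) fun τ => by positivity)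
  refine ⟨h.1, h.2.trans ?_⟩
  have hi := hf.integrable_heatKernel_mul ht (z := fun q => x - q.2) (by fun_prop)
  simp_rw [mul_assoc (2 * (Real.pi : ℂ))]
  rw [integral_const_mul]
  unfold forcingMeasure at hi ⊢
  rw [integral_prod _ hi]

lemma forcing_gamma (hf : IsAdmissibleForcing f) {x t : ℝ} (hx : 0 < x) (ht : 0 ≤ t) :
    GammaIntegrable (fun lam => kernel x t lam * fTilde f (-lam) t) ∧
      gammaIntegral (fun lam => kernel x t lam * fTilde f (-lam) t) = 2 * Real.pi *
        ∫ τ in Ioc 0 t, ∫ y in Ioi (0 : ℝ), (heatKernel (t - τ) (x + y) : ℂ) * f (y, τ) := by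
  have e : ∀ w, IsRay w → ∀ s : ℝ, 0 < s →
      (∫ q, (1 : ℂ) * kernel (x + q.2) (t - q.1) (s * w) * f (q.2, q.1) ∂forcingMeasure t) =
      kernel x t (s * w) * fTilde f (-(s * w)) t := fun w hw s hs => by
    simp_rw [one_mul]
    refine (kernel_mul_fTilde_neg ht (hf.integrable_kernel_mul t (by fun_prop) ?_)).symm
    filter_upwards [ae_forcingMeasure t] with q hq
    exact hw.norm_kernel_le_one (add_nonneg hx.le (mem_Ioi.1 hq.2).le) hs.le _
  have h := gammaIntegral_integral_kernel (μ := forcingMeasure t) (x := x) (z := fun q => x + q.2)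
    (σ := fun q => t - q.1) (m := fun q => f (q.2, q.1)) (P := fun _ => 1) (by fun_prop)
    (by fun_prop) (hf.integrable t)
    (by filter_upwards [ae_forcingMeasure t] with q hq using by linarith [mem_Ioi.1 hq.2])
    continuous_const (fun w _ => integrableOn_exp_ray hx w)
  refine ⟨h.1.congr e, (gammaIntegral_congr e).symm.trans (h.2.trans ?_)⟩
  have hi := hf.integrable_heatKernel_mul ht (z := fun q => x + q.2) (by fun_prop)
  have e2 : ∫ q, gammaIntegral (fun lam => 1 * kernel (x + q.2) (t - q.1) lam) * f (q.2, q.1)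
      ∂forcingMeasure t = ∫ q, 2 * Real.pi * ((heatKernel (t - q.1) (x + q.2) : ℂ) * f (q.2, q.1))
      ∂forcingMeasure t := by
    refine integral_congr_ae ?_
    filter_upwards [ae_forcingMeasure t] with q hq
    simp_rw [one_mul]
    rw [show (fun lam => kernel (x + q.2) (t - q.1) lam) = kernel (x + q.2) (t - q.1) from rfl,
      gammaIntegral_kernel (by linarith [mem_Ioi.1 hq.2]) (sub_pos.2 hq.1.2), mul_assoc]
  rw [e2, integral_const_mul]
  unfold forcingMeasure at hi ⊢
  rw [integral_prod _ hi]

lemma IsAdmissibleForcing.duhamel_eq (hf : IsAdmissibleForcing f) (x : ℝ) {t : ℝ} (ht : 0 ≤ t) :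
    duhamel (reflect (-1) f) x t =
      (∫ τ in Ioc 0 t, ∫ y in Ioi (0 : ℝ), (heatKernel (t - τ) (x - y) : ℂ) * f (y, τ)) -
        ∫ τ in Ioc 0 t, ∫ y in Ioi (0 : ℝ), (heatKernel (t - τ) (x + y) : ℂ) * f (y, τ) := by
  have i1 := (hf.integrable_heatKernel_mul ht (z := fun q => x - q.2) (by fun_prop))
  have i2 := (hf.integrable_heatKernel_mul ht (z := fun q => x + q.2) (by fun_prop))
  rw [duhamel, intervalIntegral.integral_of_le ht, ← integral_sub i1.integral_prod_left
    i2.integral_prod_left, integral_Ioc_eq_integral_Ioo, integral_Ioc_eq_integral_Ioo]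
  refine setIntegral_congr_fun measurableSet_Ioo fun τ hτ => ?_
  exact gaussAvg_reflect_eq hτ.1.le (hf.integrable_reflect τ) x (sub_pos.2 hτ.2)

end Forcing

section Data

variable {u₀ : ℝ → ℂ}

lemma initial_line (hu : IsSchwartzHalfLine u₀) (x : ℝ) {t : ℝ} (ht : 0 < t) :
    Integrable (fun lam : ℝ => kernel x t lam * hat u₀ lam) ∧
      ∫ lam : ℝ, kernel x t lam * hat u₀ lam = 2 * Real.pi *
        ∫ y in Ioi (0 : ℝ), (heatKernel t (x - y) : ℂ) * u₀ y := by
  have hi : IntegrableOn u₀ (Ioi 0) := hu.isAdmissibleForcing.integrableOn le_rfl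
  simp_rw [kernel_mul_hat]
  have h := integral_integral_kernel (μ := volume.restrict (Ioi 0)) (z := fun y => x - y)
    (σ := fun _ => t) (m := u₀) (by fun_prop) (by fun_prop) hi.aestronglyMeasurable
    (Eventually.of_forall fun _ => ht) (hi.norm.const_mul _)
  refine ⟨h.1, h.2.trans ?_⟩
  simp_rw [mul_assoc (2 * (Real.pi : ℂ))]
  rw [integral_const_mul]

lemma initial_gamma (hu : IsSchwartzHalfLine u₀) {x t : ℝ} (hx : 0 < x) (ht : 0 < t) :
    GammaIntegrable (fun lam => kernel x t lam * hat u₀ (-lam)) ∧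
      gammaIntegral (fun lam => kernel x t lam * hat u₀ (-lam)) = 2 * Real.pi *
        ∫ y in Ioi (0 : ℝ), (heatKernel t (x + y) : ℂ) * u₀ y := by
  have hi : IntegrableOn u₀ (Ioi 0) := hu.isAdmissibleForcing.integrableOn le_rfl
  simp_rw [kernel_mul_hat_neg]
  have h := gammaIntegral_integral_kernel (μ := volume.restrict (Ioi 0)) (x := x)
    (z := fun y => x + y) (σ := fun _ => t) (m := u₀) (P := fun _ => 1) (by fun_prop)
    (by fun_prop) hi
    (by filter_upwards [ae_restrict_mem measurableSet_Ioi] with y hy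
        linarith [mem_Ioi.1 hy])
    continuous_const (fun w _ => integrableOn_exp_ray hx w)
  simp_rw [one_mul] at h
  refine ⟨h.1, h.2.trans ?_⟩
  rw [← integral_const_mul]
  refine setIntegral_congr_fun measurableSet_Ioi fun y hy => ?_
  rw [show (fun lam => kernel (x + y) t lam) = kernel (x + y) t from rfl,
    gammaIntegral_kernel (by linarith [mem_Ioi.1 hy]) ht, mul_assoc]

lemma boundary_gamma {g₀ : ℝ → ℂ} (hg : ContinuousOn g₀ (Ici 0)) {x t : ℝ} (hx : 0 < x)
    (ht : 0 ≤ t) :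
    GammaIntegrable (fun lam => kernel x t lam * (2 * Complex.I * lam * gTilde g₀ lam t)) ∧
      gammaIntegral (fun lam => kernel x t lam * (2 * Complex.I * lam * gTilde g₀ lam t)) =
        -(2 * Real.pi * ∫ τ in (0 : ℝ)..t, (poissonKernel x (t - τ) : ℂ) * g₀ τ) := by
  have hi : IntegrableOn g₀ (Ioc 0 t) :=
    ((hg.mono Icc_subset_Ici_self).integrableOn_Icc).mono_set Ioc_subset_Icc_self
  simp_rw [kernel_mul_gTilde g₀ x ht]
  have h := gammaIntegral_integral_kernel (μ := volume.restrict (Ioc 0 t)) (x := x)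
    (z := fun _ => x) (σ := fun τ => t - τ) (m := g₀) (P := fun lam => 2 * Complex.I * lam)
    (by fun_prop) (by fun_prop) hi (Eventually.of_forall fun _ => le_rfl)
    (by fun_prop) (fun w hw => integrableOn_mul_exp_ray hx hw)
  refine ⟨h.1, h.2.trans ?_⟩
  rw [intervalIntegral.integral_of_le ht, ← neg_mul, ← integral_const_mul,
    integral_Ioc_eq_integral_Ioo, integral_Ioc_eq_integral_Ioo]
  refine setIntegral_congr_fun measurableSet_Ioo fun τ hτ => ?_
  rw [gammaIntegral_mul_kernel hx (sub_pos.2 hτ.2)]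
  ring

/-- The unified transform formula agrees with the heat kernel representation of the half-line. -/
lemma utm_eq_halfLine {g₀ : ℝ → ℂ} {f : ℝ × ℝ → ℂ} (hu : IsSchwartzHalfLine u₀)
    (hg : ContinuousOn g₀ (Ici 0)) (hf : IsAdmissibleForcing f) {x t : ℝ} (hx : 0 < x)
    (ht : 0 < t) :
    UTMConverges u₀ g₀ f x t ∧ utm u₀ g₀ f x t =
      gaussAvg (reflect (-1) fun p => u₀ p.1) x (√t) 0 +
        (∫ τ in (0 : ℝ)..t, (poissonKernel x (t - τ) : ℂ) * g₀ τ) +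
        duhamel (reflect (-1) f) x t := by
  have h1 := initial_line hu x ht
  have h2 := initial_gamma hu hx ht
  have h3 := boundary_gamma hg hx ht.le
  have h4 := forcing_line hf x ht.le
  have h5 := forcing_gamma hf hx ht.le
  refine ⟨⟨h1.1, h2.1, h3.1, h4.1, h5.1⟩, ?_⟩
  rw [utm, h1.2, h2.2, h3.2, h4.2, h5.2, hf.duhamel_eq x ht.le,
    gaussAvg_reflect_eq le_rfl (hu.isAdmissibleForcing.integrable_reflect 0) x ht]
  have hpi : (Real.pi : ℂ) ≠ 0 := Complex.ofReal_ne_zero.2 Real.pi_ne_zero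
  rw [one_div, inv_mul_eq_iff_eq_mul₀ (mul_ne_zero two_ne_zero hpi)]
  ring

end Data

/-! ### The energy method. -/

section Energy

variable {D : ℝ × ℝ → ℂ}

lemma contDiffAt_of_contDiffOn (hC : ContDiffOn ℝ 2 D QbarPunctured) {x t : ℝ} (hx : 0 < x)
    (ht : 0 < t) : ContDiffAt ℝ 2 D (x, t) :=
  hC.contDiffAt (mem_of_superset
    ((isOpen_Ioi.prod isOpen_Ioi).mem_nhds ⟨mem_Ioi.2 hx, mem_Ioi.2 ht⟩) openQuadrant_subset)

lemma contDiffOn_slice_x (hC : ContDiffOn ℝ 2 D QbarPunctured) {t : ℝ} (ht : 0 < t) :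
    ContDiffOn ℝ 2 (fun y => D (y, t)) (Ici 0) :=
  hC.comp (contDiff_prodMk_left t).contDiffOn fun _ hy =>
    mem_QbarPunctured.2 ⟨hy, ht.le, Or.inr ht.ne'⟩

lemma hasDerivAt_slice_t (hC : ContDiffOn ℝ 2 D QbarPunctured) {x t : ℝ} (hx : 0 < x)
    (ht : 0 < t) : HasDerivAt (fun s => D (x, s)) (deriv (fun s => D (x, s)) t) t :=
  (((contDiffAt_of_contDiffOn hC hx ht).differentiableAt (by simp)).comp t
    (by fun_prop : DifferentiableAt ℝ (fun s : ℝ => (x, s)) t)).hasDerivAt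

/-- One-sided derivatives within [0, ∞) are continuous up to x = 0, which the integration by parts
on [0, R] needs; in the interior they agree with the two-sided ones. -/
lemma iteratedDeriv_two_slice (hC : ContDiffOn ℝ 2 D QbarPunctured) {x t : ℝ} (hx : 0 < x)
    (ht : 0 < t) : iteratedDeriv 2 (fun y => D (y, t)) x =
      derivWithin (derivWithin (fun y => D (y, t)) (Ici 0)) (Ici 0) x := by
  have h0 := contDiffOn_slice_x hC ht
  have h1 := h0.derivWithin (uniqueDiffOn_Ici 0) (m := 1) (by norm_num)
  rw [iteratedDeriv_succ, iteratedDeriv_one]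
  have h2 := (h1.differentiableOn (by simp) x hx.le).hasDerivWithinAt.hasDerivAt (Ici_mem_nhds hx)
  refine (h2.congr_of_eventuallyEq ?_).deriv
  filter_upwards [Ioi_mem_nhds hx] with y hy
  exact ((h0.differentiableOn (by simp) y (mem_Ioi.1 hy).le).hasDerivWithinAt.hasDerivAt
    (Ici_mem_nhds hy)).deriv

/-- The dissipation of the energy, for one time. -/
lemma integral_inner_nonpos (hC : ContDiffOn ℝ 2 D QbarPunctured) {t : ℝ} (ht : 0 < t)
    (hpde : ∀ x, 0 < x → deriv (fun s => D (x, s)) t = iteratedDeriv 2 (fun y => D (y, t)) x)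
    (hbd : D (0, t) = 0) (hinf : Tendsto (fun x => D (x, t)) atTop (𝓝 0))
    (hder : ∃ C : ℝ, ∀ x : ℝ, 1 ≤ x → ‖deriv (fun y => D (y, t)) x‖ ≤ C)
    (hint : IntegrableOn (fun x => inner ℝ (D (x, t)) (deriv (fun s => D (x, s)) t)) (Ioi 0)) :
    ∫ x in Ioi (0 : ℝ), inner ℝ (D (x, t)) (deriv (fun s => D (x, s)) t) ≤ 0 := by
  set d₀ : ℝ → ℂ := fun y => D (y, t) with hd₀
  have h0 : ContDiffOn ℝ 2 d₀ (Ici 0) := contDiffOn_slice_x hC ht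
  set d₁ := derivWithin d₀ (Ici 0) with hd₁
  have h1 : ContDiffOn ℝ 1 d₁ (Ici 0) := h0.derivWithin (uniqueDiffOn_Ici 0) (by norm_num)
  set d₂ := derivWithin d₁ (Ici 0) with hd₂
  have c2 : ContinuousOn d₂ (Ici 0) := h1.continuousOn_derivWithin (uniqueDiffOn_Ici 0) le_rfl
  have e0 : ∀ x, 0 < x → HasDerivAt d₀ (d₁ x) x := fun x hx =>
    (h0.differentiableOn (by simp) x hx.le).hasDerivWithinAt.hasDerivAt (Ici_mem_nhds hx)
  have e1 : ∀ x, 0 < x → HasDerivAt d₁ (d₂ x) x := fun x hx =>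
    (h1.differentiableOn (by simp) x hx.le).hasDerivWithinAt.hasDerivAt (Ici_mem_nhds hx)
  have e2 : ∀ x, 0 < x → deriv (fun s => D (x, s)) t = d₂ x := by
    intro x hx
    rw [hpde x hx, iteratedDeriv_two_slice hC hx ht]
  have hcongr : ∀ x ∈ Ioi (0 : ℝ), inner ℝ (D (x, t)) (deriv (fun s => D (x, s)) t) =
      inner ℝ (d₀ x) (d₂ x) := fun x hx => by rw [e2 x hx]
  rw [setIntegral_congr_fun measurableSet_Ioi hcongr]
  have hint' := hint.congr_fun hcongr measurableSet_Ioi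
  have hlim := intervalIntegral_tendsto_integral_Ioi 0 hint' tendsto_id
  -- The boundary term at infinity: D tends to 0 while D_x stays bounded.
  have hΦ : Tendsto (fun R => inner ℝ (d₀ R) (d₁ R)) atTop (𝓝 0) := by
    obtain ⟨C, hCb⟩ := hder
    refine squeeze_zero_norm' (a := fun R => ‖d₀ R‖ * C) ?_ (by simpa using hinf.norm.mul_const C)
    filter_upwards [eventually_ge_atTop 1] with R hR
    refine (norm_inner_le_norm _ _).trans (mul_le_mul_of_nonneg_left ?_ (norm_nonneg _))
    rw [← (e0 R (by linarith)).deriv]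
    exact hCb R hR
  refine le_of_tendsto_of_tendsto hlim hΦ ?_
  filter_upwards [eventually_ge_atTop 0] with R hR
  have hsub : Icc 0 R ⊆ Ici (0 : ℝ) := Icc_subset_Ici_self
  have k0 := h0.continuousOn.mono hsub
  have k1 := h1.continuousOn.mono hsub
  have k2 := c2.mono hsub
  have i1 : IntervalIntegrable (fun x => inner ℝ (d₀ x) (d₂ x)) volume 0 R :=
    ContinuousOn.intervalIntegrable (by rw [uIcc_of_le hR]; exact k0.inner k2)
  have i2 : IntervalIntegrable (fun x => inner ℝ (d₁ x) (d₁ x)) volume 0 R :=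
    ContinuousOn.intervalIntegrable (by rw [uIcc_of_le hR]; exact k1.inner k1)
  -- Integration by parts is done on [0, R] only: D_x is not known to be square integrable, but the
  -- sign of its contribution suffices in the limit.
  have hftc := intervalIntegral.integral_eq_sub_of_hasDerivAt_of_le hR
    (f := fun x => inner ℝ (d₀ x) (d₁ x)) (k0.inner k1)
    (fun x hx => (e0 x hx.1).inner ℝ (e1 x hx.1)) (i1.add i2)
  have hsplit := (intervalIntegral.integral_add i1 i2).symm.trans hftc
  have hz : d₀ 0 = 0 := hbd
  rw [hz, inner_zero_left, sub_zero] at hsplit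
  have hpos : 0 ≤ ∫ x in (0 : ℝ)..R, inner ℝ (d₁ x) (d₁ x) :=
    intervalIntegral.integral_nonneg hR fun x _ => real_inner_self_nonneg
  simp only [id]
  linarith

/-- Uniqueness for the homogeneous problem, by the energy method. -/
lemma eq_zero_of_homogeneous (hC : ContDiffOn ℝ 2 D QbarPunctured)
    (hpde : ∀ x t, 0 < x → 0 < t →
      deriv (fun s => D (x, s)) t = iteratedDeriv 2 (fun y => D (y, t)) x)
    (hinit : ∀ x, 0 < x → Tendsto (fun t => D (x, t)) (𝓝[>] 0) (𝓝 0))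
    (hbd : ∀ t, 0 < t → D (0, t) = 0)
    (hinf : ∀ t, 0 < t → Tendsto (fun x => D (x, t)) atTop (𝓝 0))
    (hder : ∀ t, 0 < t → ∃ C : ℝ, ∀ x : ℝ, 1 ≤ x → ‖deriv (fun y => D (y, t)) x‖ ≤ C)
    (hdom : ∀ T, 0 < T → ∃ B : ℝ → ℝ, IntegrableOn B (Ioi 0) ∧ ∀ x t, 0 < x → 0 < t → t ≤ T →
      ‖D (x, t)‖ ^ 2 ≤ B x ∧ ‖deriv (fun s => D (x, s)) t‖ ^ 2 ≤ B x)
    {x t : ℝ} (hx : 0 < x) (ht : 0 < t) : D (x, t) = 0 := by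
  -- The horizon t + 1 makes t an interior time.
  obtain ⟨B, hBi, hB⟩ := hdom (t + 1) (by linarith)
  set E : ℝ → ℝ := fun s => ∫ x in Ioi (0 : ℝ), ‖D (x, s)‖ ^ 2 with hE
  have hcont : ∀ s, 0 < s → ContinuousOn (fun x => D (x, s)) (Ioi 0) := fun s hs =>
    (contDiffOn_slice_x hC hs).continuousOn.mono Ioi_subset_Ici_self
  have hmeas : ∀ s, 0 < s → AEStronglyMeasurable (fun x => ‖D (x, s)‖ ^ 2)
      (volume.restrict (Ioi 0)) := fun s hs =>
    ((hcont s hs).norm.pow 2).aestronglyMeasurable measurableSet_Ioi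
  have hinner : ∀ y s, 0 < y → 0 < s → s ≤ t + 1 →
      ‖inner ℝ (D (y, s)) (deriv (fun s => D (y, s)) s)‖ ≤ B y := by
    intro y s hy hs hst
    obtain ⟨b1, b2⟩ := hB y s hy hs hst
    refine (norm_inner_le_norm _ _).trans ?_
    nlinarith [sq_nonneg (‖D (y, s)‖ - ‖deriv (fun s => D (y, s)) s‖)]
  have hmeas' : ∀ s, 0 < s → AEStronglyMeasurable
      (fun x => inner ℝ (D (x, s)) (deriv (fun s => D (x, s)) s)) (volume.restrict (Ioi 0)) := by
    intro s hs
    refine AEStronglyMeasurable.inner ((hcont s hs).aestronglyMeasurable measurableSet_Ioi) ?_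
    -- Measurability of D_t in x is read off the equation: it equals D_xx, which is continuous in x.
    have h2 := (contDiffOn_slice_x hC hs).derivWithin (uniqueDiffOn_Ici 0) (m := 1) (by norm_num)
    have c2 := (h2.continuousOn_derivWithin (uniqueDiffOn_Ici 0) le_rfl).mono Ioi_subset_Ici_self
    refine (c2.aestronglyMeasurable measurableSet_Ioi).congr ?_
    filter_upwards [ae_restrict_mem measurableSet_Ioi] with y hy
    rw [hpde y s hy hs, iteratedDeriv_two_slice hC hy hs]
  have hint : ∀ s, 0 < s → s ≤ t + 1 → IntegrableOn
      (fun x => inner ℝ (D (x, s)) (deriv (fun s => D (x, s)) s)) (Ioi 0) := fun s hs hst =>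
    Integrable.mono' hBi (hmeas' s hs) (by
      filter_upwards [ae_restrict_mem measurableSet_Ioi] with y hy using hinner y s hy hs hst)
  have hEder : ∀ s ∈ Ioo 0 (t + 1), HasDerivAt E
      (∫ x in Ioi (0 : ℝ), 2 * inner ℝ (D (x, s)) (deriv (fun s => D (x, s)) s)) s := by
    intro s hs
    refine (hasDerivAt_integral_of_dominated_loc_of_deriv_le (bound := fun x => 2 * B x)
      (F' := fun s x => 2 * inner ℝ (D (x, s)) (deriv (fun s => D (x, s)) s))
      (isOpen_Ioo.mem_nhds hs) ?_ ?_ ((hmeas' s hs.1).const_mul 2) ?_ (hBi.const_mul 2) ?_).2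
    · filter_upwards [isOpen_Ioo.mem_nhds hs] with r hr using hmeas r hr.1
    · refine Integrable.mono' hBi (hmeas s hs.1) ?_
      filter_upwards [ae_restrict_mem measurableSet_Ioi] with y hy
      rw [Real.norm_of_nonneg (by positivity)]
      exact (hB y s hy hs.1 hs.2.le).1
    · filter_upwards [ae_restrict_mem measurableSet_Ioi] with y hy r hr
      rw [norm_mul, Real.norm_ofNat]
      exact mul_le_mul_of_nonneg_left (hinner y r hy hr.1 hr.2.le) zero_le_two
    · filter_upwards [ae_restrict_mem measurableSet_Ioi] with y hy r hr
      exact (hasDerivAt_slice_t hC hy hr.1).norm_sq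
  have hanti : AntitoneOn E (Ioo 0 (t + 1)) := by
    refine antitoneOn_of_deriv_nonpos (convex_Ioo _ _)
      (fun s hs => (hEder s hs).continuousAt.continuousWithinAt) ?_ ?_
    · rw [interior_Ioo]
      exact fun s hs => (hEder s hs).differentiableAt.differentiableWithinAt
    · rw [interior_Ioo]
      intro s hs
      rw [(hEder s hs).deriv, integral_const_mul]
      have := integral_inner_nonpos hC hs.1 (fun y hy => hpde y s hy hs.1) (hbd s hs.1)
        (hinf s hs.1) (hder s hs.1) (hint s hs.1 hs.2.le)
      linarith
  have hnear : ∀ᶠ s in 𝓝[>] (0 : ℝ), s ∈ Ioo 0 t := Ioo_mem_nhdsGT ht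
  have hlim : Tendsto E (𝓝[>] 0) (𝓝 0) := by
    have h := tendsto_integral_filter_of_dominated_convergence (μ := volume.restrict (Ioi 0))
      (l := 𝓝[>] (0 : ℝ)) (F := fun s x => ‖D (x, s)‖ ^ 2) (f := fun _ => (0 : ℝ)) B
      (hnear.mono fun s hs => hmeas s hs.1)
      (hnear.mono fun s hs => by
        filter_upwards [ae_restrict_mem measurableSet_Ioi] with y hy
        rw [Real.norm_of_nonneg (by positivity)]
        exact (hB y s hy hs.1 (by linarith [hs.2])).1) hBi
      (by
        filter_upwards [ae_restrict_mem measurableSet_Ioi] with y hy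
        simpa using (hinit y hy).norm.pow 2)
    simpa using h
  -- The energy decreases on (0, t + 1) and tends to 0 at 0+; its value at time 0 is never used.
  have hEt : E t ≤ 0 := by
    refine ge_of_tendsto hlim (hnear.mono fun s hs => ?_)
    exact hanti ⟨hs.1, by linarith [hs.2]⟩ ⟨ht, by linarith⟩ hs.2.le
  have hsqi : IntegrableOn (fun x => ‖D (x, t)‖ ^ 2) (Ioi 0) := by
    refine Integrable.mono' hBi (hmeas t ht) ?_
    filter_upwards [ae_restrict_mem measurableSet_Ioi] with y hy
    rw [Real.norm_of_nonneg (by positivity)]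
    exact (hB y t hy ht (by linarith)).1
  have hE0 : E t = 0 := le_antisymm hEt (integral_nonneg fun y => by positivity)
  have hae := (integral_eq_zero_iff_of_nonneg (fun y => by positivity) hsqi).1 hE0
  have heq := Measure.eqOn_open_of_ae_eq hae isOpen_Ioi ((hcont t ht).norm.pow 2) continuousOn_const
  simpa using heq (mem_Ioi.2 hx)

end Energy

/-! ### Uniqueness in the solution class. -/

section Uniqueness

variable {u₀ g₀ : ℝ → ℂ} {f V V' : ℝ × ℝ → ℂ}

lemma tendsto_boundary (hV : ContinuousOn V QbarPunctured) {t : ℝ} (ht : 0 < t) :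
    Tendsto (fun x => V (x, t)) (𝓝[>] 0) (𝓝 (V (0, t))) := by
  have h : ContinuousWithinAt (fun x => V (x, t)) (Ioi 0) 0 :=
    ContinuousWithinAt.comp (t := QbarPunctured)
      (hV (0, t) (mem_QbarPunctured.2 ⟨le_rfl, ht.le, Or.inr ht.ne'⟩))
      (by fun_prop : Continuous fun x : ℝ => (x, t)).continuousWithinAt fun x hx =>
        mem_QbarPunctured.2 ⟨(mem_Ioi.1 hx).le, ht.le, Or.inr ht.ne'⟩
  exact h

lemma tendsto_initial (hV : ContinuousOn V QbarPunctured) {x : ℝ} (hx : 0 < x) :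
    Tendsto (fun t => V (x, t)) (𝓝[>] 0) (𝓝 (V (x, 0))) := by
  have h : ContinuousWithinAt (fun t => V (x, t)) (Ioi 0) 0 :=
    ContinuousWithinAt.comp (t := QbarPunctured)
      (hV (x, 0) (mem_QbarPunctured.2 ⟨hx.le, le_rfl, Or.inl hx.ne'⟩))
      (by fun_prop : Continuous fun t : ℝ => (x, t)).continuousWithinAt fun t ht =>
        mem_QbarPunctured.2 ⟨hx.le, (mem_Ioi.1 ht).le, Or.inl hx.ne'⟩
  exact h

lemma IsClassSolution.boundary_eq (hV : IsClassSolution u₀ g₀ f V) {t : ℝ} (ht : 0 < t) :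
    V (0, t) = g₀ t :=
  tendsto_nhds_unique (tendsto_boundary hV.contDiffOn.continuousOn ht) (hV.solves.boundary t ht)

lemma IsClassSolution.initial_eq (hV : IsClassSolution u₀ g₀ f V) {x : ℝ} (hx : 0 < x) :
    V (x, 0) = u₀ x :=
  tendsto_nhds_unique (tendsto_initial hV.contDiffOn.continuousOn hx) (hV.solves.initial x hx)

lemma IsClassSolution.eqOn (hV : IsClassSolution u₀ g₀ f V) (hV' : IsClassSolution u₀ g₀ f V') :
    EqOn V V' QbarPunctured := by
  have hsl : ∀ {V : ℝ × ℝ → ℂ}, ContDiffOn ℝ 2 V QbarPunctured → ∀ {x t : ℝ}, 0 < x → 0 < t →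
      ContDiffAt ℝ 2 (fun y => V (y, t)) x := fun hC x t hx ht =>
    (contDiffOn_slice_x hC ht).contDiffAt (Ici_mem_nhds hx)
  have hdt : ∀ x t, 0 < x → 0 < t → deriv (fun s => V (x, s) - V' (x, s)) t =
      deriv (fun s => V (x, s)) t - deriv (fun s => V' (x, s)) t := fun x t hx ht =>
    ((hasDerivAt_slice_t hV.contDiffOn hx ht).sub (hasDerivAt_slice_t hV'.contDiffOn hx ht)).deriv
  have hint : ∀ x t, 0 < x → 0 < t → V (x, t) - V' (x, t) = 0 := by
    intro x t hx ht
    refine eq_zero_of_homogeneous (hV.contDiffOn.sub hV'.contDiffOn) ?_ ?_ ?_ ?_ ?_ ?_ hx ht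
    · intro x t hx ht
      have h1 := hV.solves.pde x t hx ht
      have h2 := hV'.solves.pde x t hx ht
      have h3 : iteratedDeriv 2 (fun y => V (y, t) - V' (y, t)) x =
          iteratedDeriv 2 (fun y => V (y, t)) x - iteratedDeriv 2 (fun y => V' (y, t)) x :=
        iteratedDeriv_sub (hsl hV.contDiffOn hx ht) (hsl hV'.contDiffOn hx ht)
      rw [hdt x t hx ht, h3]
      linear_combination h1 - h2
    · intro x hx
      simpa using (hV.solves.initial x hx).sub (hV'.solves.initial x hx)
    · intro t ht
      simp [hV.boundary_eq ht, hV'.boundary_eq ht]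
    · intro t ht
      simpa using (hV.tendsto_zero t ht).sub (hV'.tendsto_zero t ht)
    · intro t ht
      obtain ⟨C, hC⟩ := hV.deriv_x_bounded t ht
      obtain ⟨C', hC'⟩ := hV'.deriv_x_bounded t ht
      refine ⟨C + C', fun x hx => ?_⟩
      have hx0 : 0 < x := by linarith
      have h3 : deriv (fun y => V (y, t) - V' (y, t)) x =
          deriv (fun y => V (y, t)) x - deriv (fun y => V' (y, t)) x :=
        deriv_sub ((hsl hV.contDiffOn hx0 ht).differentiableAt (by simp))
          ((hsl hV'.contDiffOn hx0 ht).differentiableAt (by simp))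
      rw [h3]
      exact (norm_sub_le _ _).trans (add_le_add (hC x hx) (hC' x hx))
    · intro T hT
      obtain ⟨B, -, hBi, hB⟩ := hV.dominated T hT
      obtain ⟨B', -, hBi', hB'⟩ := hV'.dominated T hT
      have key : ∀ a b : ℂ, ‖a - b‖ ^ 2 ≤ 2 * ‖a‖ ^ 2 + 2 * ‖b‖ ^ 2 := fun a b => by
        have := norm_sub_le a b
        nlinarith [sq_nonneg (‖a‖ - ‖b‖), norm_nonneg (a - b), norm_nonneg a, norm_nonneg b]
      refine ⟨fun x => 2 * B x + 2 * B' x, (hBi.const_mul 2).add (hBi'.const_mul 2),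
        fun x t hx ht hT => ⟨?_, ?_⟩⟩
      · have := (key (V (x, t)) (V' (x, t)))
        linarith [(hB x t hx ht hT).1, (hB' x t hx ht hT).1]
      · rw [hdt x t hx ht]
        have := key (deriv (fun s => V (x, s)) t) (deriv (fun s => V' (x, s)) t)
        linarith [(hB x t hx ht hT).2, (hB' x t hx ht hT).2]
  rintro ⟨x, t⟩ hp
  obtain ⟨hx, ht, h⟩ := mem_QbarPunctured.1 hp
  rcases hx.eq_or_lt with rfl | hx'
  · have ht' : 0 < t := ht.lt_of_ne' (by simpa using h)
    rw [hV.boundary_eq ht', hV'.boundary_eq ht']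
  · rcases ht.eq_or_lt with rfl | ht'
    · rw [hV.initial_eq hx', hV'.initial_eq hx']
    · exact sub_eq_zero.1 (hint x t hx' ht')

/-- Apart from the C² condition, everything refers to interior derivatives or to limits from the
interior, so values outside the punctured quarter-plane are irrelevant. It transfers the class from
an explicit solution to U. -/
lemma IsClassSolution.congr (hV : IsClassSolution u₀ g₀ f V) (h : EqOn V' V QbarPunctured) :
    IsClassSolution u₀ g₀ f V' := by
  have hin : ∀ x t, 0 < x → 0 < t → V' (x, t) = V (x, t) := fun x t hx ht =>
    h (openQuadrant_subset ⟨mem_Ioi.2 hx, mem_Ioi.2 ht⟩)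
  have et : ∀ x t, 0 < x → 0 < t → (fun s => V' (x, s)) =ᶠ[𝓝 t] fun s => V (x, s) :=
    fun x t hx ht => by filter_upwards [Ioi_mem_nhds ht] with s hs using hin x s hx hs
  have ex : ∀ x t, 0 < x → 0 < t → (fun y => V' (y, t)) =ᶠ[𝓝 x] fun y => V (y, t) :=
    fun x t hx ht => by filter_upwards [Ioi_mem_nhds hx] with y hy using hin y t hy ht
  refine ⟨hV.contDiffOn.congr h, ⟨fun x t hx ht => ?_, fun x hx => ?_, fun t ht => ?_⟩,
    fun t ht => ?_, fun t ht => ?_, fun T hT => ?_⟩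
  · rw [(et x t hx ht).deriv_eq, (ex x t hx ht).iteratedDeriv_eq, hV.solves.pde x t hx ht]
  · refine (hV.solves.initial x hx).congr' ?_
    filter_upwards [self_mem_nhdsWithin] with t ht using (hin x t hx ht).symm
  · refine (hV.solves.boundary t ht).congr' ?_
    filter_upwards [self_mem_nhdsWithin] with x hx using (hin x t hx ht).symm
  · refine (hV.tendsto_zero t ht).congr' ?_
    filter_upwards [Ioi_mem_atTop 0] with x hx using (hin x t hx ht).symm
  · obtain ⟨C, hC⟩ := hV.deriv_x_bounded t ht
    refine ⟨C, fun x hx => ?_⟩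
    rw [(ex x t (by linarith) ht).deriv_eq]
    exact hC x hx
  · obtain ⟨B, hB0, hBi, hB⟩ := hV.dominated T hT
    refine ⟨B, hB0, hBi, fun x t hx ht htT => ?_⟩
    rw [hin x t hx ht, (et x t hx ht).deriv_eq]
    exact hB x t hx ht htT

end Uniqueness

/-! ### Existence: a layer plus corrected heat and Duhamel terms. -/

/-- Decay like `1 / (1 + x²)`, uniformly on bounded time intervals. -/
def HasDecay (G : ℝ × ℝ → ℂ) : Prop :=
  ∀ T : ℝ, ∃ C : ℝ, ∀ x t, 0 ≤ x → 0 ≤ t → t ≤ T → ‖G (x, t)‖ ≤ C / (1 + x ^ 2)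

lemma HasDecay.add {G H : ℝ × ℝ → ℂ} (hG : HasDecay G) (hH : HasDecay H) : HasDecay (G + H) := by
  intro T
  obtain ⟨C, hC⟩ := hG T
  obtain ⟨D, hD⟩ := hH T
  refine ⟨C + D, fun x t hx ht hT => ?_⟩
  rw [add_div]
  exact (norm_add_le _ _).trans (add_le_add (hC x t hx ht hT) (hD x t hx ht hT))

lemma DecayChain.hasDecay_heat {φ : ℕ → ℝ × ℝ → ℂ} (hφ : DecayChain φ) {ε : ℝ} (hε : |ε| = 1)
    (j : ℕ) : HasDecay fun p => gaussAvg (reflect ε (φ j)) p.1 (√p.2) 0 := by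
  intro T
  obtain ⟨M, hM0, hM⟩ := norm_gaussAvg_le_of_decay T
  obtain ⟨C, hC⟩ := reflect_decay hε (hφ.decay j) 0
  have hC0 : 0 ≤ C := by simpa using (norm_nonneg _).trans (hC 0 0 le_rfl)
  refine ⟨M * C, fun x t _ ht hT => ?_⟩
  exact hM _ C 0 hC0 (fun x => hC x 0 le_rfl) x _ (by rwa [Real.sq_sqrt ht])

lemma DecayChain.hasDecay_duhamel {ψ : ℕ → ℝ × ℝ → ℂ} (hψ : DecayChain ψ) {ε : ℝ} (hε : |ε| = 1)
    (j : ℕ) : HasDecay fun p => duhamel (reflect ε (ψ j)) p.1 p.2 := by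
  intro T
  obtain ⟨C, hC⟩ := norm_duhamel_le_of_decay (reflect_decay hε (hψ.decay j)) T
  exact ⟨C, fun x t _ => hC x t⟩

/-- The superposition of a boundary layer, the heat evolution of the initial data and Duhamel's
integral of the forcing. -/
def superposition (w : Fin 3 → ℝ → ℂ) (φ ψ : ℝ × ℝ → ℂ) (p : ℝ × ℝ) : ℂ :=
  expSum w 0 p + gaussAvg (reflect (-1) φ) p.1 (√p.2) 0 + duhamel (reflect (-1) ψ) p.1 p.2

lemma contDiffOn_expSum {w : Fin 3 → ℝ → ℂ} (hw : ∀ i, ContDiffOn ℝ ∞ (w i) (Ici 0)) (j : ℕ) :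
    ContDiffOn ℝ ∞ (expSum w j) Qbar := by
  refine ContDiffOn.sum fun i _ => ContDiffOn.mul ?_
    ((hw i).comp contDiff_snd.contDiffOn fun p hp => hp.2)
  refine ContDiff.contDiffOn ?_
  have h : ContDiff ℝ ∞ fun p : ℝ × ℝ =>
      (-((i : ℝ) + 1)) ^ j * Real.exp (-((i : ℝ) + 1) * p.1) := by fun_prop
  exact Complex.ofRealCLM.contDiff.comp h

lemma hasDerivAt_expSum_t {w : Fin 3 → ℝ → ℂ} (hw : ∀ i, ContDiffOn ℝ ∞ (w i) (Ici 0)) (j : ℕ)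
    (x : ℝ) {t : ℝ} (ht : 0 < t) : HasDerivAt (fun t => expSum w j (x, t))
      (expSum (fun i => derivWithin (w i) (Ici 0)) j (x, t)) t :=
  HasDerivAt.fun_sum fun i _ => (((hw i).differentiableOn (by simp) t
    ht.le).hasDerivWithinAt.hasDerivAt (Ici_mem_nhds ht)).const_mul
      (((-((i : ℝ) + 1)) ^ j * Real.exp (-((i : ℝ) + 1) * x) : ℝ) : ℂ)

lemma contDiffOn_derivWithin_Ici {w : ℝ → ℂ} (hw : ContDiffOn ℝ ∞ w (Ici 0)) :
    ContDiffOn ℝ ∞ (derivWithin w (Ici 0)) (Ici 0) :=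
  hw.derivWithin (uniqueDiffOn_Ici 0) (by simp)

/-- Vanishing of the orders 0 and 2 at x = 0 lets the odd reflections be differentiated four times,
which gives C². In V_t - V_xx the heat term cancels, Duhamel's integral leaves ψ₀ and the layer
leaves its own defect. At x = 0 only the layer survives, by oddness. -/
lemma isClassSolution_superposition {u₀ g₀ : ℝ → ℂ} {f : ℝ × ℝ → ℂ} {w : Fin 3 → ℝ → ℂ}
    {φ ψ : ℕ → ℝ × ℝ → ℂ} (hw : ∀ i, ContDiffOn ℝ ∞ (w i) (Ici 0)) (hφ : DecayChain φ)
    (hψ : DecayChain ψ) (φ₀ : ∀ t, 0 ≤ t → φ 0 (0, t) = 0) (φ₂ : ∀ t, 0 ≤ t → φ 2 (0, t) = 0)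
    (ψ₀ : ∀ t, 0 ≤ t → ψ 0 (0, t) = 0) (ψ₂ : ∀ t, 0 ≤ t → ψ 2 (0, t) = 0)
    (hψC : ContDiffOn ℝ ∞ (ψ 0) Qbar)
    (hu : ∀ x, 0 < x → expSum w 0 (x, 0) + φ 0 (x, 0) = u₀ x)
    (hg : ∀ t, 0 < t → expSum w 0 (0, t) = g₀ t)
    (hf : ∀ x t, 0 < x → 0 < t → expSum (fun i => derivWithin (w i) (Ici 0)) 0 (x, t) -
      expSum w 2 (x, t) + ψ 0 (x, t) = f (x, t)) :
    IsClassSolution u₀ g₀ f (superposition w (φ 0) (ψ 0)) := by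
  have n1 : |(-1 : ℝ)| = 1 := by simp
  have p1 : |(1 : ℝ)| = 1 := by simp
  have hsub : QbarPunctured ⊆ Qbar := sdiff_subset
  have hrefl : ∀ (ε : ℝ) (j : ℕ), EqOn (reflect ε (ψ j)) (ψ j) QbarPunctured := fun ε j p hp =>
    reflect_of_nonneg hp.1.1 hp.1.2
  have hdec_w : ∀ {w : Fin 3 → ℝ → ℂ}, (∀ i, ContDiffOn ℝ ∞ (w i) (Ici 0)) → ∀ j,
      HasDecay (expSum w j) := fun hw j =>
    (decayChain_expSum fun i => (hw i).continuousOn).decay j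
  have hC : ContDiffOn ℝ 2 (superposition w (φ 0) (ψ 0)) QbarPunctured := by
    refine ((((contDiffOn_expSum hw 0).of_le (WithTop.coe_le_coe.2 le_top)).mono hsub).add
      (contDiffOn_two_heat (hφ.tame n1 0) (hφ.tame p1 1) (hφ.tame n1 2) (hφ.tame p1 3)
        (hφ.tame n1 4) (hφ.isXDeriv_odd φ₀) (hφ.isXDeriv_even 1) (hφ.isXDeriv_odd φ₂)
        (hφ.isXDeriv_even 3))).add
      (contDiffOn_two_duhamel (hψ.tame n1 0) (hψ.tame p1 1) (hψ.tame n1 2) (hψ.tame p1 3)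
        (hψ.tame n1 4) (hψ.isXDeriv_odd ψ₀) (hψ.isXDeriv_even 1) (hψ.isXDeriv_odd ψ₂)
        (hψ.isXDeriv_even 3) ?_ ?_ ?_)
    · exact ((hψC.of_le (WithTop.coe_le_coe.2 le_top)).mono hsub).congr (hrefl _ _)
    · exact ((hψ.continuousOn 1).mono hsub).congr (hrefl _ _)
    · exact ((hψ.continuousOn 2).mono hsub).congr (hrefl _ _)
  set V₁ : ℝ × ℝ → ℂ := expSum w 1 + (fun p => gaussAvg (reflect 1 (φ 1)) p.1 (√p.2) 0) +
    fun p => duhamel (reflect 1 (ψ 1)) p.1 p.2 with hV₁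
  set V₂ : ℝ × ℝ → ℂ := expSum w 2 + (fun p => gaussAvg (reflect (-1) (φ 2)) p.1 (√p.2) 0) +
    fun p => duhamel (reflect (-1) (ψ 2)) p.1 p.2 with hV₂
  set Vt : ℝ × ℝ → ℂ := expSum (fun i => derivWithin (w i) (Ici 0)) 0 +
    (fun p => gaussAvg (reflect (-1) (φ 2)) p.1 (√p.2) 0) +
    (ψ 0 + fun p => duhamel (reflect (-1) (ψ 2)) p.1 p.2) with hVt
  have dx : ∀ x t, 0 < x → 0 < t →
      HasDerivAt (fun y => superposition w (φ 0) (ψ 0) (y, t)) (V₁ (x, t)) x := fun x t hx ht =>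
    ((hasDerivAt_expSum w 0 x t).add ((hφ.isXDeriv_odd φ₀).hasDerivAt_gaussAvg (a := √t) (hφ.tame n1 0)
      (hφ.tame p1 1) (Or.inl hx.ne') 0)).add
      ((hψ.isXDeriv_odd ψ₀).hasDerivAt_duhamel_x (hψ.tame n1 0) (hψ.tame p1 1) hx.ne' ht.le)
  have dxx : ∀ x t, 0 < x → 0 < t → HasDerivAt (fun y => V₁ (y, t)) (V₂ (x, t)) x :=
    fun x t hx ht =>
    ((hasDerivAt_expSum w 1 x t).add ((hφ.isXDeriv_even 1).hasDerivAt_gaussAvg (a := √t) (hφ.tame p1 1)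
      (hφ.tame n1 2) (Or.inl hx.ne') 0)).add
      ((hψ.isXDeriv_even 1).hasDerivAt_duhamel_x (hψ.tame p1 1) (hψ.tame n1 2) hx.ne' ht.le)
  have dt : ∀ x t, 0 < x → 0 < t →
      HasDerivAt (fun s => superposition w (φ 0) (ψ 0) (x, s)) (Vt (x, t)) t := by
    intro x t hx ht
    have h := ((hasDerivAt_expSum_t hw 0 x ht).add
      ((hφ.isXDeriv_odd φ₀).hasDerivAt_gaussAvg_sqrt (hφ.isXDeriv_even 1) (hφ.tame n1 0)
        (hφ.tame p1 1) (hφ.tame n1 2) x ht 0)).add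
      ((hψ.isXDeriv_odd ψ₀).hasDerivAt_duhamel_t (hψ.isXDeriv_even 1) (hψ.tame n1 0)
        (hψ.tame p1 1) (hψ.tame n1 2) hx.ne' ht)
    rw [reflect_of_nonneg hx.le ht.le] at h
    exact h
  have decV : HasDecay (superposition w (φ 0) (ψ 0)) :=
    ((hdec_w hw 0).add (hφ.hasDecay_heat n1 0)).add (hψ.hasDecay_duhamel n1 0)
  have decVt : HasDecay Vt :=
    ((hdec_w (fun i => contDiffOn_derivWithin_Ici (hw i)) 0).add (hφ.hasDecay_heat n1 2)).add
      (HasDecay.add (hψ.decay 0) (hψ.hasDecay_duhamel n1 2))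
  have decV₁ : HasDecay V₁ :=
    ((hdec_w hw 1).add (hφ.hasDecay_heat p1 1)).add (hψ.hasDecay_duhamel p1 1)
  refine ⟨hC, ⟨fun x t hx ht => ?_, fun x hx => ?_, fun t ht => ?_⟩, fun t ht => ?_, fun t ht => ?_,
    fun T hT => ?_⟩
  · have e : iteratedDeriv 2 (fun y => superposition w (φ 0) (ψ 0) (y, t)) x = V₂ (x, t) := by
      rw [iteratedDeriv_succ, iteratedDeriv_one]
      refine ((dxx x t hx ht).congr_of_eventuallyEq ?_).deriv
      filter_upwards [Ioi_mem_nhds hx] with y hy using (dx y t hy ht).deriv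
    rw [(dt x t hx ht).deriv, e, ← hf x t hx ht]
    simp only [hVt, hV₂, Pi.add_apply]
    ring
  · have h := tendsto_initial hC.continuousOn hx
    have e : superposition w (φ 0) (ψ 0) (x, 0) = u₀ x := by
      simp only [superposition, Real.sqrt_zero, gaussAvg_zero, duhamel_zero, add_zero,
        reflect_of_nonneg hx.le le_rfl, hu x hx]
    rwa [e] at h
  · have h := tendsto_boundary hC.continuousOn ht
    have e : superposition w (φ 0) (ψ 0) (0, t) = g₀ t := by
      simp only [superposition, gaussAvg_zero_of_odd (reflect_odd φ₀ · 0),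
        duhamel_zero_of_odd (reflect_odd ψ₀), add_zero, hg t ht]
    rwa [e] at h
  · obtain ⟨C, hCb⟩ := decV t
    refine squeeze_zero_norm' (a := fun x => C / (1 + x ^ 2)) ?_ ?_
    · filter_upwards [eventually_ge_atTop 0] with x hx using hCb x t hx ht.le le_rfl
    · exact tendsto_const_nhds.div_atTop
        (tendsto_atTop_add_const_left _ _ (tendsto_pow_atTop two_ne_zero))
  · obtain ⟨C, hCb⟩ := bounded_of_decay decV₁ t
    refine ⟨C, fun x hx => ?_⟩
    rw [(dx x t (by linarith) ht).deriv]
    exact hCb x t (by linarith) ht.le le_rfl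
  · obtain ⟨C, hCb⟩ := decV T
    obtain ⟨D, hDb⟩ := decVt T
    have key : ∀ (x K : ℝ) (v : ℂ), ‖v‖ ≤ K / (1 + x ^ 2) → ‖v‖ ^ 2 ≤ K ^ 2 * (1 + x ^ 2)⁻¹ := by
      intro x K v hv
      have h1 : (1 + x ^ 2)⁻¹ ≤ 1 := inv_le_one_of_one_le₀ (by nlinarith [sq_nonneg x])
      have h2 : 0 < (1 + x ^ 2)⁻¹ := by positivity
      calc ‖v‖ ^ 2 ≤ (K / (1 + x ^ 2)) ^ 2 := by gcongr
        _ = K ^ 2 * ((1 + x ^ 2)⁻¹ * (1 + x ^ 2)⁻¹) := by rw [div_eq_mul_inv]; ring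
        _ ≤ K ^ 2 * (1 + x ^ 2)⁻¹ := by
          refine mul_le_mul_of_nonneg_left ?_ (sq_nonneg K)
          exact mul_le_of_le_one_left h2.le h1
    -- One function majorizes both squares; the summand 1 makes it strictly positive even if C = D =
    -- 0.
    refine ⟨fun x => (C ^ 2 + D ^ 2 + 1) * (1 + x ^ 2)⁻¹, fun x _ => by positivity,
      (integrable_inv_one_add_sq.const_mul _).integrableOn, fun x t hx ht htT => ⟨?_, ?_⟩⟩
    · refine (key x C _ (hCb x t hx.le ht.le htT)).trans ?_
      exact mul_le_mul_of_nonneg_right (by nlinarith [sq_nonneg D]) (by positivity)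
    · rw [(dt x t hx ht).deriv]
      refine (key x D _ (hDb x t hx.le ht.le htT)).trans ?_
      exact mul_le_mul_of_nonneg_right (by nlinarith [sq_nonneg C]) (by positivity)

/-! ### Matching the superposition with the unified transform formula. -/

lemma reflect_add (ε : ℝ) (φ ψ : ℝ × ℝ → ℂ) :
    reflect ε (φ + ψ) = reflect ε φ + reflect ε ψ := by
  funext p
  simp only [reflect, Pi.add_apply]
  split_ifs <;> ring

lemma gaussAvg_reflect_expSum (c : Fin 3 → ℝ → ℂ) (x a : ℝ) {s : ℝ} (hs : 0 ≤ s) :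
    gaussAvg (reflect (-1) (expSum c 0)) x a s =
      ∑ i : Fin 3, gaussAvg (oddExp ((i : ℝ) + 1)) x a 0 * c i s := by
  have e : ∀ z : ℝ, (gaussDensity z : ℂ) * reflect (-1) (expSum c 0) (x + a * z, s) =
      ∑ i : Fin 3, (gaussDensity z : ℂ) * oddExp ((i : ℝ) + 1) (x + a * z, 0) * c i s := by
    intro z
    simp only [reflect, expSum, oddExp, max_eq_left hs, pow_zero, one_mul]
    split_ifs
    · rw [Finset.mul_sum]
      simp_rw [mul_assoc]
    · rw [Finset.mul_sum, Finset.mul_sum]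
      refine Finset.sum_congr rfl fun i _ => ?_
      ring
  simp only [gaussAvg, e]
  rw [integral_finsetSum _ fun (i : Fin 3) _ =>
    ((tame_oddExp (κ := (i : ℝ) + 1) (by positivity)).integrable x a 0).mul_const (c i s)]
  simp_rw [integral_mul_const]

lemma Tame.duhamel_add {F G : ℝ × ℝ → ℂ} (hF : Tame F) (hG : Tame G) (x t : ℝ) :
    duhamel (F + G) x t = duhamel F x t + duhamel G x t := by
  simp only [duhamel, hF.gaussAvg_add hG]
  exact intervalIntegral.integral_add (hF.intervalIntegrable_duhamel x t 0 t)
    (hG.intervalIntegrable_duhamel x t 0 t)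

/-- The half-line representation formula for a boundary layer. -/
lemma expSum_eq_halfLine {w : Fin 3 → ℝ → ℂ} (hw : ∀ i, ContDiffOn ℝ ∞ (w i) (Ici 0)) {g : ℝ → ℂ}
    (hg : ∀ t, 0 ≤ t → ∑ i, w i t = g t) {x t : ℝ} (hx : 0 < x) (ht : 0 ≤ t) :
    expSum w 0 (x, t) = gaussAvg (reflect (-1) (expSum (fun i _ => w i 0) 0)) x (√t) 0 +
      (∫ τ in (0 : ℝ)..t, (poissonKernel x (t - τ) : ℂ) * g τ) +
      duhamel (reflect (-1) (expSum
        (fun i τ => derivWithin (w i) (Ici 0) τ - ((i : ℝ) + 1 : ℝ) ^ 2 * w i τ) 0)) x t := by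
  have h1 : ∫ τ in (0 : ℝ)..t, (poissonKernel x (t - τ) : ℂ) * g τ =
      ∑ i, ∫ τ in (0 : ℝ)..t, (poissonKernel x (t - τ) : ℂ) * w i τ := by
    rw [← intervalIntegral.integral_finsetSum fun i _ =>
      intervalIntegrable_poissonKernel_mul hx ht (hw i).continuousOn]
    refine intervalIntegral.integral_congr fun τ hτ => ?_
    rw [uIcc_of_le ht] at hτ
    simp only [← Finset.mul_sum, hg τ hτ.1]
  have h2 : duhamel (reflect (-1) (expSum
      (fun i τ => derivWithin (w i) (Ici 0) τ - ((i : ℝ) + 1 : ℝ) ^ 2 * w i τ) 0)) x t =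
      ∑ i : Fin 3, ∫ τ in (0 : ℝ)..t, gaussAvg (oddExp ((i : ℝ) + 1)) x (√(t - τ)) 0 *
        (derivWithin (w i) (Ici 0) τ - ((i : ℝ) + 1 : ℝ) ^ 2 * w i τ) := by
    rw [← intervalIntegral.integral_finsetSum fun i _ => ?_]
    · refine intervalIntegral.integral_congr fun τ hτ => ?_
      rw [uIcc_of_le ht] at hτ
      simp only [gaussAvg_reflect_expSum _ _ _ hτ.1]
    · refine ContinuousOn.intervalIntegrable ?_
      rw [uIcc_of_le ht]
      have hκ : (0 : ℝ) ≤ (i : ℝ) + 1 := by positivity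
      refine ContinuousOn.mul (Continuous.continuousOn
        (((tame_oddExp hκ).continuousOn_gaussAvg_sqrt hx.ne' 0).comp (by fun_prop))) ?_
      have k := (contDiffOn_derivWithin_Ici (hw i)).continuousOn.sub
        ((continuousOn_const (c := (((i : ℝ) + 1 : ℝ) : ℂ) ^ 2)).mul (hw i).continuousOn)
      exact k.mono Icc_subset_Ici_self
  rw [h1, h2, gaussAvg_reflect_expSum _ _ _ le_rfl, ← Finset.sum_add_distrib,
    ← Finset.sum_add_distrib]
  simp only [expSum, pow_zero, one_mul]
  refine Finset.sum_congr rfl fun i _ => ?_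
  exact exp_mul_eq_halfLine (by positivity) hx ht (hw i)

/-- Three exponentials interpolate prescribed values of the even derivatives at `0`. -/
lemma exists_boundaryLayer {a b c : ℝ → ℂ} (ha : ContDiffOn ℝ ∞ a (Ici 0))
    (hb : ContDiffOn ℝ ∞ b (Ici 0)) (hc : ContDiffOn ℝ ∞ c (Ici 0)) :
    ∃ w : Fin 3 → ℝ → ℂ, (∀ i, ContDiffOn ℝ ∞ (w i) (Ici 0)) ∧
      (∀ t, w 0 t + w 1 t + w 2 t = a t) ∧ (∀ t, w 0 t + 4 * w 1 t + 9 * w 2 t = b t) ∧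
      ∀ t, w 0 t + 16 * w 1 t + 81 * w 2 t = c t := by
  have hlin : ∀ p q r : ℂ, ContDiffOn ℝ ∞ (fun t => p * c t + q * b t + r * a t) (Ici 0) :=
    fun p q r => ((contDiffOn_const.mul hc).add (contDiffOn_const.mul hb)).add
      (contDiffOn_const.mul ha)
  -- The inverse Vandermonde matrix for the nodes 1, 4, 9, the squares of the rates 1, 2, 3: each
  -- row holds the coefficients of a Lagrange polynomial, such as (y² - 13y + 36)/24 for the node 1.
  refine ⟨![fun t => (1 / 24) * c t + (-13 / 24) * b t + (36 / 24) * a t,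
    fun t => (-1 / 15) * c t + (10 / 15) * b t + (-9 / 15) * a t,
    fun t => (1 / 40) * c t + (-5 / 40) * b t + (4 / 40) * a t], ?_, ?_, ?_, ?_⟩
  · intro i
    fin_cases i
    · exact hlin _ _ _
    · exact hlin _ _ _
    · exact hlin _ _ _
  all_goals
    intro t
    simp only [Matrix.cons_val_zero, Matrix.cons_val_one, Matrix.cons_val]
    ring

lemma expSum_zero_apply_zero (w : Fin 3 → ℝ → ℂ) (t : ℝ) :
    expSum w 0 (0, t) = w 0 t + w 1 t + w 2 t := by
  simp [expSum, Fin.sum_univ_three]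

lemma expSum_two_apply_zero (w : Fin 3 → ℝ → ℂ) (t : ℝ) :
    expSum w 2 (0, t) = w 0 t + 4 * w 1 t + 9 * w 2 t := by
  simp [expSum, Fin.sum_univ_three]
  norm_num

lemma derivWithin_combination {w : Fin 3 → ℝ → ℂ} (hw : ∀ i, ContDiffOn ℝ ∞ (w i) (Ici 0))
    {a : ℝ → ℂ} {p q : ℂ} (h : ∀ t, w 0 t + p * w 1 t + q * w 2 t = a t) {t : ℝ} (ht : 0 ≤ t) :
    derivWithin (w 0) (Ici 0) t + p * derivWithin (w 1) (Ici 0) t +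
      q * derivWithin (w 2) (Ici 0) t = derivWithin a (Ici 0) t := by
  have hd : ∀ i, HasDerivWithinAt (w i) (derivWithin (w i) (Ici 0) t) (Ici 0) t := fun i =>
    ((hw i).differentiableOn (by simp) t ht).hasDerivWithinAt
  have h1 := ((hd 0).add ((hd 1).const_mul p)).add ((hd 2).const_mul q)
  rw [← h1.derivWithin (uniqueDiffOn_Ici 0 t ht)]
  exact congrArg (fun a => derivWithin a (Ici 0) t) (funext h)

/-- The unified transform formula defines a solution of the expected class. -/
lemma isClassSolution_utmSolution {u₀ g₀ : ℝ → ℂ} {f : ℝ × ℝ → ℂ} (hu₀ : IsSchwartzHalfLine u₀)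
    (hg₀ : ContDiffOn ℝ ∞ g₀ (Ici 0)) (hf : IsAdmissibleForcing f) (hcompat₀ : u₀ 0 = g₀ 0)
    (hcompat₁ : iteratedDerivWithin 2 u₀ (Ici 0) 0 + f (0, 0) = derivWithin g₀ (Ici 0) 0) :
    IsClassSolution u₀ g₀ f (utmSolution u₀ g₀ f) := by
  have hline : ∀ {h : ℝ × ℝ → ℂ}, ContDiffOn ℝ ∞ h Qbar →
      ContDiffOn ℝ ∞ (fun t => h (0, t)) (Ici 0) := fun hh =>
    hh.comp (contDiff_prodMk_right 0).contDiffOn fun _ ht => ⟨le_rfl, ht⟩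
  -- The value that the equation forces on V_xx(0, t).
  set a : ℝ → ℂ := fun t => derivWithin g₀ (Ici 0) t - f (0, t) with ha
  have hac : ContDiffOn ℝ ∞ a (Ici 0) := (contDiffOn_derivWithin_Ici hg₀).sub (hline hf.1)
  -- The value forced on V_xxxx(0, t), from the equation differentiated twice in x, where V_xxt(0,
  -- t) = a'(t).
  set b : ℝ → ℂ := fun t => derivWithin a (Ici 0) t - xDeriv f 2 (0, t) with hb
  have hbc : ContDiffOn ℝ ∞ b (Ici 0) :=
    (contDiffOn_derivWithin_Ici hac).sub (hline (contDiffOn_xDeriv hf.1 2))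
  obtain ⟨w, hw, w0, w2, w4⟩ := exists_boundaryLayer hg₀ hac hbc
  set c : Fin 3 → ℝ → ℂ :=
    fun i t => derivWithin (w i) (Ici 0) t - ((i : ℝ) + 1 : ℝ) ^ 2 * w i t with hc
  have hcc : ∀ i, ContDiffOn ℝ ∞ (c i) (Ici 0) := fun i =>
    (contDiffOn_derivWithin_Ici (hw i)).sub (contDiffOn_const.mul (hw i))
  have hu := hu₀.isAdmissibleForcing
  have chu : DecayChain (expSum fun i _ => w i 0) := decayChain_expSum fun _ => continuousOn_const
  have chf : DecayChain (expSum c) := decayChain_expSum fun i => (hcc i).continuousOn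
  set φ : ℕ → ℝ × ℝ → ℂ :=
    fun j => xDeriv (fun p => u₀ p.1) j - expSum (fun i _ => w i 0) j with hφdef
  set ψ : ℕ → ℝ × ℝ → ℂ := fun j => xDeriv f j - expSum c j with hψdef
  have hφ : DecayChain φ := hu.decayChain.sub chu
  have hψ : DecayChain ψ := hf.decayChain.sub chf
  have d0 : ∀ t, 0 ≤ t → derivWithin (w 0) (Ici 0) t + derivWithin (w 1) (Ici 0) t +
      derivWithin (w 2) (Ici 0) t = derivWithin g₀ (Ici 0) t := fun t ht => by
    simpa using derivWithin_combination hw (a := g₀) (p := 1) (q := 1) (by simpa using w0) ht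
  have d2 := fun t ht => derivWithin_combination hw w2 (t := t) ht
  have hsol : IsClassSolution u₀ g₀ f (superposition w (φ 0) (ψ 0)) := by
    refine isClassSolution_superposition hw hφ hψ ?_ ?_ ?_ ?_ ?_ ?_ ?_ ?_
    -- At the corner the layer takes the value g₀(0), so this is the first compatibility condition.
    · intro t _
      simp only [hφdef, Pi.sub_apply, xDeriv_zero, expSum_zero_apply_zero, w0, hcompat₀, sub_self]
    -- The second derivative of the layer at the corner is g₀'(0) - f(0, 0), so this is the second
    -- compatibility condition. No condition of order four is needed, since φ₄ may jump.
    · intro t _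
      simp only [hφdef, Pi.sub_apply, expSum_two_apply_zero, w2, ha, xDeriv, ← hcompat₁]
      ring
    · intro t ht
      have h1 := d0 t ht
      have h2 := w2 t
      simp only [hψdef, Pi.sub_apply, xDeriv_zero, expSum_zero_apply_zero, hc]
      simp only [ha] at h2
      norm_num
      linear_combination -h1 + h2
    · intro t ht
      have h1 := d2 t ht
      have h2 := w4 t
      simp only [hψdef, Pi.sub_apply, expSum_two_apply_zero, hc]
      simp only [hb] at h2
      norm_num
      linear_combination -h1 + h2
    · simp only [hψdef, xDeriv_zero]
      exact hf.1.sub (contDiffOn_expSum hcc 0)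
    · intro x _
      simp only [hφdef, Pi.sub_apply, xDeriv_zero, expSum]
      ring
    · intro t _
      rw [expSum_zero_apply_zero, w0]
    · intro x t _ _
      simp only [hψdef, Pi.sub_apply, xDeriv_zero, expSum, hc, Fin.sum_univ_three]
      push_cast
      ring
  refine hsol.congr ?_
  rintro ⟨x, t⟩ hp
  obtain ⟨hx, ht, h⟩ := mem_QbarPunctured.1 hp
  rcases hx.eq_or_lt with rfl | hx'
  · have ht' : 0 < t := ht.lt_of_ne' (by simpa using h)
    rw [hsol.boundary_eq ht']
    simp [utmSolution]
  rcases ht.eq_or_lt with rfl | ht'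
  · rw [hsol.initial_eq hx']
    simp [utmSolution, not_le.2 hx']
  have hut : utmSolution u₀ g₀ f (x, t) = utm u₀ g₀ f x t := by
    simp [utmSolution, not_le.2 hx', not_le.2 ht']
  -- Splitting u₀ and f into the corrected parts and the data of the layer. By linearity the
  -- half-line representation of U becomes the corrected heat and Duhamel terms plus exactly the
  -- representation of the layer.
  have e1 : reflect (-1) (fun p => u₀ p.1) =
      reflect (-1) (φ 0) + reflect (-1) (expSum (fun i _ => w i 0) 0) := by
    rw [← reflect_add]
    simp only [hφdef, xDeriv_zero, sub_add_cancel]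
  have e2 : reflect (-1) f = reflect (-1) (ψ 0) + reflect (-1) (expSum c 0) := by
    rw [← reflect_add]
    simp only [hψdef, xDeriv_zero, sub_add_cancel]
  have n1 : |(-1 : ℝ)| = 1 := by simp
  have hrep := expSum_eq_halfLine hw (g := g₀)
    (fun t _ => by rw [Fin.sum_univ_three, w0]) hx' ht
  rw [hut, (utm_eq_halfLine hu₀ hg₀.continuousOn hf hx' ht').2, e1, e2,
    (hφ.tame n1 0).gaussAvg_add (chu.tame n1 0), (hψ.tame n1 0).duhamel_add (chf.tame n1 0),
    superposition, hrep]
  ring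

end HeatUTM

end

theorem theorem4 (u₀ g₀ : ℝ → ℂ) (f : ℝ × ℝ → ℂ)
    (hu₀ : HeatUTM.IsSchwartzHalfLine u₀)
    (hg₀ : ContDiffOn ℝ ∞ g₀ (Ici 0))
    (hf : HeatUTM.IsAdmissibleForcing f)
    (hcompat₀ : u₀ 0 = g₀ 0)
    (hcompat₁ : iteratedDerivWithin 2 u₀ (Ici 0) 0 + f (0, 0) = derivWithin g₀ (Ici 0) 0) :
    (∀ x t : ℝ, 0 < x → 0 < t → HeatUTM.UTMConverges u₀ g₀ f x t) ∧
    HeatUTM.IsClassSolution u₀ g₀ f (HeatUTM.utmSolution u₀ g₀ f) ∧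
    ∀ V : ℝ × ℝ → ℂ, HeatUTM.IsClassSolution u₀ g₀ f V →
      EqOn V (HeatUTM.utmSolution u₀ g₀ f) HeatUTM.QbarPunctured := by
  have h := HeatUTM.isClassSolution_utmSolution hu₀ hg₀ hf hcompat₀ hcompat₁
  exact ⟨fun x t hx ht => (HeatUTM.utm_eq_halfLine hu₀ hg₀.continuousOn hf hx ht).1, h,
    fun V hV => hV.eqOn h⟩
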